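/- Consider the two-user complex Gaussian interference channel $Y_1=X_1+h_{12}X_2+Z_1$, $Y_2=h_{21}X_1+X_2+Z_2$ with $Z_1,Z_2\sim\mathcal{CN}(0,1)$ i.i.d. in time and independent of the inputs, average power constraints $\|X_i^n\|^2\le nP_i$ with $P_1,P_2>0$, and weak interference $|h_{12}|\le1$, $|h_{21}|\le1$. Its capacity region is the closure of the set of pairs $(R_1,R_2)$ of nonnegative rates for which some sequence of $(2^{nR_1},2^{nR_2})$ codes of block length $n$ has average error probabilities tending to $0$ at both receivers. Logarithms and entropies are to base 2. Let $\kappa=(\sigma_{N_1},\sigma_{N_2},\sigma_{W_1},\sigma_{W_2},\rho_{N_1},\rho_{N_2},\rho_{W_1},\rho_{W_2})$ with $0\le\sigma_{N_i},\sigma_{W_i}\le1$ real and $\rho_{N_i},\rho_{W_i}$ complex of modulus at most $1$. Let $X_{iG}\sim\mathcal{CN}(0,P_i)$ be independent of each other and of all noises, let $N_1\sim\mathcal{CN}(0,\sigma_{N_1}^2)$ be jointly circularly symmetric Gaussian with $Z_1$, $\mathbb E[Z_1N_1^*]=\rho_{N_1}\sigma_{N_1}$, and $W_2\sim\mathcal{CN}(0,\sigma_{W_2}^2)$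 jointly circularly symmetric Gaussian with $Z_2$, $\mathbb E[Z_2W_2^*]=\rho_{W_2}\sigma_{W_2}$, the pairs $(Z_1,N_1)$ and $(Z_2,W_2)$ being independent. Put $Y_{1G}=X_{1G}+h_{12}X_{2G}+Z_1$, $Y_{2G}=h_{21}X_{1G}+X_{2G}+Z_2$, $S_{1G}=h_{21}X_{1G}+N_1$, $U_{2G}=h_{21}X_{1G}+W_2$. Let $V_{N_1}\sim\mathcal{CN}(0,\sigma^2_{V_{N_1}})$ and $V_{W_2}\sim\mathcal{CN}(0,\sigma^2_{V_{W_2}})$ be independent of everything else, with the conditional variances $\sigma^2_{V_{N_1}}=\sigma^2_{Z_1|N_1}$ and $\sigma^2_{V_{W_2}}=\sigma^2_{W_2|Z_2-W_2}$. Suppose that $h_{21}\ne0$ and $$\sigma_{V_{W_2}}^2\ge\min(\sigma_{N_1}^2,\sigma_{W_2}^2),\qquad \sigma_{V_{N_1}}^2\ge\sigma^2_{Z_1-h_{21}^{-1}N_1},\qquad |h_{12}|^2\sigma^2_{Z_2-W_2}\le1,$$ and that the bound is non-degenerate, i.e. $\sigma_{N_1}>0$, $\sigma^2_{Z_2-W_2}>0$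 and $|h_{12}|^2P_2+\sigma^2_{Z_1-h_{21}^{-1}N_1}>0$. Put $$\tilde V_{N_1}=\sqrt{1-\sigma_{V_{N_1}}^{-2}\sigma^2_{Z_1-h_{21}^{-1}N_1}}\;V_{N_1}\ (\text{and } \tilde V_{N_1}=0 \text{ if }\sigma_{V_{N_1}}=0),\qquad \tilde Z_1=\sqrt{1-|h_{12}|^2\sigma^2_{Z_2-W_2}}\;Z_1 .$$ Then every $(R_1,R_2)$ in the capacity region satisfies $$R_1+R_2\le\tfrac12\Big\{h(Y_{1G}|S_{1G})-h(Y_{1G}+\tilde V_{N_1}|S_{1G})+h(Y_{2G}|U_{2G})-h(h_{12}Y_{2G}+\tilde Z_1|U_{2G})+R_0\Big\}$$ $$=\tfrac12\left\{\log\frac{P_1+|h_{12}|^2P_2+1-\frac{|h_{21}^*P_1+\rho_{N_1}\sigma_{N_1}|^2}{|h_{21}|^2P_1+\sigma_{N_1}^2}}{|h_{12}|^2P_2+\sigma_{V_{N_1}}^2-\frac{|\rho_{N_1}\sigma_{N_1}-h_{21}^{-1}\sigma_{N_1}^2|^2}{|h_{21}|^2P_1+\sigma_{N_1}^2}}+\log\frac{P_2+|h_{21}|^2P_1+1-\frac{||h_{21}|^2P_1+\rho_{W_2}\sigma_{W_2}|^2}{|h_{21}|^2P_1+\sigma_{W_2}^2}}{|h_{12}|^2P_2+1-\frac{|h_{12}\rho_{W_2}\sigma_{W_2}-h_{12}\sigma_{W_2}^2|^2}{|h_{21}|^2P_1+\sigma_{W_2}^2}}+R_0\right\},$$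 where $$R_0=h(S_{1G})-h(h_{21}X_{1G}+V_{W_2})+h(U_{2G})-h(Y_{2G}|X_{2G})+h(Y_{1G})-h(N_1)+h(Y_{2G})-h(Z_2-W_2)$$ $$=\log\frac{|h_{21}|^2P_1+\sigma_{N_1}^2}{|h_{21}|^2P_1+\sigma_{V_{W_2}}^2}+\log\frac{|h_{21}|^2P_1+\sigma_{W_2}^2}{|h_{21}|^2P_1+1}+\log\frac{P_1+|h_{12}|^2P_2+1}{\sigma_{N_1}^2}+\log\frac{P_2+|h_{21}|^2P_1+1}{1+\sigma_{W_2}^2-2\,\mathrm{Re}(\rho_{W_2}\sigma_{W_2})}.$$ Interchanging the user indices $1\leftrightarrow2$ throughout (channel and $\kappa$) gives another valid bound under the interchanged conditions. -/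

import Mathlib

open MeasureTheory ProbabilityTheory Filter Topology
open scoped ComplexConjugate

noncomputable section

namespace GIC

/-! ### The two-user complex Gaussian interference channel and its capacity region -/

/-- The law `CN(0,1)`: real and imaginary parts are independent `N(0,1/2)`. -/
def stdCN : Measure ℂ :=
  ((gaussianReal 0 (1 / 2)).prod (gaussianReal 0 (1 / 2))).map
    (fun p : ℝ × ℝ => (p.1 : ℂ) + (p.2 : ℂ) * Complex.I)

/-- Parameters of the channel
`Y₁ = X₁ + h₁₂ X₂ + Z₁`, `Y₂ = h₂₁ X₁ + X₂ + Z₂`, with noises `Z₁, Z₂ ∼ CN(0,1)` and average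
power constraints `P₁`, `P₂` on the inputs. -/
structure Channel where
  h12 : ℂ
  h21 : ℂ
  P1 : ℝ
  P2 : ℝ

/-- The same channel with the user indices interchanged. -/
def Channel.swap (c : Channel) : Channel where
  h12 := c.h21
  h21 := c.h12
  P1 := c.P2
  P2 := c.P1

/-- Weak interference: both cross gains are at most one. -/
def Channel.WeakInterference (c : Channel) : Prop := ‖c.h12‖ ≤ 1 ∧ ‖c.h21‖ ≤ 1

/-- Law of `n` i.i.d. `CN(0,1)` noise samples. -/
def noise (n : ℕ) : Measure (Fin n → ℂ) := Measure.pi (fun _ => stdCN)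

/-- A code of block length `n` with `M₁` and `M₂` messages: deterministic encoders obeying the
power constraints, and (measurable) decoders. -/
structure Code (c : Channel) (n M1 M2 : ℕ) where
  enc1 : Fin M1 → Fin n → ℂ
  enc2 : Fin M2 → Fin n → ℂ
  dec1 : (Fin n → ℂ) → Fin M1
  dec2 : (Fin n → ℂ) → Fin M2
  power1 : ∀ m, ∑ k, ‖enc1 m k‖ ^ 2 ≤ n * c.P1
  power2 : ∀ m, ∑ k, ‖enc2 m k‖ ^ 2 ≤ n * c.P2
  measurable_dec1 : Measurable dec1
  measurable_dec2 : Measurable dec2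

/-- Average error probability at receiver 1, over independent uniform messages and the noise. (The
error probability of one receiver involves the law of its own noise only.) -/
def Code.err1 {c : Channel} {n M1 M2 : ℕ} (C : Code c n M1 M2) : ℝ :=
  (∑ m1, ∑ m2, (noise n).real
    {z | C.dec1 (fun k => C.enc1 m1 k + c.h12 * C.enc2 m2 k + z k) ≠ m1}) / (M1 * M2)

/-- Average error probability at receiver 2. -/
def Code.err2 {c : Channel} {n M1 M2 : ℕ} (C : Code c n M1 M2) : ℝ :=
  (∑ m1, ∑ m2, (noise n).real
    {z | C.dec2 (fun k => c.h21 * C.enc1 m1 k + C.enc2 m2 k + z k) ≠ m2}) / (M1 * M2)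

/-- The number of messages of a code of rate `R` (bits per channel use) and block length `n`. -/
def numMessages (n : ℕ) (R : ℝ) : ℕ := ⌈(2 : ℝ) ^ ((n : ℝ) * R)⌉₊

/-- `(R₁, R₂)` is achievable if some sequence of `(2^{nR₁}, 2^{nR₂})` codes has both error
probabilities tending to zero. -/
def Channel.Achievable (c : Channel) (R : ℝ × ℝ) : Prop :=
  0 ≤ R.1 ∧ 0 ≤ R.2 ∧
    ∃ C : ∀ n : ℕ, Code c n (numMessages n R.1) (numMessages n R.2),
      Tendsto (fun n => (C n).err1) atTop (𝓝 0) ∧ Tendsto (fun n => (C n).err2) atTop (𝓝 0)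

/-- The capacity region. -/
def Channel.capacityRegion (c : Channel) : Set (ℝ × ℝ) := closure {R | c.Achievable R}

/-! ### Differential entropy, in bits -/

/-- Differential entropy (base 2) of a random variable with values in a space with a reference
measure, for instance `ℂ` or `ℂ × ℂ` with Lebesgue measure. -/
def diffEntropy {Ω E : Type*} [MeasurableSpace Ω] [MeasureSpace E] (μ : Measure Ω) (X : Ω → E) :
    ℝ :=
  -∫ x, Real.logb 2 (((μ.map X).rnDeriv volume x).toReal) ∂(μ.map X)

/-- Conditional differential entropy `h(X | Y) = h(X, Y) - h(Y)`. -/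
def condDiffEntropy {Ω E F : Type*} [MeasurableSpace Ω] [MeasureSpace E] [MeasureSpace F]
    (μ : Measure Ω) (X : Ω → E) (Y : Ω → F) : ℝ :=
  diffEntropy μ (fun ω => (X ω, Y ω)) - diffEntropy μ Y

/-! ### Second moments of complex random variables -/

/-- `E[(A - E A)(B - E B)^*]`. -/
def cov {Ω : Type*} [MeasurableSpace Ω] (μ : Measure Ω) (A B : Ω → ℂ) : ℂ :=
  ∫ ω, (A ω - ∫ ω', A ω' ∂μ) * conj (B ω - ∫ ω', B ω' ∂μ) ∂μ

/-- `σ²_A = E|A - E A|²`. -/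
def var {Ω : Type*} [MeasurableSpace Ω] (μ : Measure Ω) (A : Ω → ℂ) : ℝ :=
  ∫ ω, ‖A ω - ∫ ω', A ω' ∂μ‖ ^ 2 ∂μ

/-- `σ²_{A|B}`, the conditional variance of `A` given `B` for jointly circularly symmetric complex
Gaussian `(A, B)`; it is `σ²_A` if `B` is constant. -/
def gaussCondVar {Ω : Type*} [MeasurableSpace Ω] (μ : Measure Ω) (A B : Ω → ℂ) : ℝ :=
  var μ A - ‖cov μ A B‖ ^ 2 / var μ B

/-! ### Parameters of the genie signals and the Gaussian test variables -/

/-- The parameter vector `κ` of the genie signals: standard deviations of `N₁, N₂, W₁, W₂` and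
their correlation coefficients with `Z₁, Z₂, Z₁, Z₂`. -/
structure Params where
  σN1 : ℝ
  σN2 : ℝ
  σW1 : ℝ
  σW2 : ℝ
  ρN1 : ℂ
  ρN2 : ℂ
  ρW1 : ℂ
  ρW2 : ℂ

/-- The same parameters with the user indices interchanged. -/
def Params.swap (κ : Params) : Params where
  σN1 := κ.σN2
  σN2 := κ.σN1
  σW1 := κ.σW2
  σW2 := κ.σW1
  ρN1 := κ.ρN2
  ρN2 := κ.ρN1
  ρW1 := κ.ρW2
  ρW2 := κ.ρW1

/-- The standing ranges of the parameters. -/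
def Params.InRange (κ : Params) : Prop :=
  (0 ≤ κ.σN1 ∧ κ.σN1 ≤ 1) ∧ (0 ≤ κ.σN2 ∧ κ.σN2 ≤ 1) ∧
  (0 ≤ κ.σW1 ∧ κ.σW1 ≤ 1) ∧ (0 ≤ κ.σW2 ∧ κ.σW2 ≤ 1) ∧
  ‖κ.ρN1‖ ≤ 1 ∧ ‖κ.ρN2‖ ≤ 1 ∧ ‖κ.ρW1‖ ≤ 1 ∧ ‖κ.ρW2‖ ≤ 1

/-- Sample space carrying eight independent `CN(0,1)` variables (the coordinates), from which all
Gaussian variables of the bound are built. -/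
abbrev Smp : Type := Fin 8 → ℂ

/-- Its probability measure. -/
def prob : Measure Smp := Measure.pi (fun _ => stdCN)

/-- `X₁G ∼ CN(0, P₁)`. -/
def X1G (c : Channel) (ω : Smp) : ℂ := (√c.P1 : ℝ) * ω 0

/-- `X₂G ∼ CN(0, P₂)`. -/
def X2G (c : Channel) (ω : Smp) : ℂ := (√c.P2 : ℝ) * ω 1

/-- Noise at receiver 1. -/
def Z1 (ω : Smp) : ℂ := ω 2

/-- Noise at receiver 2. -/
def Z2 (ω : Smp) : ℂ := ω 4

/-- `N₁ ∼ CN(0, σ²_{N₁})`, jointly Gaussian with `Z₁`, `E[Z₁ N₁^*] = ρ_{N₁} σ_{N₁}`, independent of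
everything else. -/
def N1 (κ : Params) (ω : Smp) : ℂ :=
  κ.σN1 * (conj κ.ρN1 * Z1 ω + (√(1 - ‖κ.ρN1‖ ^ 2) : ℝ) * ω 3)

/-- `W₂ ∼ CN(0, σ²_{W₂})`, jointly Gaussian with `Z₂`, `E[Z₂ W₂^*] = ρ_{W₂} σ_{W₂}`, independent of
everything else. -/
def W2 (κ : Params) (ω : Smp) : ℂ :=
  κ.σW2 * (conj κ.ρW2 * Z2 ω + (√(1 - ‖κ.ρW2‖ ^ 2) : ℝ) * ω 5)

/-- Output 1 for Gaussian inputs. -/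
def Y1G (c : Channel) (ω : Smp) : ℂ := X1G c ω + c.h12 * X2G c ω + Z1 ω

/-- Output 2 for Gaussian inputs. -/
def Y2G (c : Channel) (ω : Smp) : ℂ := c.h21 * X1G c ω + X2G c ω + Z2 ω

/-- Etkin-type genie signal `S₁ = h₂₁ X₁ + N₁` for Gaussian inputs. -/
def S1G (c : Channel) (κ : Params) (ω : Smp) : ℂ := c.h21 * X1G c ω + N1 κ ω

/-- Change-of-interference signal `U₂ = h₂₁ X₁ + W₂` for Gaussian inputs. -/
def U2G (c : Channel) (κ : Params) (ω : Smp) : ℂ := c.h21 * X1G c ω + W2 κ ω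

/-- `σ²_{Z₁ - h₂₁⁻¹ N₁}`. -/
def varZ1N1 (c : Channel) (κ : Params) : ℝ := var prob (fun ω => Z1 ω - c.h21⁻¹ * N1 κ ω)

/-- `σ²_{Z₂ - W₂}`. -/
def varZ2W2 (κ : Params) : ℝ := var prob (fun ω => Z2 ω - W2 κ ω)

/-- `σ²_{V_{N₁}} = σ²_{Z₁ | N₁}`. -/
def varVN1 (κ : Params) : ℝ := gaussCondVar prob Z1 (N1 κ)

/-- `σ²_{V_{W₂}} = σ²_{W₂ | Z₂ - W₂}`. -/
def varVW2 (κ : Params) : ℝ := gaussCondVar prob (W2 κ) (fun ω => Z2 ω - W2 κ ω)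

/-- `V_{N₁} ∼ CN(0, σ²_{V_{N₁}})`, independent of everything else. -/
def VN1 (κ : Params) (ω : Smp) : ℂ := (√(varVN1 κ) : ℝ) * ω 6

/-- `V_{W₂} ∼ CN(0, σ²_{V_{W₂}})`, independent of everything else. -/
def VW2 (κ : Params) (ω : Smp) : ℂ := (√(varVW2 κ) : ℝ) * ω 7

/-- `Ṽ_{N₁} = √(1 - σ⁻²_{V_{N₁}} σ²_{Z₁ - h₂₁⁻¹ N₁}) V_{N₁}`. -/
def VtN1 (c : Channel) (κ : Params) (ω : Smp) : ℂ :=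
  (√(1 - (varVN1 κ)⁻¹ * varZ1N1 c κ) : ℝ) * VN1 κ ω

/-- `Z̃₁ = √(1 - |h₁₂|² σ²_{Z₂ - W₂}) Z₁`. -/
def Zt1 (c : Channel) (κ : Params) (ω : Smp) : ℂ :=
  (√(1 - ‖c.h12‖ ^ 2 * varZ2W2 κ) : ℝ) * Z1 ω

/-- The set of parameters for which the bound is claimed. -/
def Admissible (c : Channel) (κ : Params) : Prop :=
  κ.InRange ∧ min (κ.σN1 ^ 2) (κ.σW2 ^ 2) ≤ varVW2 κ ∧ varZ1N1 c κ ≤ varVN1 κ ∧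
    ‖c.h12‖ ^ 2 * varZ2W2 κ ≤ 1

/-- The bound is meaningful: `h₂₁⁻¹` exists, and the Gaussian variables `N₁`, `Z₂ - W₂` and
`h₁₂ X₂G + Z₁ - h₂₁⁻¹ N₁` are non-degenerate, so that no differential entropy below is `-∞`. -/
def Nondegenerate (c : Channel) (κ : Params) : Prop :=
  c.h21 ≠ 0 ∧ 0 < κ.σN1 ∧ 0 < varZ2W2 κ ∧ 0 < ‖c.h12‖ ^ 2 * c.P2 + varZ1N1 c κ

/-! ### The bound -/

/-- `R₀` through differential entropies. -/
def R0 (c : Channel) (κ : Params) : ℝ :=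
  diffEntropy prob (S1G c κ) - diffEntropy prob (fun ω => c.h21 * X1G c ω + VW2 κ ω)
    + diffEntropy prob (U2G c κ) - condDiffEntropy prob (Y2G c) (X2G c)
    + diffEntropy prob (Y1G c) - diffEntropy prob (N1 κ)
    + diffEntropy prob (Y2G c) - diffEntropy prob (fun ω => Z2 ω - W2 κ ω)

/-- `R₀` in closed form. -/
def R0Explicit (c : Channel) (κ : Params) : ℝ :=
  Real.logb 2 ((‖c.h21‖ ^ 2 * c.P1 + κ.σN1 ^ 2) / (‖c.h21‖ ^ 2 * c.P1 + varVW2 κ))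
    + Real.logb 2 ((‖c.h21‖ ^ 2 * c.P1 + κ.σW2 ^ 2) / (‖c.h21‖ ^ 2 * c.P1 + 1))
    + Real.logb 2 ((c.P1 + ‖c.h12‖ ^ 2 * c.P2 + 1) / κ.σN1 ^ 2)
    + Real.logb 2 ((c.P2 + ‖c.h21‖ ^ 2 * c.P1 + 1) /
        (1 + κ.σW2 ^ 2 - 2 * (κ.ρW2 * κ.σW2).re))

/-- The sum-rate bound through differential entropies. -/
def hybridBound (c : Channel) (κ : Params) : ℝ :=
  1 / 2 *
    (condDiffEntropy prob (Y1G c) (S1G c κ)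
      - condDiffEntropy prob (fun ω => Y1G c ω + VtN1 c κ ω) (S1G c κ)
      + condDiffEntropy prob (Y2G c) (U2G c κ)
      - condDiffEntropy prob (fun ω => c.h12 * Y2G c ω + Zt1 c κ ω) (U2G c κ)
      + R0 c κ)

/-- The sum-rate bound in closed form. -/
def hybridBoundExplicit (c : Channel) (κ : Params) : ℝ :=
  1 / 2 *
    (Real.logb 2
        ((c.P1 + ‖c.h12‖ ^ 2 * c.P2 + 1
            - ‖conj c.h21 * c.P1 + κ.ρN1 * κ.σN1‖ ^ 2 / (‖c.h21‖ ^ 2 * c.P1 + κ.σN1 ^ 2)) /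
          (‖c.h12‖ ^ 2 * c.P2 + varVN1 κ
            - ‖κ.ρN1 * κ.σN1 - c.h21⁻¹ * (κ.σN1 : ℂ) ^ 2‖ ^ 2 /
                (‖c.h21‖ ^ 2 * c.P1 + κ.σN1 ^ 2)))
      + Real.logb 2
        ((c.P2 + ‖c.h21‖ ^ 2 * c.P1 + 1
            - ‖(‖c.h21‖ : ℂ) ^ 2 * c.P1 + κ.ρW2 * κ.σW2‖ ^ 2 /
                (‖c.h21‖ ^ 2 * c.P1 + κ.σW2 ^ 2)) /
          (‖c.h12‖ ^ 2 * c.P2 + 1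
            - ‖c.h12 * κ.ρW2 * κ.σW2 - c.h12 * (κ.σW2 : ℂ) ^ 2‖ ^ 2 /
                (‖c.h21‖ ^ 2 * c.P1 + κ.σW2 ^ 2)))
      + R0Explicit c κ)

end GIC

end

noncomputable section

namespace GIC

/-! ### The standard complex Gaussian law -/

/-! The condition `σ²_{V_{N₁}} ≥ σ²_{Z₁ - h₂₁⁻¹N₁}` is rigid. Its right side is the error of
estimating `Z₁` by `h₂₁⁻¹N₁`, its left side the least error of any linear estimate from `N₁`. So
`h₂₁⁻¹N₁` is the optimal estimate, that is `ρ_{N₁} = h₂₁⁻¹σ_{N₁}` (`rho_eq`). Hence `Ṽ_{N₁} = 0`,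
the first two conditional entropies cancel, `σ_{N₁} ≤ |h₂₁|`, and, once the interference is known,
`Y₁` is a degraded copy of `S₁ = h₂₁X₁ + N₁`.

At receiver 2 put `D = Z₂ - W₂`, of variance `d`, and split `W₂ = γD + V` with `V` independent of
`D`, of variance `ν = σ²_{V_{W₂}}`. Then `Z₂ = (1 + γ)D + V` and `Y₂ - U₂ = X₂ + D`.

Each rate is bounded twice. For `R₁` the bounds are `h(S₁) - h(N₁)` (`rate_le_degraded`) and `h(Y₁G)
- h(h₁₂X₂ + Z₁)` (`fano_gaussian`). For `R₂` they are `h(Y₂G) - h(h₂₁X₁ + Z₂)` (`fano_gaussian`)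
and, with the genie signal `U₂`, a bound made of `h(Ỹ) + h(U₂) - h(h₂₁X₁ + V)` and a Gaussian term,
where `Ỹ = h₁₂(X₂ + D) + Z̃₁` (`rate_le_genie`). Since `Ỹ` has the law of `h₁₂X₂ + Z₁`, the
entropies of the second codebook cancel in the sum (`sum_rate_le`). What is left of the first
codebook is the entropy of `h₂₁X₁` in noise of variances `σ²_{N₁}` and `σ²_{W₂}`, minus that in
noise of variances `ν` and `1`. The hypothesis on the minimum allows these to be paired so that the
worst additive noise lemma `ent_sub_ent_le` bounds each difference by its Gaussian value.

Every information inequality comes from Gibbs' inequality against an explicit reference density.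
Fano's inequality takes the form `fano`: the average divergence of the output densities from any
subprobability density is at least `(1 - Pₑ) log M - log 2`. The choice of that density replaces
subadditivity of entropy and maximality of the Gaussian. Outputs are finite Gaussian mixtures,
positive, with logarithms of quadratic growth, so integrability is uniform.

Letting the block length tend to infinity and taking closures gives the region; `ν = 0` is a limit
of `ν > 0`. The entropies in the statement are evaluated by writing all test variables as linear
forms in independent standard Gaussians. -/

instance : IsProbabilityMeasure stdCN :=
  Measure.isProbabilityMeasure_map (by fun_prop)

instance (n : ℕ) : IsProbabilityMeasure (noise n) := by unfold noise; infer_instance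

/-- The complex number representing a real linear functional on `ℂ`. -/
def dualVec (L : StrongDual ℝ ℂ) : ℂ := L 1 + L Complex.I * Complex.I

lemma dualVec_add (L L' : StrongDual ℝ ℂ) : dualVec (L + L') = dualVec L + dualVec L' := by
  simp [dualVec]; ring

/-- Multiplication by a complex number, as a real linear map. -/
def mulL (a : ℂ) : ℂ →L[ℝ] ℂ := ContinuousLinearMap.mul ℝ ℂ a

@[simp] lemma mulL_apply (a z : ℂ) : mulL a z = a * z := rfl

lemma dual_apply (L : StrongDual ℝ ℂ) (z : ℂ) : L z = z.re * L 1 + z.im * L Complex.I := by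
  conv_lhs => rw [← Complex.re_add_im z]
  have h1 : (z.re : ℂ) = z.re • (1 : ℂ) := by simp
  have h2 : (z.im : ℂ) * Complex.I = z.im • Complex.I := by simp
  rw [map_add, h1, h2, map_smul, map_smul]; simp

lemma dualVec_comp_mulL (L : StrongDual ℝ ℂ) (a : ℂ) :
    dualVec (L.comp (mulL a)) = conj a * dualVec L := by
  simp only [dualVec, ContinuousLinearMap.comp_apply, mulL_apply, mul_one]
  rw [dual_apply L a, dual_apply L (a * Complex.I)]
  apply Complex.ext
  · simp
  · simp; ring

/-- Only the modulus of `dualVec L` enters. This circular symmetry is why complex combinations of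
independent noises are governed by sums of squared moduli. -/
lemma charFunDual_stdCN (L : StrongDual ℝ ℂ) :
    charFunDual stdCN L = Complex.exp (-(‖dualVec L‖ ^ 2 / 4 : ℝ)) := by
  rw [charFunDual_apply, stdCN, integral_map (by fun_prop) (by fun_prop)]
  have h : ∀ p : ℝ × ℝ, Complex.exp (L ((p.1 : ℂ) + p.2 * Complex.I) * Complex.I)
      = Complex.exp (L 1 * p.1 * Complex.I) * Complex.exp (L Complex.I * p.2 * Complex.I) := by
    intro p
    rw [← Complex.exp_add, dual_apply]
    congr 1; simp; ring
  simp_rw [h]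
  rw [integral_prod_mul (f := fun x : ℝ => Complex.exp (L 1 * x * Complex.I))
    (g := fun x : ℝ => Complex.exp (L Complex.I * x * Complex.I))]
  have h1 := charFun_gaussianReal (μ := 0) (v := 1 / 2) (L 1)
  have h2 := charFun_gaussianReal (μ := 0) (v := 1 / 2) (L Complex.I)
  rw [charFun_apply_real] at h1 h2
  rw [h1, h2, ← Complex.exp_add]
  congr 1
  have : ‖dualVec L‖ ^ 2 = (L 1) ^ 2 + (L Complex.I) ^ 2 := by
    rw [← Complex.normSq_eq_norm_sq, Complex.normSq_apply]; simp [dualVec]; ring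
  rw [this]; push_cast; ring

lemma stdCN_eq_withDensity :
    stdCN = volume.withDensity (fun z => ENNReal.ofReal (Real.pi⁻¹ * Real.exp (-‖z‖ ^ 2))) := by
  have hv : (1 / 2 : NNReal) ≠ 0 := by norm_num
  ext s hs
  rw [stdCN, Measure.map_apply (by fun_prop) hs, gaussianReal_of_var_ne_zero _ hv,
    prod_withDensity (by fun_prop) (by fun_prop), withDensity_apply _ ((by fun_prop :
      Measurable (fun p : ℝ × ℝ => (p.1 : ℂ) + (p.2 : ℂ) * Complex.I)) hs), withDensity_apply _ hs,
    ← (Complex.volume_preserving_equiv_real_prod.symm).setLIntegral_comp_preimage_emb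
      (MeasurableEquiv.measurableEmbedding _)]
  have hset : (fun p : ℝ × ℝ => (p.1 : ℂ) + (p.2 : ℂ) * Complex.I) ⁻¹' s
      = Complex.measurableEquivRealProd.symm ⁻¹' s := by
    ext p
    have : (p.1 : ℂ) + (p.2 : ℂ) * Complex.I = Complex.measurableEquivRealProd.symm p := by
      apply Complex.ext <;> simp
    simp only [Set.mem_preimage, this]
  rw [hset]
  refine setLIntegral_congr_fun (Complex.measurableEquivRealProd.symm.measurable hs) ?_
  intro p _
  simp only [gaussianPDF, gaussianPDFReal]
  rw [← ENNReal.ofReal_mul (by positivity)]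
  congr 1
  have h1 : ‖Complex.measurableEquivRealProd.symm p‖ ^ 2 = p.1 ^ 2 + p.2 ^ 2 := by
    rw [← Complex.normSq_eq_norm_sq, Complex.normSq_apply]; simp; ring
  rw [h1]
  have h2 : (√(2 * Real.pi * ((1 / 2 : NNReal) : ℝ)))⁻¹ * (√(2 * Real.pi * ((1 / 2 : NNReal) : ℝ)))⁻¹
      = Real.pi⁻¹ := by
    rw [← mul_inv, Real.mul_self_sqrt (by positivity)]; push_cast; field_simp
  rw [← h2, mul_mul_mul_comm, ← Real.exp_add]
  congr 2
  push_cast; ring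

lemma integrable_norm_sq_stdCN : Integrable (fun z => ‖z‖ ^ 2) stdCN := by
  rw [stdCN, integrable_map_measure (by fun_prop) (by fun_prop)]
  have h : (fun z : ℂ => ‖z‖ ^ 2) ∘ (fun p : ℝ × ℝ => (p.1 : ℂ) + (p.2 : ℂ) * Complex.I)
      = fun p => p.1 ^ 2 + p.2 ^ 2 := by
    ext p
    simp only [Function.comp]
    rw [← Complex.normSq_eq_norm_sq, Complex.normSq_add_mul_I]
  rw [h]
  have hi : Integrable (fun x : ℝ => x ^ 2) (gaussianReal 0 (1 / 2)) :=
    (memLp_id_gaussianReal 2).integrable_sq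
  exact (hi.comp_fst _).add (hi.comp_snd _)

lemma integral_norm_sq_stdCN : ∫ z, ‖z‖ ^ 2 ∂stdCN = 1 := by
  rw [stdCN, integral_map (by fun_prop) (by fun_prop)]
  have h : ∀ p : ℝ × ℝ, ‖(p.1 : ℂ) + (p.2 : ℂ) * Complex.I‖ ^ 2 = p.1 ^ 2 + p.2 ^ 2 := by
    intro p
    rw [← Complex.normSq_eq_norm_sq, Complex.normSq_add_mul_I]
  simp_rw [h]
  have hi : Integrable (fun x : ℝ => x ^ 2) (gaussianReal 0 (1 / 2)) :=
    (memLp_id_gaussianReal 2).integrable_sq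
  have hvar : ∫ x : ℝ, x ^ 2 ∂gaussianReal 0 (1 / 2) = 1 / 2 := by
    have := variance_fun_id_gaussianReal (μ := 0) (v := 1 / 2)
    rw [variance_eq_integral (by fun_prop)] at this
    simpa using this
  rw [integral_add (hi.comp_fst _) (hi.comp_snd _),
    integral_fun_fst (fun x : ℝ => x ^ 2), integral_fun_snd (fun x : ℝ => x ^ 2), hvar]
  simp; norm_num

lemma integrable_id_stdCN : Integrable (fun z => z) stdCN := by
  refine (integrable_norm_sq_stdCN.add (integrable_const 1)).mono' (by fun_prop) ?_
  filter_upwards with z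
  simp only [Pi.add_apply]; nlinarith [sq_nonneg (‖z‖ - 1)]

lemma integral_id_stdCN : ∫ z, z ∂stdCN = 0 := by
  have hi : Integrable (fun x : ℝ => x) (gaussianReal 0 (1 / 2)) :=
    (memLp_id_gaussianReal 1).integrable le_rfl
  rw [stdCN, integral_map (by fun_prop) (by fun_prop)]
  have h0 : ∫ x : ℝ, (x : ℂ) ∂gaussianReal 0 (1 / 2) = 0 := by
    rw [integral_complex_ofReal, integral_id_gaussianReal]; simp
  rw [integral_add (hi.comp_fst _).ofReal ((hi.comp_snd _).ofReal.mul_const _), integral_mul_const,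
    integral_fun_fst (fun x : ℝ => (x : ℂ)), integral_fun_snd (fun x : ℝ => (x : ℂ)),
    h0]
  simp

/-! ### Gaussian noise vectors -/

lemma charFunDual_pi_stdCN {ι : Type*} [Fintype ι] [DecidableEq ι] (L : StrongDual ℝ (ι → ℂ)) :
    charFunDual (Measure.pi fun _ : ι => stdCN) L
      = Complex.exp (-((∑ i, ‖dualVec (L.comp (.single ℝ (fun _ => ℂ) i))‖ ^ 2) / 4 : ℝ)) := by
  rw [charFunDual_pi]
  simp_rw [charFunDual_stdCN]
  rw [← Complex.exp_sum]
  congr 1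
  push_cast
  rw [Finset.sum_neg_distrib, Finset.sum_div]

lemma dualVec_comp_smul_single {ι : Type*} [Fintype ι] [DecidableEq ι]
    (L : StrongDual ℝ (ι → ℂ)) (a : ℂ) (i : ι) :
    ‖dualVec ((L.comp (a • ContinuousLinearMap.id ℝ (ι → ℂ))).comp (.single ℝ (fun _ => ℂ) i))‖ ^ 2
      = ‖a‖ ^ 2 * ‖dualVec (L.comp (.single ℝ (fun _ => ℂ) i))‖ ^ 2 := by
  have h : (L.comp (a • ContinuousLinearMap.id ℝ (ι → ℂ))).comp (.single ℝ (fun _ => ℂ) i)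
      = (L.comp (.single ℝ (fun _ => ℂ) i)).comp (mulL a) := by
    refine ContinuousLinearMap.ext fun z => ?_
    simp only [ContinuousLinearMap.comp_apply]
    congr 1
    ext j
    by_cases hj : j = i
    · subst hj; simp
    · simp [hj]
  rw [h, dualVec_comp_mulL, norm_mul, mul_pow, RCLike.norm_conj]

/-- A linear combination of two independent noise vectors is a scaled noise vector. -/
lemma noise_prod_map (n : ℕ) (a b : ℂ) (s : ℝ) (h : s ^ 2 = ‖a‖ ^ 2 + ‖b‖ ^ 2) :
    ((noise n).prod (noise n)).map (fun p => a • p.1 + b • p.2)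
      = (noise n).map (fun z => (s : ℂ) • z) := by
  have e1 : (fun p : (Fin n → ℂ) × (Fin n → ℂ) => a • p.1 + b • p.2)
      = ⇑((a • ContinuousLinearMap.id ℝ (Fin n → ℂ)).coprod
        (b • ContinuousLinearMap.id ℝ (Fin n → ℂ))) := by
    ext p; simp
  have e2 : (fun z : Fin n → ℂ => (s : ℂ) • z) = ⇑((s : ℂ) • ContinuousLinearMap.id ℝ (Fin n → ℂ)) := by
    ext p; simp
  have : IsFiniteMeasure (((noise n).prod (noise n)).map
      (fun p : (Fin n → ℂ) × (Fin n → ℂ) => a • p.1 + b • p.2)) := by infer_instance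
  apply Measure.ext_of_charFunDual
  ext L
  rw [e1, e2, charFunDual_map, charFunDual_map, charFunDual_prod]
  have h1 : (L.comp ((a • ContinuousLinearMap.id ℝ (Fin n → ℂ)).coprod
      (b • ContinuousLinearMap.id ℝ (Fin n → ℂ)))).comp (.inl ℝ _ _)
      = L.comp (a • ContinuousLinearMap.id ℝ (Fin n → ℂ)) := by
    ext z; simp
  have h2 : (L.comp ((a • ContinuousLinearMap.id ℝ (Fin n → ℂ)).coprod
      (b • ContinuousLinearMap.id ℝ (Fin n → ℂ)))).comp (.inr ℝ _ _)
      = L.comp (b • ContinuousLinearMap.id ℝ (Fin n → ℂ)) := by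
    ext z; simp
  rw [h1, h2]
  simp only [noise]
  rw [charFunDual_pi_stdCN, charFunDual_pi_stdCN, charFunDual_pi_stdCN, ← Complex.exp_add]
  simp_rw [dualVec_comp_smul_single, ← Finset.mul_sum]
  congr 1
  have hs : ‖(s : ℂ)‖ ^ 2 = ‖a‖ ^ 2 + ‖b‖ ^ 2 := by rw [← h]; simp
  rw [hs]; push_cast; ring

/-! ### Second moments of noise vectors. -/

/-- Squared Euclidean norm of a vector. -/
def nsq {n : ℕ} (x : Fin n → ℂ) : ℝ := ∑ k, ‖x k‖ ^ 2

lemma nsq_nonneg {n : ℕ} (x : Fin n → ℂ) : 0 ≤ nsq x := Finset.sum_nonneg fun _ _ => by positivity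

@[fun_prop] lemma continuous_nsq {n : ℕ} : Continuous (nsq (n := n)) := by unfold nsq; fun_prop

lemma nsq_smul {n : ℕ} (a : ℂ) (x : Fin n → ℂ) : nsq (a • x) = ‖a‖ ^ 2 * nsq x := by
  simp [nsq, mul_pow, Finset.mul_sum]

lemma nsq_add {n : ℕ} (x y : Fin n → ℂ) :
    nsq (x + y) = nsq x + nsq y + 2 * ∑ k, (conj (x k) * y k).re := by
  simp only [nsq, Finset.mul_sum, ← Finset.sum_add_distrib]
  refine Finset.sum_congr rfl fun k _ => ?_
  rw [Pi.add_apply, ← Complex.normSq_eq_norm_sq, ← Complex.normSq_eq_norm_sq,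
    ← Complex.normSq_eq_norm_sq, Complex.normSq_add]
  simp [Complex.mul_re]

lemma nsq_le_norm {n : ℕ} (x : Fin n → ℂ) : nsq x ≤ n * ‖x‖ ^ 2 := by
  calc nsq x ≤ ∑ _k : Fin n, ‖x‖ ^ 2 := Finset.sum_le_sum fun k _ => by
        have := norm_le_pi_norm x k; gcongr
    _ = _ := by simp

lemma norm_sq_le_nsq {n : ℕ} (x : Fin n → ℂ) : ‖x‖ ^ 2 ≤ nsq x := by
  have h : ‖x‖ ≤ √(nsq x) := by
    rw [pi_norm_le_iff_of_nonneg (Real.sqrt_nonneg _)]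
    intro k
    apply Real.le_sqrt_of_sq_le
    exact Finset.single_le_sum (f := fun k => ‖x k‖ ^ 2) (fun _ _ => by positivity)
      (Finset.mem_univ k)
  calc ‖x‖ ^ 2 ≤ √(nsq x) ^ 2 := by gcongr
    _ = nsq x := Real.sq_sqrt (nsq_nonneg x)

lemma integrable_eval_noise {n : ℕ} (k : Fin n) : Integrable (fun z => z k) (noise n) :=
  integrable_comp_eval (μ := fun _ : Fin n => stdCN) (f := fun z : ℂ => z) integrable_id_stdCN

lemma integral_eval_noise {n : ℕ} (k : Fin n) : ∫ z, z k ∂noise n = 0 := by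
  rw [noise, integral_comp_eval (μ := fun _ : Fin n => stdCN) (f := fun z : ℂ => z) (by fun_prop),
    integral_id_stdCN]

lemma integrable_norm_sq_eval_noise {n : ℕ} (k : Fin n) :
    Integrable (fun z => ‖z k‖ ^ 2) (noise n) :=
  integrable_comp_eval (μ := fun _ : Fin n => stdCN) (i := k) (f := fun z : ℂ => ‖z‖ ^ 2)
    integrable_norm_sq_stdCN

lemma integrable_nsq_noise {n : ℕ} : Integrable nsq (noise n) :=
  integrable_finsetSum _ fun k _ => integrable_norm_sq_eval_noise k

lemma integral_nsq_noise {n : ℕ} : ∫ z, nsq z ∂noise n = n := by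
  have : ∀ k : Fin n, ∫ z, ‖z k‖ ^ 2 ∂noise n = 1 := fun k => by
    rw [noise, integral_comp_eval (μ := fun _ : Fin n => stdCN) (f := fun z : ℂ => ‖z‖ ^ 2)
      (by fun_prop), integral_norm_sq_stdCN]
  simp only [nsq]
  rw [integral_finsetSum _ fun k _ => integrable_norm_sq_eval_noise k]
  simp [this]

/-- The cross term is linear in the noise and so has mean zero. -/
lemma integral_nsq_affine {n : ℕ} (c : Fin n → ℂ) (s : ℂ) :
    ∫ z, nsq (c + s • z) ∂noise n = nsq c + n * ‖s‖ ^ 2 := by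
  have h : ∀ z : Fin n → ℂ, nsq (c + s • z)
      = nsq c + ‖s‖ ^ 2 * nsq z + 2 * ∑ k, (conj (c k) * s * z k).re := by
    intro z
    rw [nsq_add, nsq_smul]
    simp [mul_assoc]
  have hk : ∀ k : Fin n, Integrable (fun z => (conj (c k) * s * z k).re) (noise n) := fun k =>
    ((integrable_eval_noise k).const_mul _).re
  have h0 : ∀ k : Fin n, ∫ z, (conj (c k) * s * z k).re ∂noise n = 0 := fun k => by
    have := integral_re ((integrable_eval_noise k).const_mul (conj (c k) * s))
    simp only [RCLike.re_to_complex] at this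
    rw [this, integral_const_mul, integral_eval_noise]; simp
  simp_rw [h]
  rw [integral_add (by exact (integrable_const _).add (integrable_nsq_noise.const_mul _))
      (by exact (integrable_finsetSum _ fun k _ => hk k).const_mul _),
    integral_add (integrable_const _) (integrable_nsq_noise.const_mul _), integral_const_mul,
    integral_const_mul, integral_finsetSum _ fun k _ => hk k, integral_nsq_noise,
    Finset.sum_congr rfl fun k _ => h0 k]
  simp; ring

/-! ### Isotropic Gaussian densities on `ℂⁿ`. -/

/-- Density of the isotropic complex Gaussian vector of variance `s` per coordinate. -/
def gd {n : ℕ} (s : ℝ) (x : Fin n → ℂ) : ℝ :=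
  Real.exp (-(n * Real.log (Real.pi * s)) - nsq x / s)

lemma gd_pos {n : ℕ} (s : ℝ) (x : Fin n → ℂ) : 0 < gd s x := Real.exp_pos _

lemma log_gd {n : ℕ} (s : ℝ) (x : Fin n → ℂ) :
    Real.log (gd s x) = -(n * Real.log (Real.pi * s)) - nsq x / s := Real.log_exp _

@[fun_prop] lemma continuous_gd {n : ℕ} (s : ℝ) : Continuous (gd (n := n) s) := by
  unfold gd; fun_prop

lemma gd_le {n : ℕ} {s : ℝ} (hs : 0 < s) (x : Fin n → ℂ) :
    gd s x ≤ Real.exp (-(n * Real.log (Real.pi * s))) := by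
  unfold gd
  have := nsq_nonneg x
  gcongr
  have : 0 ≤ nsq x / s := by positivity
  linarith

lemma gd_eq_prod {n : ℕ} {s : ℝ} (hs : 0 < s) (x : Fin n → ℂ) :
    gd s x = ∏ k, ((Real.pi * s)⁻¹ * Real.exp (-‖x k‖ ^ 2 / s)) := by
  have hp : 0 < Real.pi * s := by positivity
  rw [Finset.prod_mul_distrib, ← Real.exp_sum, gd, sub_eq_add_neg, Real.exp_add]
  congr 1
  · rw [← mul_neg, ← Real.log_inv, Real.exp_nat_mul, Real.exp_log (by positivity)]; simp
  · congr 1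
    rw [nsq, Finset.sum_div, ← Finset.sum_neg_distrib]
    exact Finset.sum_congr rfl fun k _ => by ring

/-- It suffices to compare boxes, and the indicator of a box times a product of densities is again a
product, so its integral factorises. -/
lemma pi_withDensity_ofReal {ι E : Type*} [Fintype ι] [MeasurableSpace E] (μ : Measure E)
    [SigmaFinite μ] (f : E → ℝ) (hi : Integrable f μ) (h0 : ∀ x, 0 ≤ f x) :
    Measure.pi (fun _ : ι => μ.withDensity fun x => ENNReal.ofReal (f x))
      = (Measure.pi fun _ : ι => μ).withDensity fun x => ENNReal.ofReal (∏ i, f (x i)) := by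
  have : IsFiniteMeasure (μ.withDensity fun x => ENNReal.ofReal (f x)) :=
    isFiniteMeasure_withDensity_ofReal hi.2
  refine Measure.pi_eq fun s hs => ?_
  rw [withDensity_apply _ (MeasurableSet.univ_pi hs),
    ← lintegral_indicator (MeasurableSet.univ_pi hs)]
  have h1 : ∀ x : ι → E, (Set.univ.pi s).indicator (fun x => ENNReal.ofReal (∏ i, f (x i))) x
      = ENNReal.ofReal (∏ i, (s i).indicator f (x i)) := by
    intro x
    by_cases hx : x ∈ Set.univ.pi s
    · rw [Set.indicator_of_mem hx]
      congr 1
      exact Finset.prod_congr rfl fun i _ => (Set.indicator_of_mem (hx i trivial) f).symm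
    · rw [Set.indicator_of_notMem hx]
      simp only [Set.mem_pi, Set.mem_univ, true_implies, not_forall] at hx
      obtain ⟨i, hi⟩ := hx
      rw [Finset.prod_eq_zero (Finset.mem_univ i) (Set.indicator_of_notMem hi f)]; simp
  simp_rw [h1]
  have hii : ∀ i, Integrable ((s i).indicator f) μ := fun i => hi.indicator (hs i)
  have h0' : ∀ i x, 0 ≤ (s i).indicator f x := fun i x =>
    Set.indicator_nonneg (fun x _ => h0 x) x
  rw [← ofReal_integral_eq_lintegral_ofReal (Integrable.fintype_prod_dep (f := fun i => (s i).indicator f) hii)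
    (Eventually.of_forall fun x => Finset.prod_nonneg fun i _ => h0' i _),
    integral_fintype_prod_eq_prod (f := fun i => (s i).indicator f),
    ENNReal.ofReal_prod_of_nonneg fun i _ => integral_nonneg (h0' i)]
  refine Finset.prod_congr rfl fun i _ => ?_
  rw [ofReal_integral_eq_lintegral_ofReal (hii i) (Eventually.of_forall (h0' i)),
    withDensity_apply _ (hs i), ← lintegral_indicator (hs i)]
  congr 1
  ext x
  by_cases hx : x ∈ s i <;> simp [hx]

lemma noise_eq_withDensity (n : ℕ) :
    noise n = volume.withDensity (fun z => ENNReal.ofReal (gd 1 z)) := by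
  have hm : Measurable fun z : ℂ => Real.pi⁻¹ * Real.exp (-‖z‖ ^ 2) := by fun_prop
  have h0 : ∀ z : ℂ, 0 ≤ Real.pi⁻¹ * Real.exp (-‖z‖ ^ 2) := fun z => by positivity
  have hi : Integrable (fun z : ℂ => Real.pi⁻¹ * Real.exp (-‖z‖ ^ 2)) := by
    refine ⟨hm.aestronglyMeasurable, ?_⟩
    rw [hasFiniteIntegral_iff_ofReal (Eventually.of_forall h0)]
    have := measure_univ (μ := stdCN)
    rw [stdCN_eq_withDensity, withDensity_apply _ MeasurableSet.univ, setLIntegral_univ] at this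
    rw [this]; simp
  rw [noise, stdCN_eq_withDensity, pi_withDensity_ofReal volume _ hi h0, ← volume_pi]
  congr 1
  ext z
  rw [gd_eq_prod one_pos]; simp

/-- Density of a scaled and shifted noise vector. -/
lemma noise_map_affine {n : ℕ} {s : ℝ} (hs : 0 < s) (x : Fin n → ℂ) :
    (noise n).map (fun z => x + ((√s : ℝ) : ℂ) • z)
      = volume.withDensity (fun y => ENNReal.ofReal (gd s (y - x))) := by
  have hr : √s ≠ 0 := (Real.sqrt_pos.2 hs).ne'
  refine Measure.ext_of_lintegral _ fun f hf => ?_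
  have hm : Measurable fun z : Fin n → ℂ => x + ((√s : ℝ) : ℂ) • z := by fun_prop
  rw [lintegral_map hf hm, noise_eq_withDensity, lintegral_withDensity_eq_lintegral_mul _
    (by fun_prop) (show Measurable fun z : Fin n → ℂ => f (x + ((√s : ℝ) : ℂ) • z) from hf.comp hm),
    lintegral_withDensity_eq_lintegral_mul _ (by fun_prop) hf]
  refine Eq.trans ?_ (lintegral_add_left_eq_self (μ := volume)
    ((fun y : Fin n → ℂ => ENNReal.ofReal (gd s (y - x))) * f : (Fin n → ℂ) → ENNReal) x)
  set G : (Fin n → ℂ) → ENNReal := fun y => ENNReal.ofReal (gd s y) * f (x + y) with hG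
  have hGm : Measurable G := by
    have : Measurable fun y => f (x + y) := hf.comp (by fun_prop)
    exact Measurable.mul (by fun_prop) this
  have e1 : ∀ y : Fin n → ℂ, ((fun y : Fin n → ℂ => ENNReal.ofReal (gd s (y - x))) * f :
      (Fin n → ℂ) → ENNReal) (x + y) = G y := by
    intro y; simp [hG]
  simp_rw [e1]
  have key := Measure.map_addHaar_smul (volume : Measure (Fin n → ℂ)) hr
  have : ∫⁻ y, G y ∂(Measure.map (fun y => √s • y) (volume : Measure (Fin n → ℂ)))
      = ENNReal.ofReal (|(√s ^ Module.finrank ℝ (Fin n → ℂ))⁻¹|) * ∫⁻ y, G y := by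
    rw [key, lintegral_smul_measure, smul_eq_mul]
  rw [lintegral_map hGm (by fun_prop)] at this
  -- The real dimension is `2n`, so dilation by `√s` has Jacobian `s ^ n`.
  have hfr : √s ^ Module.finrank ℝ (Fin n → ℂ) = s ^ n := by
    rw [Module.finrank_pi_fintype, Finset.sum_const, Complex.finrank_real_complex]
    simp only [Finset.card_univ, Fintype.card_fin, smul_eq_mul]
    rw [mul_comm, pow_mul, Real.sq_sqrt hs.le]
  rw [hfr, abs_of_pos (by positivity)] at this
  have hc : ENNReal.ofReal (s ^ n) * ENNReal.ofReal ((s ^ n)⁻¹) = 1 := by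
    rw [← ENNReal.ofReal_mul (by positivity), mul_inv_cancel₀ (by positivity), ENNReal.ofReal_one]
  calc _ = ∫⁻ z, ENNReal.ofReal (s ^ n) * G (√s • z) := by
        refine lintegral_congr fun z => ?_
        simp only [Pi.mul_apply, hG]
        rw [← mul_assoc, ← ENNReal.ofReal_mul (by positivity)]
        have : (((√s : ℝ) : ℂ) • z) = √s • z := by ext k; simp
        rw [this]
        congr 2
        have e2 : nsq (√s • z) = s * nsq z := by
          rw [← this, nsq_smul]
          simp [abs_of_nonneg, Real.sqrt_nonneg, Real.sq_sqrt hs.le]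
        rw [gd, gd, e2, Real.log_mul Real.pi_ne_zero hs.ne', mul_one]
        have e3 : s ^ n = Real.exp (n * Real.log s) := by
          rw [Real.exp_nat_mul, Real.exp_log hs]
        rw [e3, ← Real.exp_add]
        congr 1
        field_simp; ring
    _ = ENNReal.ofReal (s ^ n) * ∫⁻ z, G (√s • z) := by
        exact lintegral_const_mul _ (hGm.comp (by fun_prop : Measurable fun z : Fin n → ℂ => √s • z))
    _ = _ := by rw [this, ← mul_assoc, hc, one_mul]

/-! ### Functions of quadratic growth and maps of linear growth -/

section Growth

variable {V W U : Type*} [NormedAddCommGroup V] [NormedAddCommGroup W] [NormedAddCommGroup U]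

/-- Continuous maps bounded by a multiple of `1 + ‖y‖`. -/
def LinGrowth (g : V → W) : Prop := Continuous g ∧ ∃ K, 0 ≤ K ∧ ∀ y, ‖g y‖ ≤ K * (1 + ‖y‖)

namespace LinGrowth

lemma id : LinGrowth (fun y : V => y) := ⟨continuous_id, 1, zero_le_one, fun y => by linarith [norm_nonneg y]⟩

lemma const (c : W) : LinGrowth (fun _ : V => c) :=
  ⟨continuous_const, ‖c‖, norm_nonneg c, fun y => by nlinarith [norm_nonneg y, norm_nonneg c]⟩

lemma add {f g : V → W} (hf : LinGrowth f) (hg : LinGrowth g) : LinGrowth (fun y => f y + g y) := by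
  obtain ⟨hf, K, hK, h⟩ := hf
  obtain ⟨hg, K', hK', h'⟩ := hg
  exact ⟨hf.add hg, K + K', by positivity, fun y => (norm_add_le _ _).trans
    (by linarith [h y, h' y])⟩

lemma sub {f g : V → W} (hf : LinGrowth f) (hg : LinGrowth g) : LinGrowth (fun y => f y - g y) := by
  obtain ⟨hf, K, hK, h⟩ := hf
  obtain ⟨hg, K', hK', h'⟩ := hg
  exact ⟨hf.sub hg, K + K', by positivity, fun y => (norm_sub_le _ _).trans
    (by linarith [h y, h' y])⟩

lemma smul [NormedSpace ℂ W] {f : V → W} (a : ℂ) (hf : LinGrowth f) :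
    LinGrowth (fun y => a • f y) := by
  obtain ⟨hf, K, hK, h⟩ := hf
  refine ⟨hf.const_smul a, ‖a‖ * K, by positivity, fun y => ?_⟩
  rw [norm_smul, mul_assoc]
  exact mul_le_mul_of_nonneg_left (h y) (norm_nonneg a)

lemma fst {f : U → V × W} (hf : LinGrowth f) : LinGrowth (fun y => (f y).1) := by
  obtain ⟨hf, K, hK, h⟩ := hf
  exact ⟨hf.fst, K, hK, fun y => (norm_fst_le _).trans (h y)⟩

lemma snd {f : U → V × W} (hf : LinGrowth f) : LinGrowth (fun y => (f y).2) := by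
  obtain ⟨hf, K, hK, h⟩ := hf
  exact ⟨hf.snd, K, hK, fun y => (norm_snd_le _).trans (h y)⟩

lemma prodMk {f : U → V} {g : U → W} (hf : LinGrowth f) (hg : LinGrowth g) :
    LinGrowth (fun y => (f y, g y)) := by
  obtain ⟨hf, K, hK, h⟩ := hf
  obtain ⟨hg, K', hK', h'⟩ := hg
  refine ⟨hf.prodMk hg, K + K', by positivity, fun y => ?_⟩
  have h1 : 0 ≤ K * (1 + ‖y‖) := by positivity
  have h2 : 0 ≤ K' * (1 + ‖y‖) := by positivity
  rw [Prod.norm_mk]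
  exact max_le (by linarith [h y]) (by linarith [h' y])

end LinGrowth

variable [MeasurableSpace V] [MeasurableSpace W]

/-- Measurable real functions bounded by a multiple of `1 + ‖y‖²`. -/
def QuadGrowth (φ : V → ℝ) : Prop := Measurable φ ∧ ∃ C, ∀ y, |φ y| ≤ C * (1 + ‖y‖ ^ 2)

namespace QuadGrowth

lemma of_le {φ ψ : V → ℝ} (hm : Measurable φ) (h : ∀ y, |φ y| ≤ ψ y) (hψ : QuadGrowth ψ) :
    QuadGrowth φ := by
  obtain ⟨_, C, hC⟩ := hψ
  exact ⟨hm, C, fun y => (h y).trans ((le_abs_self _).trans (hC y))⟩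

lemma const (c : ℝ) : QuadGrowth (fun _ : V => c) :=
  ⟨measurable_const, |c|, fun y => by nlinarith [abs_nonneg c, sq_nonneg ‖y‖]⟩

lemma add {φ ψ : V → ℝ} (hf : QuadGrowth φ) (hg : QuadGrowth ψ) :
    QuadGrowth (fun y => φ y + ψ y) := by
  obtain ⟨hf, K, h⟩ := hf
  obtain ⟨hg, K', h'⟩ := hg
  exact ⟨hf.add hg, K + K', fun y => (abs_add_le _ _).trans (by linarith [h y, h' y])⟩

lemma const_mul {φ : V → ℝ} (c : ℝ) (hf : QuadGrowth φ) : QuadGrowth (fun y => c * φ y) := by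
  obtain ⟨hf, K, h⟩ := hf
  refine ⟨hf.const_mul c, |c| * K, fun y => ?_⟩
  rw [abs_mul, mul_assoc]
  exact mul_le_mul_of_nonneg_left (h y) (abs_nonneg c)

lemma sub {φ ψ : V → ℝ} (hf : QuadGrowth φ) (hg : QuadGrowth ψ) :
    QuadGrowth (fun y => φ y - ψ y) := by
  have := hf.add (hg.const_mul (-1))
  simpa [sub_eq_add_neg] using this

lemma comp [BorelSpace V] [BorelSpace W] {φ : W → ℝ} {g : V → W} (hφ : QuadGrowth φ) (hg : LinGrowth g) :
    QuadGrowth (fun y => φ (g y)) := by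
  obtain ⟨hφ, C, hC⟩ := hφ
  obtain ⟨hg, K, hK, h⟩ := hg
  refine ⟨hφ.comp hg.measurable, |C| * (1 + 2 * K ^ 2), fun y => ?_⟩
  have h1 : ‖g y‖ ^ 2 ≤ 2 * K ^ 2 * (1 + ‖y‖ ^ 2) := by
    calc ‖g y‖ ^ 2 ≤ (K * (1 + ‖y‖)) ^ 2 := by gcongr; exact h y
      _ ≤ _ := by nlinarith [mul_nonneg (sq_nonneg K) (sq_nonneg (1 - ‖y‖))]
  calc |φ (g y)| ≤ C * (1 + ‖g y‖ ^ 2) := hC _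
    _ ≤ |C| * (1 + ‖g y‖ ^ 2) := by gcongr; exact le_abs_self C
    _ ≤ |C| * ((1 + 2 * K ^ 2) * (1 + ‖y‖ ^ 2)) := by
        gcongr
        nlinarith [sq_nonneg ‖y‖]
    _ = _ := by ring

lemma nsq {n : ℕ} : QuadGrowth (nsq (n := n)) :=
  ⟨continuous_nsq.measurable, n, fun y => by
    rw [abs_of_nonneg (nsq_nonneg y)]
    nlinarith [nsq_le_norm y, (Nat.cast_nonneg n : (0 : ℝ) ≤ n)]⟩

lemma log_gd {n : ℕ} (s : ℝ) : QuadGrowth (fun y : Fin n → ℂ => Real.log (gd s y)) := by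
  simp_rw [GIC.log_gd, div_eq_inv_mul]
  exact (const _).sub (nsq.const_mul _)

/-- Noise vectors have second moments, so together with `comp` this settles the integrability of
logarithms of Gaussian and mixture densities along affine images of the noise. -/
lemma integrable {φ : V → ℝ} (hφ : QuadGrowth φ) {μ : Measure V} [IsFiniteMeasure μ]
    (hμ : Integrable (fun y => ‖y‖ ^ 2) μ) : Integrable φ μ := by
  obtain ⟨hφ, C, hC⟩ := hφ
  exact (((integrable_const 1).add hμ).const_mul C).mono' hφ.aestronglyMeasurable
    (Eventually.of_forall hC)

end QuadGrowth

lemma integrable_norm_sq_prod [BorelSpace V] [BorelSpace W] {μ : Measure V} {ν : Measure W} [IsFiniteMeasure μ]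
    [IsFiniteMeasure ν] (hμ : Integrable (fun y => ‖y‖ ^ 2) μ)
    (hν : Integrable (fun y => ‖y‖ ^ 2) ν) :
    Integrable (fun y : V × W => ‖y‖ ^ 2) (μ.prod ν) := by
  refine ((hμ.comp_fst ν).add (hν.comp_snd μ)).mono' ?_ ?_
  · exact ((measurable_fst.norm).max (measurable_snd.norm)).pow_const 2 |>.aestronglyMeasurable
  · filter_upwards with y
    rw [Real.norm_of_nonneg (by positivity), Prod.norm_def, Pi.add_apply]
    rcases le_total ‖y.1‖ ‖y.2‖ with h | h
    · rw [max_eq_right h]; nlinarith [sq_nonneg ‖y.1‖]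
    · rw [max_eq_left h]; nlinarith [sq_nonneg ‖y.2‖]

end Growth

lemma integrable_norm_sq_noise (n : ℕ) : Integrable (fun y => ‖y‖ ^ 2) (noise n) :=
  integrable_nsq_noise.mono' (by fun_prop) (Eventually.of_forall fun y => by
    rw [Real.norm_of_nonneg (by positivity)]; exact norm_sq_le_nsq y)

/-! ### Densities -/

/-- The random element `T` has the positive density `f` with respect to Lebesgue measure. -/
structure HasDens {Ω V : Type*} [MeasurableSpace Ω] [MeasureSpace V] (μ : Measure Ω) (T : Ω → V)
    (f : V → ℝ) : Prop where
  meas_map : Measurable T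
  meas : Measurable f
  pos : ∀ y, 0 < f y
  map_eq : μ.map T = volume.withDensity fun y => ENNReal.ofReal (f y)

namespace HasDens

variable {Ω Ω' V W : Type*} [MeasurableSpace Ω] [MeasurableSpace Ω'] [MeasureSpace V]
  [MeasureSpace W] {μ : Measure Ω} {μ' : Measure Ω'} {T : Ω → V} {f : V → ℝ}

lemma integral_eq (h : HasDens μ T f) {φ : V → ℝ} (hφ : Measurable φ) :
    ∫ ω, φ (T ω) ∂μ = ∫ y, f y * φ y := by
  rw [← integral_map (f := φ) h.meas_map.aemeasurable hφ.aestronglyMeasurable, h.map_eq,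
    integral_withDensity_eq_integral_toReal_smul (by have := h.meas; fun_prop)
      (Eventually.of_forall fun y => ENNReal.ofReal_lt_top)]
  simp [ENNReal.toReal_ofReal (h.pos _).le]

lemma integrable_iff (h : HasDens μ T f) {φ : V → ℝ} (hφ : Measurable φ) :
    Integrable (fun y => f y * φ y) ↔ Integrable (fun ω => φ (T ω)) μ := by
  have h1 := integrable_map_measure (f := T) (μ := μ) (g := φ) hφ.aestronglyMeasurable
    h.meas_map.aemeasurable
  rw [h.map_eq, integrable_withDensity_iff_integrable_smul' (by have := h.meas; fun_prop)
      (Eventually.of_forall fun y => ENNReal.ofReal_lt_top)] at h1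
  simp only [ENNReal.toReal_ofReal (h.pos _).le, smul_eq_mul] at h1
  exact h1

lemma integrable [IsFiniteMeasure μ] (h : HasDens μ T f) : Integrable f := by
  simpa using (h.integrable_iff (φ := fun _ => 1) measurable_const).2 (integrable_const 1)

lemma integral_one [IsProbabilityMeasure μ] (h : HasDens μ T f) : ∫ y, f y = 1 := by
  simpa using (h.integral_eq (φ := fun _ => 1) measurable_const).symm

lemma prod [SigmaFinite μ] [SigmaFinite μ'] [SigmaFinite (volume : Measure V)]
    [SigmaFinite (volume : Measure W)] {T' : Ω' → W} {f' : W → ℝ} [IsFiniteMeasure μ]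
    [IsFiniteMeasure μ']
    (h : HasDens μ T f) (h' : HasDens μ' T' f') :
    HasDens (μ.prod μ') (fun p => (T p.1, T' p.2)) (fun y => f y.1 * f' y.2) where
  meas_map := (h.meas_map.comp measurable_fst).prodMk (h'.meas_map.comp measurable_snd)
  meas := (h.meas.comp measurable_fst).mul (h'.meas.comp measurable_snd)
  pos y := mul_pos (h.pos _) (h'.pos _)
  map_eq := by
    have e : (fun p : Ω × Ω' => (T p.1, T' p.2)) = Prod.map T T' := rfl
    have := h.meas
    have := h'.meas
    rw [e, ← Measure.map_prod_map _ _ h.meas_map h'.meas_map, h.map_eq, h'.map_eq,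
      prod_withDensity (by fun_prop) (by fun_prop)]
    congr 1
    ext y
    rw [ENNReal.ofReal_mul (h.pos _).le]

/-- Adding a function of the first component to the second one shears the density. -/
lemma shear [AddGroup W] [MeasurableAdd₂ W] [MeasurableNeg W] [MeasurableSub₂ W]
    [SFinite (volume : Measure V)]
    [SFinite (volume : Measure W)] [(volume : Measure W).IsAddRightInvariant]
    {T : Ω → V × W} {f : V × W → ℝ} (h : HasDens μ T f) {g : V → W} (hg : Measurable g) :
    HasDens μ (fun ω => ((T ω).1, (T ω).2 + g (T ω).1)) (fun y => f (y.1, y.2 - g y.1)) where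
  meas_map := (h.meas_map.fst).prodMk (h.meas_map.snd.add (hg.comp h.meas_map.fst))
  meas := h.meas.comp (measurable_fst.prodMk (measurable_snd.sub (hg.comp measurable_fst)))
  pos y := h.pos _
  map_eq := by
    have hS : Measurable fun y : V × W => (y.1, y.2 + g y.1) :=
      measurable_fst.prodMk (measurable_snd.add (hg.comp measurable_fst))
    have hS' : Measurable fun y : V × W => (y.1, y.2 - g y.1) :=
      measurable_fst.prodMk (measurable_snd.sub (hg.comp measurable_fst))
    have e : (fun ω => ((T ω).1, (T ω).2 + g (T ω).1)) = (fun y : V × W => (y.1, y.2 + g y.1)) ∘ T :=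
      rfl
    rw [e, ← Measure.map_map hS h.meas_map, h.map_eq]
    have := h.meas
    have hfm : Measurable fun y => ENNReal.ofReal (f y) := by fun_prop
    have hfm' : Measurable fun y : V × W => ENNReal.ofReal (f (y.1, y.2 - g y.1)) := hfm.comp hS'
    refine Measure.ext_of_lintegral _ fun φ hφ => ?_
    rw [lintegral_map hφ hS, lintegral_withDensity_eq_lintegral_mul _ hfm
      (show Measurable fun y : V × W => φ (y.1, y.2 + g y.1) from hφ.comp hS),
      lintegral_withDensity_eq_lintegral_mul _ hfm' hφ, Measure.volume_eq_prod,
      lintegral_prod _ (by exact (hfm.mul (hφ.comp hS)).aemeasurable),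
      lintegral_prod _ (by exact (hfm'.mul hφ).aemeasurable)]
    refine lintegral_congr fun a => ?_
    refine Eq.trans ?_ (lintegral_add_right_eq_self
      (fun y => ENNReal.ofReal (f (a, y - g a)) * φ (a, y)) (g a))
    simp

end HasDens

lemma hasDens_noise {n : ℕ} {s : ℝ} (hs : 0 < s) (x : Fin n → ℂ) :
    HasDens (noise n) (fun z => x + ((√s : ℝ) : ℂ) • z) (fun y => gd s (y - x)) where
  meas_map := by fun_prop
  meas := by fun_prop
  pos y := gd_pos _ _
  map_eq := noise_map_affine hs x

lemma hasDens_noise_one {n : ℕ} (x : Fin n → ℂ) :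
    HasDens (noise n) (fun z => x + z) (fun y => gd 1 (y - x)) := by
  simpa using hasDens_noise one_pos x

/-! ### Gibbs' inequality and Fano's inequality -/

lemma mul_log_sub_log_le {p r : ℝ} (hp : 0 < p) (hr : 0 < r) :
    p * (Real.log r - Real.log p) ≤ r - p := by
  rw [← Real.log_div hr.ne' hp.ne']
  have := Real.log_le_sub_one_of_pos (div_pos hr hp)
  calc p * Real.log (r / p) ≤ p * (r / p - 1) := by gcongr
    _ = r - p := by field_simp

/-- Integrate the pointwise inequality `p (log r - log p) ≤ r - p`. Positivity everywhere avoids any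
discussion of supports. -/
theorem gibbs {V : Type*} [MeasureSpace V] {p r : V → ℝ} (hp : ∀ y, 0 < p y) (hr : ∀ y, 0 < r y)
    (ip : Integrable p) (ir : Integrable r) (h : ∫ y, r y ≤ ∫ y, p y)
    (ipp : Integrable fun y => p y * Real.log (p y))
    (ipr : Integrable fun y => p y * Real.log (r y)) :
    ∫ y, p y * Real.log (r y) ≤ ∫ y, p y * Real.log (p y) := by
  have h1 : ∫ y, (p y * Real.log (r y) - p y * Real.log (p y)) ≤ ∫ y, (r y - p y) := by
    refine integral_mono (ipr.sub ipp) (ir.sub ip) fun y => ?_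
    have := mul_log_sub_log_le (hp y) (hr y)
    simp only; linarith
  rw [integral_sub ipr ipp, integral_sub ir ip] at h1
  linarith

open Classical in
-- A variational form of Fano's inequality. A guess `q j y` for the posterior probability of message
-- `j`, of total mass at most one, turns `log (M q)` into a lower bound for the average divergence.
-- Nothing relates `r` to the densities `f j`, and this freedom is used in every application.
theorem fano {V J : Type*} [MeasureSpace V] [Fintype J] [Nonempty J]
    [MeasurableSpace J] [MeasurableSingletonClass J]
    {f : J → V → ℝ} {r : V → ℝ} {dec : V → J} (hdec : Measurable dec)
    (hf : ∀ j y, 0 < f j y) (hr : ∀ y, 0 < r y) (jf : ∀ j, Integrable (f j))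
    (hf1 : ∀ j, ∫ y, f j y = 1)
    (ir : Integrable r) (hr1 : ∫ y, r y ≤ 1)
    (iff : ∀ j, Integrable fun y => f j y * Real.log (f j y))
    (ifr : ∀ j, Integrable fun y => f j y * Real.log (r y)) :
    (1 - (∑ j, ∫ y, f j y * (if dec y = j then 0 else 1)) / Fintype.card J)
        * Real.log (Fintype.card J) - Real.log 2
      ≤ (∑ j, ((∫ y, f j y * Real.log (f j y)) - ∫ y, f j y * Real.log (r y))) / Fintype.card J := by
  set M : ℝ := (Fintype.card J : ℝ) with hM
  have hMpos : 0 < M := by rw [hM]; exact_mod_cast Fintype.card_pos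
  have hset : ∀ j, MeasurableSet {y | dec y = j} := fun j => hdec (measurableSet_singleton j)
  have hme : ∀ j, Measurable fun y => (if dec y = j then (0 : ℝ) else 1) := fun j =>
    Measurable.ite (hset j) measurable_const measurable_const
  -- The guess gives half of the mass to the decoded message and spreads the other half uniformly.
  -- Thus `log (M q)` is at least `log M - log 2` without error and equals `-log 2` with an error.
  set q : J → V → ℝ := fun j y => if dec y = j then 1 / 2 else 1 / (2 * M) with hq
  have hqm : ∀ j, Measurable (q j) := fun j =>
    Measurable.ite (hset j) measurable_const measurable_const
  have hqpos : ∀ j y, 0 < q j y := fun j y => by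
    simp only [hq]; split_ifs <;> positivity
  have hqlog : ∀ j y, Real.log (q j y)
      = -Real.log 2 - (if dec y = j then 0 else 1) * Real.log M := fun j y => by
    simp only [hq]
    split_ifs
    · rw [one_div, Real.log_inv]; ring
    · rw [one_div, Real.log_inv, Real.log_mul two_ne_zero hMpos.ne']; ring
  have hqle : ∀ j y, ‖q j y‖ ≤ 1 / 2 + 1 / (2 * M) := fun j y => by
    rw [Real.norm_of_nonneg (hqpos j y).le]
    have : 0 < 1 / (2 * M) := by positivity
    simp only [hq]; split_ifs <;> linarith
  have hqsum : ∀ y, ∑ j, q j y ≤ 1 := fun y => by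
    have h1 : ∀ j, q j y ≤ (if dec y = j then 1 / 2 else 0) + 1 / (2 * M) := fun j => by
      have : 0 < 1 / (2 * M) := by positivity
      simp only [hq]; split_ifs <;> linarith
    calc ∑ j, q j y ≤ ∑ j, ((if dec y = j then (1 : ℝ) / 2 else 0) + 1 / (2 * M)) :=
          Finset.sum_le_sum fun j _ => h1 j
      _ = 1 / 2 + M * (1 / (2 * M)) := by
          rw [Finset.sum_add_distrib, Finset.sum_ite_eq]; simp [hM]
      _ = 1 := by field_simp; norm_num
  have iqr : ∀ j, Integrable fun y => q j y * r y := fun j =>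
    ir.bdd_mul (hqm j).aestronglyMeasurable (Eventually.of_forall (hqle j))
  have ife : ∀ j, Integrable fun y => f j y * (if dec y = j then 0 else 1) := fun j => by
    refine (jf j).mul_bdd (c := 1) (hme j).aestronglyMeasurable (Eventually.of_forall fun y => ?_)
    split_ifs <;> simp
  have key : ∀ j, Real.log M - Real.log 2
      - (∫ y, f j y * (if dec y = j then 0 else 1)) * Real.log M
      + (∫ y, f j y * Real.log (r y)) - (∫ y, f j y * Real.log (f j y))
      ≤ M * (∫ y, q j y * r y) - 1 := by
    intro j
    have i1 : Integrable fun y => (Real.log M - Real.log 2) * f j y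
        - (f j y * (if dec y = j then 0 else 1)) * Real.log M :=
      ((jf j).const_mul _).sub ((ife j).mul_const _)
    have i2 : Integrable fun y => (Real.log M - Real.log 2) * f j y
        - (f j y * (if dec y = j then 0 else 1)) * Real.log M + f j y * Real.log (r y) :=
      i1.add (ifr j)
    have h1 : ∫ y, ((Real.log M - Real.log 2) * f j y
        - (f j y * (if dec y = j then 0 else 1)) * Real.log M
        + f j y * Real.log (r y) - f j y * Real.log (f j y))
        ≤ ∫ y, (M * (q j y * r y) - f j y) := by
      refine integral_mono (i2.sub (iff j)) (((iqr j).const_mul _).sub (jf j)) fun y => ?_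
      -- The comparison function is `M q r`; averaging over `j` its mass is at most that of `r`.
      have h2 := mul_log_sub_log_le (hf j y)
        (mul_pos hMpos (mul_pos (hqpos j y) (hr y)))
      rw [Real.log_mul hMpos.ne' (mul_pos (hqpos j y) (hr y)).ne',
        Real.log_mul (hqpos j y).ne' (hr y).ne', hqlog] at h2
      simp only
      linarith
    rw [integral_sub i2 (iff j), integral_add i1 (ifr j),
      integral_sub ((jf j).const_mul _) ((ife j).mul_const _), integral_const_mul,
      integral_mul_const, integral_sub ((iqr j).const_mul _) (jf j), integral_const_mul, hf1,
      mul_one] at h1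
    exact h1
  have hsum := Finset.sum_le_sum fun j (_ : j ∈ Finset.univ) => key j
  have hq1 : ∑ j, ∫ y, q j y * r y ≤ 1 := by
    rw [← integral_finsetSum _ fun j _ => iqr j]
    refine le_trans (integral_mono (integrable_finsetSum _ fun j _ => iqr j) ir fun y => ?_) hr1
    simp only
    rw [← Finset.sum_mul]
    exact mul_le_of_le_one_left (hr y).le (hqsum y)
  simp only [Finset.sum_add_distrib, Finset.sum_sub_distrib, ← Finset.sum_mul, ← Finset.mul_sum,
    Finset.sum_const, Finset.card_univ, nsmul_eq_mul, mul_one, ← hM] at hsum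
  rw [Finset.sum_sub_distrib, le_div_iff₀ hMpos, sub_mul, mul_right_comm, sub_mul, one_mul,
    div_mul_cancel₀ _ hMpos.ne']
  nlinarith

/-! ### Averages over finite index sets -/

section Avg

variable {J : Type*} [Fintype J]

/-- The average of a function on a finite type. -/
def avg (f : J → ℝ) : ℝ := (∑ j, f j) / Fintype.card J

lemma avg_add (f g : J → ℝ) : avg (fun j => f j + g j) = avg f + avg g := by
  simp only [avg, Finset.sum_add_distrib, add_div]

lemma avg_sub (f g : J → ℝ) : avg (fun j => f j - g j) = avg f - avg g := by
  simp only [avg, Finset.sum_sub_distrib, sub_div]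

lemma avg_mul_left (c : ℝ) (f : J → ℝ) : avg (fun j => c * f j) = c * avg f := by
  simp only [avg, ← Finset.mul_sum, mul_div_assoc]

lemma avg_mul_right (c : ℝ) (f : J → ℝ) : avg (fun j => f j * c) = avg f * c := by
  simp only [avg, ← Finset.sum_mul, div_mul_eq_mul_div]

lemma avg_mono {f g : J → ℝ} (h : ∀ j, f j ≤ g j) : avg f ≤ avg g := by
  unfold avg
  gcongr with j
  exact h j

lemma avg_comm {I : Type*} [Fintype I] (f : I → J → ℝ) :
    avg (fun i => avg (f i)) = avg fun j => avg fun i => f i j := by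
  simp only [avg, ← Finset.sum_div]
  rw [Finset.sum_comm, div_right_comm]

@[simp] lemma avg_const [Nonempty J] (c : ℝ) : avg (fun _ : J => c) = c := by simp [avg]

lemma avg_pos [Nonempty J] {f : J → ℝ} (h : ∀ j, 0 < f j) : 0 < avg f :=
  div_pos (Finset.sum_pos (fun j _ => h j) Finset.univ_nonempty)
    (by exact_mod_cast Fintype.card_pos)

lemma integrable_avg_mul {Ω V : Type*} [MeasurableSpace Ω] [MeasureSpace V] {μ : Measure Ω}
    {T : J → Ω → V} {f : J → V → ℝ} (h : ∀ j, HasDens μ (T j) (f j)) {φ : V → ℝ}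
    (hφ : Measurable φ) (hi : ∀ j, Integrable (fun ω => φ (T j ω)) μ) :
    Integrable fun y => avg (fun j => f j y) * φ y := by
  simp only [← avg_mul_right]
  exact (integrable_finsetSum _ fun j _ => ((h j).integrable_iff hφ).2 (hi j)).div_const _

lemma integral_avg_mul {Ω V : Type*} [MeasurableSpace Ω] [MeasureSpace V] {μ : Measure Ω}
    {T : J → Ω → V} {f : J → V → ℝ} (h : ∀ j, HasDens μ (T j) (f j)) {φ : V → ℝ}
    (hφ : Measurable φ) (hi : ∀ j, Integrable (fun ω => φ (T j ω)) μ) :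
    ∫ y, avg (fun j => f j y) * φ y = avg fun j => ∫ ω, φ (T j ω) ∂μ := by
  simp only [← avg_mul_right]
  simp only [avg]
  rw [integral_div, integral_finsetSum _ fun j _ => ((h j).integrable_iff hφ).2 (hi j)]
  congr 1
  exact Finset.sum_congr rfl fun j _ => ((h j).integral_eq hφ).symm

lemma integrable_avg {Ω V : Type*} [MeasurableSpace Ω] [MeasureSpace V] {μ : Measure Ω}
    [IsProbabilityMeasure μ] {T : J → Ω → V} {f : J → V → ℝ} (h : ∀ j, HasDens μ (T j) (f j)) :
    Integrable fun y => avg fun j => f j y := by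
  simpa using integrable_avg_mul h (φ := fun _ => 1) measurable_const fun _ => integrable_const 1

lemma integral_avg [Nonempty J] {Ω V : Type*} [MeasurableSpace Ω] [MeasureSpace V] {μ : Measure Ω}
    [IsProbabilityMeasure μ] {T : J → Ω → V} {f : J → V → ℝ} (h : ∀ j, HasDens μ (T j) (f j)) :
    ∫ y, avg (fun j => f j y) = 1 := by
  simpa using integral_avg_mul h (φ := fun _ => 1) measurable_const fun _ => integrable_const 1

end Avg

/-! ### Gaussian mixtures and their entropy -/

section Mix

variable {n : ℕ} {J : Type*} [Fintype J]

/-- Density of a Gaussian mixture with centres `x j` and variance `s`. -/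
def mix (x : J → Fin n → ℂ) (s : ℝ) (y : Fin n → ℂ) : ℝ := avg fun j => gd s (y - x j)

/-- Differential entropy, in nats, of a Gaussian mixture. -/
def ent (x : J → Fin n → ℂ) (s : ℝ) : ℝ := -∫ y, mix x s y * Real.log (mix x s y)

@[fun_prop] lemma continuous_mix (x : J → Fin n → ℂ) (s : ℝ) : Continuous (mix x s) := by
  unfold mix avg; fun_prop

lemma integral_mix_mul (x : J → Fin n → ℂ) {s : ℝ} (hs : 0 < s) {φ : (Fin n → ℂ) → ℝ}
    (hφ : QuadGrowth φ) :
    ∫ y, mix x s y * φ y = avg fun j => ∫ z, φ (x j + ((√s : ℝ) : ℂ) • z) ∂noise n :=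
  integral_avg_mul (fun j => hasDens_noise hs (x j)) hφ.1 fun _ =>
    (hφ.comp ((LinGrowth.const _).add (LinGrowth.id.smul _))).integrable (integrable_norm_sq_noise n)

variable [Nonempty J]

lemma mix_pos (x : J → Fin n → ℂ) (s : ℝ) (y : Fin n → ℂ) : 0 < mix x s y :=
  avg_pos fun _ => gd_pos _ _

/-- A mixture is at most the peak value of one Gaussian and at least one of its components divided
by their number; both bounds have logarithms of quadratic growth. -/
lemma quadGrowth_log_mix (x : J → Fin n → ℂ) {s : ℝ} (hs : 0 < s) :
    QuadGrowth fun y => Real.log (mix x s y) := by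
  obtain ⟨j0⟩ := ‹Nonempty J›
  have : Nonempty J := ⟨j0⟩
  have hc : (0 : ℝ) < Fintype.card J := by exact_mod_cast Fintype.card_pos
  refine QuadGrowth.of_le (ψ := fun y => |(n : ℝ) * Real.log (Real.pi * s)|
    + Real.log (Fintype.card J) + s⁻¹ * nsq (y - x j0)) ?_ (fun y => ?_) ?_
  · exact Real.measurable_log.comp (continuous_mix x s).measurable
  · have hcard : (0 : ℝ) ≤ Real.log (Fintype.card J) :=
      Real.log_nonneg (by exact_mod_cast Fintype.card_pos)
    have hn := nsq_nonneg (y - x j0)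
    have hn' : 0 ≤ s⁻¹ * nsq (y - x j0) := by positivity
    have hup : Real.log (mix x s y) ≤ -(n * Real.log (Real.pi * s)) := by
      rw [Real.log_le_iff_le_exp (mix_pos x s y)]
      calc mix x s y ≤ avg fun _ : J => Real.exp (-(n * Real.log (Real.pi * s))) :=
            avg_mono fun j => gd_le hs _
        _ = _ := avg_const _
    have hlow : Real.log (gd s (y - x j0)) - Real.log (Fintype.card J)
        ≤ Real.log (mix x s y) := by
      rw [← Real.log_div (gd_pos _ _).ne' hc.ne']
      refine Real.log_le_log (div_pos (gd_pos _ _) hc) ?_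
      unfold mix avg
      gcongr
      exact Finset.single_le_sum (f := fun j => gd s (y - x j)) (fun _ _ => (gd_pos _ _).le)
        (Finset.mem_univ j0)
    rw [log_gd, div_eq_inv_mul] at hlow
    have h1 := neg_abs_le ((n : ℝ) * Real.log (Real.pi * s))
    have h2 := le_abs_self ((n : ℝ) * Real.log (Real.pi * s))
    rw [abs_le]
    constructor <;> linarith
  · exact (QuadGrowth.const _).add
      ((QuadGrowth.nsq.comp (LinGrowth.id.sub (LinGrowth.const _))).const_mul _)

/-- The form in which entropies come out of the divergences: an average over messages of an
expectation over the noise. -/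
lemma ent_eq (x : J → Fin n → ℂ) {s : ℝ} (hs : 0 < s) :
    avg (fun j => ∫ z, Real.log (mix x s (x j + ((√s : ℝ) : ℂ) • z)) ∂noise n) = -ent x s := by
  rw [ent, neg_neg, integral_mix_mul x hs (quadGrowth_log_mix x hs)]

lemma lintegral_eq_one_iff {V : Type*} [MeasureSpace V] {r : V → ℝ} (hm : Measurable r)
    (h0 : ∀ y, 0 ≤ r y) (h : ∫⁻ y, ENNReal.ofReal (r y) = 1) : Integrable r ∧ ∫ y, r y = 1 := by
  constructor
  · refine ⟨hm.aestronglyMeasurable, ?_⟩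
    rw [hasFiniteIntegral_iff_ofReal (Eventually.of_forall h0), h]; simp
  · rw [integral_eq_lintegral_of_nonneg_ae (Eventually.of_forall h0) hm.aestronglyMeasurable, h]
    simp

lemma lintegral_gd {s : ℝ} (hs : 0 < s) (c : Fin n → ℂ) :
    ∫⁻ y : Fin n → ℂ, ENNReal.ofReal (gd s (y - c)) = 1 := by
  have h := hasDens_noise hs c
  rw [← ofReal_integral_eq_lintegral_ofReal h.integrable
    (Eventually.of_forall fun y => (h.pos y).le), h.integral_one, ENNReal.ofReal_one]

lemma lintegral_mix (x : J → Fin n → ℂ) {s : ℝ} (hs : 0 < s) :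
    ∫⁻ y : Fin n → ℂ, ENNReal.ofReal (mix x s y) = 1 := by
  have h := fun j => hasDens_noise hs (x j)
  unfold mix
  rw [← ofReal_integral_eq_lintegral_ofReal (integrable_avg h)
    (Eventually.of_forall fun y => (mix_pos x s y).le), integral_avg h, ENNReal.ofReal_one]

end Mix

/-! ### Independent noise vectors -/

instance sFinite_noise_prod (n : ℕ) : SFinite ((noise n).prod (noise n)) :=
  @Measure.prod.instSFinite _ _ _ _ _ _ _ _

lemma integrable_norm_sq_noise_prod (n : ℕ) :
    Integrable (fun y => ‖y‖ ^ 2) ((noise n).prod (noise n)) :=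
  integrable_norm_sq_prod (integrable_norm_sq_noise n) (integrable_norm_sq_noise n)

lemma integrable_norm_sq_noise_prod_prod (n : ℕ) :
    Integrable (fun y => ‖y‖ ^ 2) (((noise n).prod (noise n)).prod (noise n)) :=
  integrable_norm_sq_prod (integrable_norm_sq_noise_prod n) (integrable_norm_sq_noise n)

/-- A linear combination of three independent noise vectors is a scaled noise vector. -/
lemma noise_prod_prod_map (n : ℕ) (a b e : ℂ) (s : ℝ)
    (h : s ^ 2 = ‖a‖ ^ 2 + ‖b‖ ^ 2 + ‖e‖ ^ 2) :
    (((noise n).prod (noise n)).prod (noise n)).map (fun p => a • p.1.1 + b • p.1.2 + e • p.2)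
      = (noise n).map (fun z => (s : ℂ) • z) := by
  set t : ℝ := √(‖a‖ ^ 2 + ‖b‖ ^ 2) with ht
  have ht2 : t ^ 2 = ‖a‖ ^ 2 + ‖b‖ ^ 2 := Real.sq_sqrt (by positivity)
  have h1 := noise_prod_map n a b t ht2
  have e1 : (fun p : ((Fin n → ℂ) × (Fin n → ℂ)) × (Fin n → ℂ) => a • p.1.1 + b • p.1.2 + e • p.2)
      = (fun q : (Fin n → ℂ) × (Fin n → ℂ) => q.1 + q.2) ∘
        Prod.map (fun p : (Fin n → ℂ) × (Fin n → ℂ) => a • p.1 + b • p.2)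
          (fun z : Fin n → ℂ => e • z) := rfl
  have e2 : (fun p : (Fin n → ℂ) × (Fin n → ℂ) => (t : ℂ) • p.1 + e • p.2)
      = (fun q : (Fin n → ℂ) × (Fin n → ℂ) => q.1 + q.2) ∘
        Prod.map (fun z : Fin n → ℂ => (t : ℂ) • z) (fun z : Fin n → ℂ => e • z) := rfl
  have k1 : (((noise n).prod (noise n)).map (fun p => a • p.1 + b • p.2)).prod
      ((noise n).map (fun z => e • z))
      = (((noise n).prod (noise n)).prod (noise n)).map
        (Prod.map (fun p => a • p.1 + b • p.2) (fun z => e • z)) := by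
    have hm1 : Measurable fun p : (Fin n → ℂ) × (Fin n → ℂ) => a • p.1 + b • p.2 := by fun_prop
    have hm2 : Measurable fun z : Fin n → ℂ => e • z := by fun_prop
    exact Measure.map_prod_map ((noise n).prod (noise n)) (noise n) hm1 hm2
  have k2 : ((noise n).map (fun z => (t : ℂ) • z)).prod ((noise n).map (fun z => e • z))
      = ((noise n).prod (noise n)).map
        (Prod.map (fun z => (t : ℂ) • z) (fun z => e • z)) :=
    Measure.map_prod_map _ _ (by fun_prop) (by fun_prop)
  rw [← noise_prod_map n t e s (by simp [h, ht2]), e1, e2,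
    ← Measure.map_map (by fun_prop) (by fun_prop), ← Measure.map_map (by fun_prop) (by fun_prop),
    ← k1, ← k2, h1]

lemma integral_noise_prod {n : ℕ} (c : Fin n → ℂ) (a b : ℂ) {s : ℝ}
    (h : s ^ 2 = ‖a‖ ^ 2 + ‖b‖ ^ 2) {φ : (Fin n → ℂ) → ℝ} (hφ : Measurable φ) :
    ∫ p, φ (c + (a • p.1 + b • p.2)) ∂((noise n).prod (noise n))
      = ∫ z, φ (c + (s : ℂ) • z) ∂noise n := by
  have hm : Measurable fun y => φ (c + y) := hφ.comp (by fun_prop)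
  rw [← integral_map (μ := (noise n).prod (noise n)) (φ := fun p => a • p.1 + b • p.2)
    (f := fun y => φ (c + y)) (by fun_prop) hm.aestronglyMeasurable, noise_prod_map n a b s h,
    integral_map (by fun_prop) hm.aestronglyMeasurable]

lemma integral_noise_prod_prod {n : ℕ} (c : Fin n → ℂ) (a b e : ℂ) {s : ℝ}
    (h : s ^ 2 = ‖a‖ ^ 2 + ‖b‖ ^ 2 + ‖e‖ ^ 2) {φ : (Fin n → ℂ) → ℝ} (hφ : Measurable φ) :
    ∫ p, φ (c + (a • p.1.1 + b • p.1.2 + e • p.2)) ∂(((noise n).prod (noise n)).prod (noise n))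
      = ∫ z, φ (c + (s : ℂ) • z) ∂noise n := by
  have hm : Measurable fun y => φ (c + y) := hφ.comp (by fun_prop)
  rw [← integral_map (μ := ((noise n).prod (noise n)).prod (noise n))
    (φ := fun p => a • p.1.1 + b • p.1.2 + e • p.2)
    (f := fun y => φ (c + y)) (by fun_prop) hm.aestronglyMeasurable,
    noise_prod_prod_map n a b e s h, integral_map (by fun_prop) hm.aestronglyMeasurable]

lemma integral_nsq_prod {n : ℕ} (c : Fin n → ℂ) (a b : ℂ) :
    ∫ p, nsq (c + (a • p.1 + b • p.2)) ∂((noise n).prod (noise n))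
      = nsq c + n * (‖a‖ ^ 2 + ‖b‖ ^ 2) := by
  have h : √(‖a‖ ^ 2 + ‖b‖ ^ 2) ^ 2 = ‖a‖ ^ 2 + ‖b‖ ^ 2 := Real.sq_sqrt (by positivity)
  rw [integral_noise_prod c a b h continuous_nsq.measurable, integral_nsq_affine, ← h]
  simp

lemma integral_nsq_prod_prod {n : ℕ} (c : Fin n → ℂ) (a b e : ℂ) :
    ∫ p, nsq (c + (a • p.1.1 + b • p.1.2 + e • p.2))
        ∂(((noise n).prod (noise n)).prod (noise n))
      = nsq c + n * (‖a‖ ^ 2 + ‖b‖ ^ 2 + ‖e‖ ^ 2) := by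
  have h : √(‖a‖ ^ 2 + ‖b‖ ^ 2 + ‖e‖ ^ 2) ^ 2 = ‖a‖ ^ 2 + ‖b‖ ^ 2 + ‖e‖ ^ 2 :=
    Real.sq_sqrt (by positivity)
  rw [integral_noise_prod_prod c a b e h continuous_nsq.measurable, integral_nsq_affine, ← h]
  simp

lemma integral_log_gd {n : ℕ} {s : ℝ} (hs : 0 < s) :
    ∫ z : Fin n → ℂ, Real.log (gd s (((√s : ℝ) : ℂ) • z)) ∂noise n
      = -(n * Real.log (Real.pi * s)) - n := by
  simp_rw [log_gd, nsq_smul]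
  have e : ‖((√s : ℝ) : ℂ)‖ ^ 2 = s := by simp [Real.sq_sqrt hs.le]
  simp_rw [e, mul_div_cancel_left₀ _ hs.ne']
  rw [integral_sub (integrable_const _) integrable_nsq_noise, integral_nsq_noise]
  simp

/-! ### The worst additive noise -/

section WorstNoise

variable {n : ℕ} {J : Type*} [Fintype J] [Nonempty J]

/-- Split the larger noise as the smaller one plus an independent `N` of variance `t = s2 - s1`. The
difference of entropies is minus the information between `N` and the total. That information is
smallest when the rest is Gaussian, since a linear estimate of `N` from the total never does worse
than its Gaussian value. Gibbs' inequality for the pair (smaller output, `N`) makes this precise. -/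
theorem ent_sub_ent_le (x : J → Fin n → ℂ) {P s1 s2 : ℝ} (hP : 0 ≤ P) (hs1 : 0 < s1)
    (h12 : s1 ≤ s2) (hx : avg (fun j => nsq (x j)) ≤ n * P) :
    ent x s1 - ent x s2 ≤ n * Real.log ((P + s1) / (P + s2)) := by
  rcases h12.eq_or_lt with rfl | hlt
  · rw [div_self (by linarith)]; simp
  set t := s2 - s1 with ht
  have htpos : 0 < t := by linarith
  have hs2 : 0 < s2 := by linarith
  -- `k` is the linear estimation coefficient of `N` from the total when the input has variance `P`,
  -- and `m` is the resulting error variance.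
  set k := t / (P + s2) with hk
  set m := t * (P + s1) / (P + s2) with hm
  have hPs1 : 0 < P + s1 := by linarith
  have hPs2 : 0 < P + s2 := by linarith
  have hmpos : 0 < m := by positivity
  set T : J → (Fin n → ℂ) × (Fin n → ℂ) → (Fin n → ℂ) × (Fin n → ℂ) :=
    fun j p => (x j + ((√s1 : ℝ) : ℂ) • p.1, 0 + ((√t : ℝ) : ℂ) • p.2) with hT
  have hd : ∀ j, HasDens ((noise n).prod (noise n)) (T j)
      (fun y => gd s1 (y.1 - x j) * gd t (y.2 - 0)) := fun j =>
    (hasDens_noise hs1 (x j)).prod (hasDens_noise htpos 0)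
  have hTl : ∀ j, LinGrowth (T j) := fun j =>
    ((LinGrowth.const _).add (LinGrowth.id.fst.smul _)).prodMk
      ((LinGrowth.const _).add (LinGrowth.id.snd.smul _))
  set p : (Fin n → ℂ) × (Fin n → ℂ) → ℝ := fun y => mix x s1 y.1 * gd t y.2 with hp
  -- Reference density: the total keeps its true law, and `N` given the total is Gaussian about its
  -- linear estimate.
  set r : (Fin n → ℂ) × (Fin n → ℂ) → ℝ :=
    fun y => mix x s2 (y.1 + y.2) * gd m (y.2 - (k : ℂ) • (y.1 + y.2)) with hr
  have hpavg : ∀ y, p y = avg fun j => gd s1 (y.1 - x j) * gd t (y.2 - 0) := fun y => by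
    simp only [hp, mix, sub_zero, avg_mul_right]
  have hppos : ∀ y, 0 < p y := fun y => mul_pos (mix_pos _ _ _) (gd_pos _ _)
  have hrpos : ∀ y, 0 < r y := fun y => mul_pos (mix_pos _ _ _) (gd_pos _ _)
  have hlp : ∀ y, Real.log (p y) = Real.log (mix x s1 y.1) + Real.log (gd t y.2) := fun y =>
    Real.log_mul (mix_pos _ _ _).ne' (gd_pos _ _).ne'
  have hlr : ∀ y, Real.log (r y) = Real.log (mix x s2 (y.1 + y.2))
      + Real.log (gd m (y.2 - (k : ℂ) • (y.1 + y.2))) := fun y =>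
    Real.log_mul (mix_pos _ _ _).ne' (gd_pos _ _).ne'
  have q1 := (quadGrowth_log_mix x hs1).comp (V := (Fin n → ℂ) × (Fin n → ℂ)) LinGrowth.id.fst
  have q2 := (QuadGrowth.log_gd t).comp (V := (Fin n → ℂ) × (Fin n → ℂ)) LinGrowth.id.snd
  have q3 := (quadGrowth_log_mix x hs2).comp (V := (Fin n → ℂ) × (Fin n → ℂ))
    (LinGrowth.id.fst.add LinGrowth.id.snd)
  have q4 := (QuadGrowth.log_gd m).comp (V := (Fin n → ℂ) × (Fin n → ℂ))
    (LinGrowth.id.snd.sub ((LinGrowth.id.fst.add LinGrowth.id.snd).smul (k : ℂ)))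
  have qp : QuadGrowth fun y => Real.log (p y) := by simp_rw [hlp]; exact q1.add q2
  have qr : QuadGrowth fun y => Real.log (r y) := by simp_rw [hlr]; exact q3.add q4
  have hint : ∀ {φ : (Fin n → ℂ) × (Fin n → ℂ) → ℝ}, QuadGrowth φ → ∀ j,
      Integrable (fun ω => φ (T j ω)) ((noise n).prod (noise n)) := fun h j =>
    (h.comp (hTl j)).integrable (integrable_norm_sq_noise_prod n)
  have hr1 : Integrable r ∧ ∫ y, r y = 1 := by
    have hrc : Continuous r := by simp only [hr]; fun_prop
    refine lintegral_eq_one_iff hrc.measurable (fun y => (hrpos y).le) ?_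
    have hrm : Measurable fun y => ENNReal.ofReal (r y) := by have := hrc.measurable; fun_prop
    rw [Measure.volume_eq_prod, lintegral_prod_symm _ hrm.aemeasurable]
    -- For fixed `N`, passing from the first component to the total is a translation.
    have e : ∀ v : Fin n → ℂ, ∫⁻ a, ENNReal.ofReal (r (a, v))
        = ∫⁻ a, ENNReal.ofReal (mix x s2 a * gd m (v - (k : ℂ) • a)) := fun v =>
      lintegral_add_right_eq_self
        (fun a => ENNReal.ofReal (mix x s2 a * gd m (v - (k : ℂ) • a))) v
    simp_rw [e]
    rw [lintegral_lintegral_swap (by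
      have : Continuous (Function.uncurry fun (v : Fin n → ℂ) (a : Fin n → ℂ) =>
        mix x s2 a * gd m (v - (k : ℂ) • a)) := by
          unfold Function.uncurry; fun_prop
      exact this.measurable.ennreal_ofReal.aemeasurable)]
    have e2 : ∀ a : Fin n → ℂ, ∫⁻ v, ENNReal.ofReal (mix x s2 a * gd m (v - (k : ℂ) • a))
        = ENNReal.ofReal (mix x s2 a) := fun a => by
      simp_rw [ENNReal.ofReal_mul (mix_pos x s2 a).le]
      rw [lintegral_const_mul _ (by fun_prop), lintegral_gd hmpos, mul_one]
    simp_rw [e2]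
    exact lintegral_mix x hs2
  have hg := gibbs hppos hrpos (by rw [funext hpavg]; exact integrable_avg hd) hr1.1
    (by simp_rw [hpavg]; rw [integral_avg hd, hr1.2])
    (by
      have := integrable_avg_mul hd qp.1 (hint qp)
      simpa only [hpavg] using this)
    (by
      have := integrable_avg_mul hd qr.1 (hint qr)
      simpa only [hpavg] using this)
  have hE1 : ∫ y, p y * Real.log (p y)
      = -ent x s1 + (-(n * Real.log (Real.pi * t)) - n) := by
    have h1 := integral_avg_mul hd qp.1 (hint qp)
    simp_rw [← hpavg] at h1
    rw [h1, ← ent_eq x hs1, ← avg_const (J := J) (-(n * Real.log (Real.pi * t)) - n), ← avg_add]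
    congr 1
    ext j
    simp only [hlp, hT]
    rw [integral_add (hint q1 j) (hint q2 j),
      integral_fun_fst (fun z : Fin n → ℂ => Real.log (mix x s1 (x j + ((√s1 : ℝ) : ℂ) • z))),
      integral_fun_snd (fun z : Fin n → ℂ => Real.log (gd t (0 + ((√t : ℝ) : ℂ) • z)))]
    simp only [zero_add, integral_log_gd htpos]
    simp
  have hE2 : -ent x s2 - n * Real.log (Real.pi * m) - n ≤ ∫ y, p y * Real.log (r y) := by
    have h1 := integral_avg_mul hd qr.1 (hint qr)
    simp_rw [← hpavg] at h1
    have h2 : ∀ j, ∫ ω, Real.log (r (T j ω)) ∂((noise n).prod (noise n))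
        = ∫ z, Real.log (mix x s2 (x j + ((√s2 : ℝ) : ℂ) • z)) ∂noise n
          + (-(n * Real.log (Real.pi * m))
            - (k ^ 2 * nsq (x j) + n * (k ^ 2 * s1 + (1 - k) ^ 2 * t)) * m⁻¹) := fun j => by
      simp only [hlr]
      rw [integral_add (hint q3 j) (hint q4 j)]
      congr 1
      · rw [← integral_noise_prod (x j) ((√s1 : ℝ) : ℂ) ((√t : ℝ) : ℂ) (s := √s2)
          (by simp [Real.sq_sqrt, hs1.le, hs2.le, htpos.le]; linarith)
          (quadGrowth_log_mix x hs2).1]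
        congr 1
        ext ω
        simp only [hT]
        congr 2
        abel
      · have e3 : ∀ ω : (Fin n → ℂ) × (Fin n → ℂ),
            (T j ω).2 - (k : ℂ) • ((T j ω).1 + (T j ω).2)
            = -(k : ℂ) • x j + ((-(k * √s1) : ℂ) • ω.1 + ((1 - k) * √t : ℂ) • ω.2) := fun ω => by
          simp only [hT]; module
        have q5 := (QuadGrowth.nsq (n := n)).comp (V := (Fin n → ℂ) × (Fin n → ℂ))
          ((LinGrowth.const (-(k : ℂ) • x j)).add ((LinGrowth.id.fst.smul (-(k * √s1) : ℂ)).add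
            (LinGrowth.id.snd.smul ((1 - k) * √t : ℂ))))
        simp_rw [e3, log_gd, div_eq_mul_inv]
        rw [integral_sub (integrable_const _)
          ((q5.integrable (integrable_norm_sq_noise_prod n)).mul_const _), integral_mul_const,
          integral_nsq_prod, nsq_smul]
        have e4 : ‖(-(k * √s1) : ℂ)‖ ^ 2 = k ^ 2 * s1 := by
          simp [mul_pow, Real.sq_sqrt hs1.le]
        have e5 : ‖((1 - k) * √t : ℂ)‖ ^ 2 = (1 - k) ^ 2 * t := by
          rw [← Complex.ofReal_one, ← Complex.ofReal_sub, ← Complex.ofReal_mul, Complex.norm_real,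
            Real.norm_eq_abs, sq_abs, mul_pow, Real.sq_sqrt htpos.le]
        rw [e4, e5]
        simp
    rw [h1]
    simp_rw [h2]
    rw [avg_add, ent_eq x hs2, avg_sub, avg_const, avg_mul_right, avg_add, avg_const, avg_mul_left]
    -- The only use of the power constraint: the actual error of the linear estimate is at most its
    -- value `m` at full power.
    have h3 : k ^ 2 * avg (fun j => nsq (x j)) + n * (k ^ 2 * s1 + (1 - k) ^ 2 * t) ≤ n * m := by
      have h4 : k ^ 2 * (P + s1) + (1 - k) ^ 2 * t = m := by
        have : t = s2 - s1 := ht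
        rw [hk, hm]; field_simp; rw [this]; ring
      calc _ ≤ k ^ 2 * (n * P) + n * (k ^ 2 * s1 + (1 - k) ^ 2 * t) := by gcongr
        _ = n * (k ^ 2 * (P + s1) + (1 - k) ^ 2 * t) := by ring
        _ = _ := by rw [h4]
    have h5 := mul_le_mul_of_nonneg_right h3 (inv_pos.2 hmpos).le
    rw [mul_assoc (n : ℝ), mul_inv_cancel₀ hmpos.ne', mul_one] at h5
    linarith
  have hlog : Real.log (Real.pi * m) - Real.log (Real.pi * t)
      = Real.log ((P + s1) / (P + s2)) := by
    rw [← Real.log_div (by positivity) (by positivity)]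
    congr 1
    rw [hm]; field_simp
  rw [← hlog]
  linarith

end WorstNoise

/-! ### Single-user converse bounds for Gaussian mixtures -/

open Classical in
lemma integral_ite_eq {Ω J : Type*} [MeasurableSpace Ω] [MeasurableSpace J]
    [MeasurableSingletonClass J] (μ : Measure Ω) {D : Ω → J} (hD : Measurable D) (j : J) :
    ∫ ω, (if D ω = j then (0 : ℝ) else 1) ∂μ = μ.real {ω | D ω ≠ j} := by
  have hs : MeasurableSet {ω | D ω ≠ j} := (hD (measurableSet_singleton j)).compl
  rw [← integral_indicator_one hs]
  congr 1
  ext ω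
  by_cases h : D ω = j <;> simp [h]

open Classical in
lemma measurable_ite_eq {V J : Type*} [MeasurableSpace V] [MeasurableSpace J]
    [MeasurableSingletonClass J] {D : V → J} (hD : Measurable D) (j : J) :
    Measurable fun y => if D y = j then (0 : ℝ) else 1 :=
  Measurable.ite (hD (measurableSet_singleton j)) measurable_const measurable_const

/-- Fano's inequality for a family of mixture densities and an arbitrary reference density. -/
theorem fano_mixture {Ω V I J : Type*} [MeasurableSpace Ω] [MeasureSpace V] [Fintype I]
    [Nonempty I] [Fintype J] [Nonempty J] [MeasurableSpace J] [MeasurableSingletonClass J]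
    {μ : Measure Ω} [IsProbabilityMeasure μ] {T : J → I → Ω → V} {f : J → I → V → ℝ}
    (hT : ∀ j i, HasDens μ (T j i) (f j i)) {r : V → ℝ} {dec : V → J} (hdec : Measurable dec)
    (hr : ∀ y, 0 < r y) (ir : Integrable r) (hr1 : ∫ y, r y ≤ 1) (hrm : Measurable r)
    (iff : ∀ j i, Integrable (fun ω => Real.log (avg fun i' => f j i' (T j i ω))) μ)
    (ifr : ∀ j i, Integrable (fun ω => Real.log (r (T j i ω))) μ) :
    (1 - avg fun j => avg fun i => μ.real {ω | dec (T j i ω) ≠ j})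
        * Real.log (Fintype.card J) - Real.log 2
      ≤ avg fun j => avg fun i => (∫ ω, Real.log (avg fun i' => f j i' (T j i ω)) ∂μ)
          - ∫ ω, Real.log (r (T j i ω)) ∂μ := by
  classical
  have hm : ∀ j, Measurable fun y => avg fun i => f j i y := fun j => by
    unfold avg
    exact (Finset.measurable_fun_sum _ fun i _ => (hT j i).meas).div_const _
  have hite : ∀ j i, Integrable (fun ω => if dec (T j i ω) = j then (0 : ℝ) else 1) μ :=
    fun j i => by
      refine (integrable_const (1 : ℝ)).mono'
        ((measurable_ite_eq hdec j).comp (hT j i).meas_map).aestronglyMeasurable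
        (Eventually.of_forall fun ω => ?_)
      split_ifs <;> simp
  have h := fano (f := fun j y => avg fun i => f j i y) hdec
    (fun j y => avg_pos fun i => (hT j i).pos y) hr (fun j => integrable_avg (hT j))
    (fun j => integral_avg (hT j)) ir hr1
    (fun j => integrable_avg_mul (hT j) (φ := fun y => Real.log (avg fun i => f j i y))
      (Real.measurable_log.comp (hm j)) (iff j))
    (fun j => integrable_avg_mul (hT j) (φ := fun y => Real.log (r y))
      (Real.measurable_log.comp hrm) (ifr j))
  have e1 : ∀ j, ∫ y, (avg fun i => f j i y) * (if dec y = j then (0 : ℝ) else 1)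
      = avg fun i => μ.real {ω | dec (T j i ω) ≠ j} := fun j => by
    rw [integral_avg_mul (hT j) (measurable_ite_eq hdec j) (hite j)]
    congr 1
    ext i
    exact integral_ite_eq μ (hdec.comp (hT j i).meas_map) j
  have e2 : ∀ j, (∫ y, (avg fun i => f j i y) * Real.log (avg fun i => f j i y))
      - ∫ y, (avg fun i => f j i y) * Real.log (r y)
      = avg fun i => (∫ ω, Real.log (avg fun i' => f j i' (T j i ω)) ∂μ)
          - ∫ ω, Real.log (r (T j i ω)) ∂μ := fun j => by
    rw [avg_sub, integral_avg_mul (hT j) (φ := fun y => Real.log (avg fun i => f j i y))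
      (Real.measurable_log.comp (hm j)) (iff j),
      integral_avg_mul (hT j) (φ := fun y => Real.log (r y))
      (Real.measurable_log.comp hrm) (ifr j)]
  simp only [e1, e2] at h
  exact h

lemma mix_add_left {n : ℕ} {I : Type*} [Fintype I] (x : Fin n → ℂ) (y : I → Fin n → ℂ) (s : ℝ)
    (w : Fin n → ℂ) : (avg fun i => gd s (w - (x + y i))) = mix y s (w - x) := by
  simp only [mix, sub_sub]

instance borelSpace_triple (n : ℕ) :
    BorelSpace (((Fin n → ℂ) × (Fin n → ℂ)) × (Fin n → ℂ)) :=
  @Prod.borelSpace _ _ _ _ _ _ _ _ _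

section Fano

variable {n : ℕ} {I J : Type*} [Fintype I] [Nonempty I] [Fintype J] [Nonempty J]
  [MeasurableSpace J] [MeasurableSingletonClass J]

/-- The message `j` is sent as `x j`, and observed in Gaussian noise and interference `y i`. -/
theorem fano_gaussian (x : J → Fin n → ℂ) (y : I → Fin n → ℂ) {dec : (Fin n → ℂ) → J}
    (hdec : Measurable dec) {v : ℝ} (hv : 0 < v)
    (hxy : (avg fun j => avg fun i => nsq (x j + y i)) + n ≤ n * v) :
    (1 - avg fun j => avg fun i => (noise n).real {z | dec (x j + y i + z) ≠ j})
        * Real.log (Fintype.card J) - Real.log 2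
      ≤ n * Real.log (Real.pi * v) + n - ent y 1 := by
  have hd : ∀ j i, HasDens (noise n) (fun z => x j + y i + z) (fun w => gd 1 (w - (x j + y i))) :=
    fun j i => hasDens_noise_one _
  -- With a Gaussian reference density the cross entropy depends on the output power only.
  have hr := hasDens_noise (n := n) hv 0
  simp only [sub_zero] at hr
  have hl : ∀ j i, LinGrowth fun z : Fin n → ℂ => x j + y i + z := fun j i =>
    (LinGrowth.const _).add LinGrowth.id
  have hf := fano_mixture hd hdec hr.pos hr.integrable hr.integral_one.le hr.meas
    (fun j i => by
      simp only [mix_add_left]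
      exact ((quadGrowth_log_mix y one_pos).comp ((hl j i).sub (LinGrowth.const _))).integrable
        (integrable_norm_sq_noise n))
    (fun j i => ((QuadGrowth.log_gd v).comp (hl j i)).integrable (integrable_norm_sq_noise n))
  refine hf.trans ?_
  have e1 : ∀ j i, ∫ z, Real.log (avg fun i' => gd 1 (x j + y i + z - (x j + y i'))) ∂noise n
      = ∫ z, Real.log (mix y 1 (y i + ((√(1 : ℝ) : ℝ) : ℂ) • z)) ∂noise n := fun j i => by
    simp only [mix_add_left, add_assoc, add_sub_cancel_left]
    simp
  have e2 : ∀ j i, ∫ z, Real.log (gd v (x j + y i + z)) ∂noise n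
      = -(n * Real.log (Real.pi * v)) - (nsq (x j + y i) + n) * v⁻¹ := fun j i => by
    have h1 := integral_nsq_affine (x j + y i) 1
    simp only [one_smul, norm_one, one_pow, mul_one] at h1
    have h2 : Integrable (fun z => nsq (x j + y i + z)) (noise n) :=
      (QuadGrowth.nsq.comp (hl j i)).integrable (integrable_norm_sq_noise n)
    simp only [log_gd, div_eq_mul_inv]
    rw [integral_sub (integrable_const _) (h2.mul_const _), integral_mul_const, h1]
    simp
  simp only [e1, e2]
  simp only [avg_sub, avg_const, avg_mul_right, avg_add, ent_eq y one_pos]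
  have h3 := mul_le_mul_of_nonneg_right hxy (inv_pos.2 hv).le
  rw [mul_assoc, mul_inv_cancel₀ hv.ne', mul_one] at h3
  linarith

/-- The message is observed in Gaussian noise only; the decoder also uses independent noise. -/
theorem fano_randomized (x : J → Fin n → ℂ) {s : ℝ} (hs : 0 < s)
    {dec : (Fin n → ℂ) × (Fin n → ℂ) → J} (hdec : Measurable dec) :
    (1 - avg fun j => ((noise n).prod (noise n)).real
        {p | dec (x j + ((√s : ℝ) : ℂ) • p.1, p.2) ≠ j})
        * Real.log (Fintype.card J) - Real.log 2
      ≤ ent x s - n * Real.log (Real.pi * s) - n := by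
  have hd : ∀ (j : J) (_ : Unit), HasDens ((noise n).prod (noise n))
      (fun p => (x j + ((√s : ℝ) : ℂ) • p.1, 0 + p.2))
      (fun y => gd s (y.1 - x j) * gd 1 (y.2 - 0)) := fun j _ =>
    (hasDens_noise hs (x j)).prod (hasDens_noise_one 0)
  simp only [sub_zero, zero_add] at hd
  have hrd : ∀ j : J, _ := fun j => hd j ()
  have hravg : ∀ y : (Fin n → ℂ) × (Fin n → ℂ), mix x s y.1 * gd 1 y.2
      = avg fun j => gd s (y.1 - x j) * gd 1 y.2 := fun y => by rw [mix, avg_mul_right]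
  have hl : ∀ j, LinGrowth fun p : (Fin n → ℂ) × (Fin n → ℂ) =>
      (x j + ((√s : ℝ) : ℂ) • p.1, p.2) := fun j =>
    ((LinGrowth.const _).add (LinGrowth.id.fst.smul _)).prodMk LinGrowth.id.snd
  have hin := integrable_norm_sq_noise_prod n
  have q1 : Integrable (fun p : (Fin n → ℂ) × (Fin n → ℂ) =>
      Real.log (gd s (((√s : ℝ) : ℂ) • p.1))) ((noise n).prod (noise n)) :=
    ((QuadGrowth.log_gd s).comp (LinGrowth.id.fst.smul _)).integrable hin
  have q2 : Integrable (fun p : (Fin n → ℂ) × (Fin n → ℂ) =>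
      Real.log (gd 1 p.2)) ((noise n).prod (noise n)) :=
    ((QuadGrowth.log_gd 1).comp LinGrowth.id.snd).integrable hin
  have q3 : ∀ j, Integrable (fun p : (Fin n → ℂ) × (Fin n → ℂ) =>
      Real.log (mix x s (x j + ((√s : ℝ) : ℂ) • p.1))) ((noise n).prod (noise n)) := fun j =>
    ((quadGrowth_log_mix x hs).comp ((LinGrowth.const _).add (LinGrowth.id.fst.smul _))).integrable
      hin
  have hlr : ∀ a b : Fin n → ℂ, Real.log (mix x s a * gd 1 b)
      = Real.log (mix x s a) + Real.log (gd 1 b) := fun a b =>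
    Real.log_mul (mix_pos _ _ _).ne' (gd_pos _ _).ne'
  have hlf : ∀ a b : Fin n → ℂ, Real.log (gd s a * gd 1 b)
      = Real.log (gd s a) + Real.log (gd 1 b) := fun a b =>
    Real.log_mul (gd_pos _ _).ne' (gd_pos _ _).ne'
  -- The reference is the true output density times that of the auxiliary noise, whose contribution
  -- cancels.
  have hf := fano_mixture (I := Unit) hd hdec (r := fun y => mix x s y.1 * gd 1 y.2)
    (fun y => mul_pos (mix_pos _ _ _) (gd_pos _ _))
    (by simp only [hravg]; exact integrable_avg hrd)
    (by simp only [hravg]; exact (integral_avg hrd).le)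
    (by exact Continuous.measurable (by fun_prop))
    (fun j i => by
      simp only [avg_const, add_sub_cancel_left, hlf]
      exact q1.add q2)
    (fun j i => by
      simp only [hlr]
      exact (q3 j).add q2)
  simp only [avg_const, add_sub_cancel_left, hlf, hlr] at hf
  refine hf.trans ?_
  have e1 : ∀ j, (∫ ω, (Real.log (gd s (((√s : ℝ) : ℂ) • ω.1)) + Real.log (gd 1 ω.2))
        ∂((noise n).prod (noise n)))
      - ∫ ω, (Real.log (mix x s (x j + ((√s : ℝ) : ℂ) • ω.1)) + Real.log (gd 1 ω.2))
        ∂((noise n).prod (noise n))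
      = (-(n * Real.log (Real.pi * s)) - n)
        - ∫ z, Real.log (mix x s (x j + ((√s : ℝ) : ℂ) • z)) ∂noise n := fun j => by
    rw [integral_add q1 q2, integral_add (q3 j) q2, integral_fun_fst
      (fun z : Fin n → ℂ => Real.log (gd s (((√s : ℝ) : ℂ) • z))), integral_fun_fst
      (fun z : Fin n → ℂ => Real.log (mix x s (x j + ((√s : ℝ) : ℂ) • z))), integral_log_gd hs]
    simp
  simp only [e1]
  rw [avg_sub, ent_eq x hs, avg_const]
  linarith

/-- The message is observed through two noisy copies `β x j + z₁` and `η x j + z₂`, together with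
the interference `a i` in noise correlated with `z₁` and `z₂`. -/
theorem fano_genie (x : J → Fin n → ℂ) (a : I → Fin n → ℂ) (β η g1 g2 k l : ℂ) {ν m w : ℝ}
    (hν : 0 < ν) (hm : 0 < m) (hw : w = ‖g1‖ ^ 2 + ‖g2‖ ^ 2 + ν)
    {dec : ((Fin n → ℂ) × (Fin n → ℂ)) × (Fin n → ℂ) → J} (hdec : Measurable dec)
    (hQ : (avg fun j => avg fun i => nsq ((η - k * β) • x j - l • a i))
      + n * (‖k + l * g1‖ ^ 2 + ‖1 - l * g2‖ ^ 2 + ‖l‖ ^ 2 * ν) ≤ n * m) :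
    (1 - avg fun j => avg fun i => (((noise n).prod (noise n)).prod (noise n)).real
        {p | dec ((β • x j + p.1.1, η • x j + p.1.2),
          a i + (g1 • p.1.1 + g2 • p.1.2 + ((√ν : ℝ) : ℂ) • p.2)) ≠ j})
        * Real.log (Fintype.card J) - Real.log 2
      ≤ ent (fun j => β • x j) 1 + ent a w - ent a ν
        + n * Real.log (Real.pi * m) + n - 2 * (n * Real.log Real.pi + n) := by
  set N3 := ((noise n).prod (noise n)).prod (noise n) with hN3
  have hwpos : 0 < w := by rw [hw]; positivity
  set T : J → I → ((Fin n → ℂ) × (Fin n → ℂ)) × (Fin n → ℂ) →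
      ((Fin n → ℂ) × (Fin n → ℂ)) × (Fin n → ℂ) := fun j i p =>
    ((β • x j + p.1.1, η • x j + p.1.2),
      a i + (g1 • p.1.1 + g2 • p.1.2 + ((√ν : ℝ) : ℂ) • p.2)) with hT
  -- Given the message, the first two components reveal `z₁` and `z₂`. `G` is the part of the genie
  -- noise that they determine, and adding it is a shear of a product density.
  set G : J → (Fin n → ℂ) × (Fin n → ℂ) → (Fin n → ℂ) := fun j y =>
    g1 • (y.1 - β • x j) + g2 • (y.2 - η • x j) with hG
  have hGc : ∀ j, Continuous (G j) := fun j => by simp only [hG]; fun_prop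
  have hd : ∀ j i, HasDens N3 (T j i) (fun y => gd 1 (y.1.1 - β • x j) * gd 1 (y.1.2 - η • x j)
      * gd ν (y.2 - G j y.1 - a i)) := fun j i => by
    have h := (((hasDens_noise_one (β • x j)).prod (hasDens_noise_one (η • x j))).prod
      (hasDens_noise hν (a i))).shear (hGc j).measurable
    convert h using 1
    ext p : 1
    simp only [hT, hG, add_sub_cancel_left]
    congr 1
    abel
  have hlT : ∀ j i, LinGrowth (T j i) := fun j i =>
    (((LinGrowth.const _).add LinGrowth.id.fst.fst).prodMk
      ((LinGrowth.const _).add LinGrowth.id.fst.snd)).prodMk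
      ((LinGrowth.const _).add (((LinGrowth.id.fst.fst.smul _).add (LinGrowth.id.fst.snd.smul _)).add
        (LinGrowth.id.snd.smul _)))
  have hin : Integrable (fun y => ‖y‖ ^ 2) N3 := integrable_norm_sq_noise_prod_prod n
  set bx : J → Fin n → ℂ := fun j => β • x j with hbx
  -- The first copy and the genie signal get their true marginals as if independent. The second copy
  -- is Gaussian about the estimate `k y + l u`, with error variance `m`. This encodes `h(y₁, y₂, u)
  -- ≤ h(y₁) + h(u) + h(y₂ | y₁, u)` and the Gaussian bound on the last term.
  set r : ((Fin n → ℂ) × (Fin n → ℂ)) × (Fin n → ℂ) → ℝ := fun y =>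
    mix bx 1 y.1.1 * mix a w y.2 * gd m (y.1.2 - k • y.1.1 - l • y.2) with hr
  have hrpos : ∀ y, 0 < r y := fun y =>
    mul_pos (mul_pos (mix_pos _ _ _) (mix_pos _ _ _)) (gd_pos _ _)
  have hlr : ∀ y, Real.log (r y) = Real.log (mix bx 1 y.1.1) + Real.log (mix a w y.2)
      + Real.log (gd m (y.1.2 - k • y.1.1 - l • y.2)) := fun y => by
    simp only [hr]
    rw [Real.log_mul (mul_pos (mix_pos _ _ _) (mix_pos _ _ _)).ne' (gd_pos _ _).ne',
      Real.log_mul (mix_pos _ _ _).ne' (mix_pos _ _ _).ne']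
  have hrc : Continuous r := by simp only [hr]; fun_prop
  have hr1 : Integrable r ∧ ∫ y, r y = 1 := by
    refine lintegral_eq_one_iff hrc.measurable (fun y => (hrpos y).le) ?_
    have hrm : Measurable fun y => ENNReal.ofReal (r y) := hrc.measurable.ennreal_ofReal
    rw [Measure.volume_eq_prod, lintegral_prod_symm _ hrm.aemeasurable]
    have e1 : ∀ u : Fin n → ℂ, ∫⁻ yw : (Fin n → ℂ) × (Fin n → ℂ), ENNReal.ofReal (r (yw, u))
        = ENNReal.ofReal (mix a w u) := fun u => by
      rw [Measure.volume_eq_prod, lintegral_prod _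
        (show AEMeasurable (fun yw : (Fin n → ℂ) × (Fin n → ℂ) => ENNReal.ofReal (r (yw, u))) _
          from (hrm.comp (measurable_id.prodMk measurable_const)).aemeasurable)]
      have e2 : ∀ y : Fin n → ℂ, ∫⁻ v : Fin n → ℂ, ENNReal.ofReal (r ((y, v), u))
          = ENNReal.ofReal (mix a w u) * ENNReal.ofReal (mix bx 1 y) := fun y => by
        simp only [hr, sub_sub]
        simp_rw [ENNReal.ofReal_mul (mul_pos (mix_pos bx 1 y) (mix_pos a w u)).le]
        rw [lintegral_const_mul _ (by fun_prop), lintegral_gd hm, mul_one,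
          ENNReal.ofReal_mul (mix_pos _ _ _).le, mul_comm]
      simp_rw [e2]
      rw [lintegral_const_mul _ (by fun_prop), lintegral_mix bx one_pos, mul_one]
    simp_rw [e1]
    exact lintegral_mix a hwpos
  have q1 : Integrable (fun p => Real.log (gd 1 p.1.1)) N3 :=
    ((QuadGrowth.log_gd 1).comp LinGrowth.id.fst.fst).integrable hin
  have q2 : Integrable (fun p => Real.log (gd 1 p.1.2)) N3 :=
    ((QuadGrowth.log_gd 1).comp LinGrowth.id.fst.snd).integrable hin
  have q3 : ∀ i, Integrable (fun p => Real.log (mix a ν (a i + ((√ν : ℝ) : ℂ) • p.2))) N3 :=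
    fun i => ((quadGrowth_log_mix a hν).comp
      ((LinGrowth.const _).add (LinGrowth.id.snd.smul _))).integrable hin
  have q4 : ∀ j i, Integrable (fun p => Real.log (mix bx 1 (T j i p).1.1)) N3 := fun j i =>
    ((quadGrowth_log_mix bx one_pos).comp (hlT j i).fst.fst).integrable hin
  have q5 : ∀ j i, Integrable (fun p => Real.log (mix a w (T j i p).2)) N3 := fun j i =>
    ((quadGrowth_log_mix a hwpos).comp (hlT j i).snd).integrable hin
  have q6 : ∀ j i, Integrable (fun p => Real.log (gd m ((T j i p).1.2 - k • (T j i p).1.1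
      - l • (T j i p).2))) N3 := fun j i =>
    ((QuadGrowth.log_gd m).comp (((hlT j i).fst.snd.sub ((hlT j i).fst.fst.smul k)).sub
      ((hlT j i).snd.smul l))).integrable hin
  have hlf : ∀ j i p, Real.log (avg fun i' => gd 1 ((T j i p).1.1 - β • x j)
      * gd 1 ((T j i p).1.2 - η • x j) * gd ν ((T j i p).2 - G j (T j i p).1 - a i'))
      = Real.log (gd 1 p.1.1) + Real.log (gd 1 p.1.2)
        + Real.log (mix a ν (a i + ((√ν : ℝ) : ℂ) • p.2)) := fun j i p => by
    have h1 : (T j i p).2 - G j (T j i p).1 = a i + ((√ν : ℝ) : ℂ) • p.2 := by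
      simp only [hT, hG, add_sub_cancel_left]; abel
    have h2 : (T j i p).1.1 - β • x j = p.1.1 := by simp only [hT, add_sub_cancel_left]
    have h3 : (T j i p).1.2 - η • x j = p.1.2 := by simp only [hT, add_sub_cancel_left]
    rw [h1, h2, h3, avg_mul_left, ← mix, Real.log_mul (mul_pos (gd_pos _ _) (gd_pos _ _)).ne'
      (mix_pos _ _ _).ne', Real.log_mul (gd_pos _ _).ne' (gd_pos _ _).ne']
  have hf := fano_mixture hd hdec hrpos hr1.1 hr1.2.le hrc.measurable
    (fun j i => by
      simp only [hlf]
      exact (q1.add q2).add (q3 i))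
    (fun j i => by
      simp only [hlr]
      exact ((q4 j i).add (q5 j i)).add (q6 j i))
  simp only [hlf, hlr] at hf
  refine hf.trans ?_
  have hlog1 : ∫ z : Fin n → ℂ, Real.log (gd 1 z) ∂noise n = -(n * Real.log Real.pi) - n := by
    simpa using integral_log_gd (n := n) one_pos
  have i12 : ∫ p, Real.log (gd 1 p.1.1) ∂N3 = -(n * Real.log Real.pi) - n := by
    rw [hN3, integral_fun_fst (fun q : (Fin n → ℂ) × (Fin n → ℂ) => Real.log (gd 1 q.1)),
      integral_fun_fst (fun z : Fin n → ℂ => Real.log (gd 1 z)), hlog1]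
    simp
  have i12' : ∫ p, Real.log (gd 1 p.1.2) ∂N3 = -(n * Real.log Real.pi) - n := by
    rw [hN3, integral_fun_fst (fun q : (Fin n → ℂ) × (Fin n → ℂ) => Real.log (gd 1 q.2)),
      integral_fun_snd (fun z : Fin n → ℂ => Real.log (gd 1 z)), hlog1]
    simp
  have i3 : ∀ i, ∫ p, Real.log (mix a ν (a i + ((√ν : ℝ) : ℂ) • p.2)) ∂N3
      = ∫ z, Real.log (mix a ν (a i + ((√ν : ℝ) : ℂ) • z)) ∂noise n := fun i => by
    rw [hN3, integral_fun_snd (fun z : Fin n → ℂ => Real.log (mix a ν (a i + ((√ν : ℝ) : ℂ) • z)))]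
    simp
  have i4 : ∀ j i, ∫ p, Real.log (mix bx 1 (T j i p).1.1) ∂N3
      = ∫ z, Real.log (mix bx 1 (bx j + ((√(1 : ℝ) : ℝ) : ℂ) • z)) ∂noise n := fun j i => by
    simp only [hT]
    rw [hN3, integral_fun_fst (fun q : (Fin n → ℂ) × (Fin n → ℂ) =>
        Real.log (mix bx 1 (β • x j + q.1))),
      integral_fun_fst (fun z : Fin n → ℂ => Real.log (mix bx 1 (β • x j + z)))]
    simp [hbx]
  have i5 : ∀ j i, ∫ p, Real.log (mix a w (T j i p).2) ∂N3
      = ∫ z, Real.log (mix a w (a i + ((√w : ℝ) : ℂ) • z)) ∂noise n := fun j i => by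
    simp only [hT]
    exact integral_noise_prod_prod (a i) g1 g2 ((√ν : ℝ) : ℂ)
      (by rw [Real.sq_sqrt hwpos.le, hw]; simp [Real.sq_sqrt hν.le]) (quadGrowth_log_mix a hwpos).1
  have i6 : ∀ j i, ∫ p, Real.log (gd m ((T j i p).1.2 - k • (T j i p).1.1
      - l • (T j i p).2)) ∂N3 = -(n * Real.log (Real.pi * m))
        - (nsq ((η - k * β) • x j - l • a i)
          + n * (‖k + l * g1‖ ^ 2 + ‖1 - l * g2‖ ^ 2 + ‖l‖ ^ 2 * ν)) * m⁻¹ := fun j i => by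
    have e : ∀ p : ((Fin n → ℂ) × (Fin n → ℂ)) × (Fin n → ℂ),
        (T j i p).1.2 - k • (T j i p).1.1 - l • (T j i p).2
        = ((η - k * β) • x j - l • a i) + (-(k + l * g1) • p.1.1 + (1 - l * g2) • p.1.2
          + (-(l * √ν)) • p.2) := fun p => by
      simp only [hT]; module
    have q7 : Integrable (fun p : ((Fin n → ℂ) × (Fin n → ℂ)) × (Fin n → ℂ) =>
        nsq (((η - k * β) • x j - l • a i) + (-(k + l * g1) • p.1.1 + (1 - l * g2) • p.1.2
          + (-(l * √ν)) • p.2))) N3 :=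
      (QuadGrowth.nsq.comp ((LinGrowth.const _).add (((LinGrowth.id.fst.fst.smul _).add
        (LinGrowth.id.fst.snd.smul _)).add (LinGrowth.id.snd.smul _)))).integrable hin
    simp_rw [e, log_gd, div_eq_mul_inv]
    rw [integral_sub (integrable_const _) (q7.mul_const _), integral_mul_const,
      integral_nsq_prod_prod, norm_neg, norm_neg, norm_mul]
    have e2 : (‖l‖ * ‖((√ν : ℝ) : ℂ)‖) ^ 2 = ‖l‖ ^ 2 * ν := by
      simp [mul_pow, Real.sq_sqrt hν.le]
    rw [e2]
    simp
  have hsplit : ∀ j i, (∫ p, (Real.log (gd 1 p.1.1) + Real.log (gd 1 p.1.2)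
        + Real.log (mix a ν (a i + ((√ν : ℝ) : ℂ) • p.2))) ∂N3)
      - ∫ p, (Real.log (mix bx 1 (T j i p).1.1) + Real.log (mix a w (T j i p).2)
        + Real.log (gd m ((T j i p).1.2 - k • (T j i p).1.1 - l • (T j i p).2))) ∂N3
      = ((-(n * Real.log Real.pi) - n) + (-(n * Real.log Real.pi) - n)
        + ∫ z, Real.log (mix a ν (a i + ((√ν : ℝ) : ℂ) • z)) ∂noise n)
        - ((∫ z, Real.log (mix bx 1 (bx j + ((√(1 : ℝ) : ℝ) : ℂ) • z)) ∂noise n)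
        + (∫ z, Real.log (mix a w (a i + ((√w : ℝ) : ℂ) • z)) ∂noise n)
        + (-(n * Real.log (Real.pi * m))
        - (nsq ((η - k * β) • x j - l • a i)
          + n * (‖k + l * g1‖ ^ 2 + ‖1 - l * g2‖ ^ 2 + ‖l‖ ^ 2 * ν)) * m⁻¹)) := fun j i => by
    have s1 := integral_add (q1.add q2) (q3 i)
    have s2 := integral_add q1 q2
    have s3 := integral_add ((q4 j i).add (q5 j i)) (q6 j i)
    have s4 := integral_add (q4 j i) (q5 j i)
    simp only [Pi.add_apply] at s1 s2 s3 s4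
    rw [s1, s2, s3, s4, i12, i12', i3, i4, i5, i6]
  simp only [hsplit]
  simp only [avg_sub, avg_const, avg_mul_right, avg_add, ent_eq bx one_pos, ent_eq a hwpos,
    ent_eq a hν]
  have h3 := mul_le_mul_of_nonneg_right hQ (inv_pos.2 hm).le
  rw [mul_assoc (n : ℝ), mul_inv_cancel₀ hm.ne', mul_one] at h3
  linarith

end Fano

/-! ### The sum-rate bound at block length `n` -/

section Centered

variable {n : ℕ} {I J : Type*} [Fintype I] [Nonempty I] [Fintype J] [Nonempty J]

/-- Independent messages make the cross term factor through the mean of `x`, which is zero. -/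
lemma avg_nsq_add {x : J → Fin n → ℂ} (hx : ∑ j, x j = 0) (y : I → Fin n → ℂ) :
    (avg fun j => avg fun i => nsq (x j + y i))
      = (avg fun j => nsq (x j)) + avg fun i => nsq (y i) := by
  simp only [nsq_add, avg_add, avg_const, avg_mul_left]
  have h : (avg fun j => avg fun i => ∑ k, (conj (x j k) * y i k).re) = 0 := by
    rw [avg_comm]
    have h1 : ∀ i, (avg fun j => ∑ k, (conj (x j k) * y i k).re) = 0 := fun i => by
      simp only [avg]
      rw [Finset.sum_comm]
      simp only [← Complex.re_sum, ← Finset.sum_mul, ← map_sum]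
      have h2 : ∀ k, ∑ j, x j k = 0 := fun k => by
        have := congrFun hx k
        simpa using this
      simp [h2]
    simp only [h1, avg_const]
  rw [h]; ring

end Centered

/-- Error probabilities see only the law of the total noise, so noise may be split into independent
parts of total variance one. -/
lemma noise_prod_real_eq {n : ℕ} {J : Type*} [MeasurableSpace J]
    [MeasurableSingletonClass J] {D : (Fin n → ℂ) → J} (hD : Measurable D) (c : Fin n → ℂ) {a b : ℂ}
    (h : ‖a‖ ^ 2 + ‖b‖ ^ 2 = 1) (j : J) :
    ((noise n).prod (noise n)).real {p | D (c + (a • p.1 + b • p.2)) ≠ j}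
      = (noise n).real {z | D (c + z) ≠ j} := by
  classical
  have hm : Measurable fun p : (Fin n → ℂ) × (Fin n → ℂ) => c + (a • p.1 + b • p.2) := by fun_prop
  refine (integral_ite_eq _ (hD.comp hm) j).symm.trans
    (Eq.trans ?_ (integral_ite_eq _ (hD.comp (measurable_const_add c)) j))
  have := integral_noise_prod c a b (s := 1) (by rw [h]; norm_num)
    (measurable_ite_eq hD j)
  simpa using this

lemma noise_prod_prod_real_eq {n : ℕ} {J : Type*} [MeasurableSpace J]
    [MeasurableSingletonClass J] {D : (Fin n → ℂ) → J} (hD : Measurable D) (c : Fin n → ℂ)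
    {a b e : ℂ} (h : ‖a‖ ^ 2 + ‖b‖ ^ 2 + ‖e‖ ^ 2 = 1) (j : J) :
    (((noise n).prod (noise n)).prod (noise n)).real
        {p | D (c + (a • p.1.1 + b • p.1.2 + e • p.2)) ≠ j}
      = (noise n).real {z | D (c + z) ≠ j} := by
  classical
  have hm : Measurable fun p : ((Fin n → ℂ) × (Fin n → ℂ)) × (Fin n → ℂ) =>
    c + (a • p.1.1 + b • p.1.2 + e • p.2) := by fun_prop
  refine (integral_ite_eq _ (hD.comp hm) j).symm.trans
    (Eq.trans ?_ (integral_ite_eq _ (hD.comp (measurable_const_add c)) j))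
  have := integral_noise_prod_prod c a b e (s := 1) (by rw [h]; norm_num)
    (measurable_ite_eq hD j)
  simpa using this

/-- The error of the linear estimate in `rate_le_genie`, with `t = c/d` and `p = 1 - q`. The
summands come from `z₁`, from `z₂`, and from the inputs with the remaining noise. The right side is
a Schur complement: `t` is the determinant of the covariance of the two copies given the genie
signal, `vy` the variance of the first copy. -/
lemma mmse_identity {t p T B vy : ℝ} (hB : B + T = 1) (hvy : vy = B * t + T) (h0 : vy ≠ 0) :
    B * T * ((p - t) / vy) ^ 2 + (1 - (1 - p) * T / vy) ^ 2 + T * (t - p ^ 2) / vy ^ 2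
      = t / vy := by
  have hB' : B = 1 - T := by linarith
  field_simp
  rw [hvy, hB']
  ring

section Bounds

variable {n : ℕ} {J1 J2 : Type*} [Fintype J1] [Nonempty J1] [Fintype J2] [Nonempty J2]

/-- Average error probability when `j` is sent as `x j`, in the presence of interference. -/
def errProb {n : ℕ} {J I : Type*} [Fintype J] [Fintype I] (x : J → Fin n → ℂ)
    (y : I → Fin n → ℂ) (D : (Fin n → ℂ) → J) : ℝ :=
  avg fun j => avg fun i => (noise n).real {z | D (x j + y i + z) ≠ j}

/-- The output `x j + y i + z` is a degraded version of `g • x j + σ • z`. -/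
theorem rate_le_degraded [MeasurableSpace J1] [MeasurableSingletonClass J1]
    (x : J1 → Fin n → ℂ) (y : J2 → Fin n → ℂ) {D : (Fin n → ℂ) → J1}
    (hD : Measurable D) {g : ℂ} {σ : ℝ} (hσ : 0 < σ) (hσg : σ ≤ ‖g‖) :
    (1 - errProb x y D) * Real.log (Fintype.card J1) - Real.log 2
      ≤ ent (fun j => g • x j) (σ ^ 2) - n * Real.log (Real.pi * σ ^ 2) - n := by
  have hg : 0 < ‖g‖ := hσ.trans_le hσg
  have hg0 : g ≠ 0 := norm_pos_iff.1 hg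
  -- After division by `g` the observed noise has variance `(σ/‖g‖)²`; fresh noise of variance `τ²`
  -- completes it to one.
  set τ : ℝ := √(1 - (σ / ‖g‖) ^ 2) with hτ
  have hle : σ / ‖g‖ ≤ 1 := (div_le_one hg).2 hσg
  have hτ2 : τ ^ 2 = 1 - (σ / ‖g‖) ^ 2 := Real.sq_sqrt (by
    have : 0 ≤ σ / ‖g‖ := by positivity
    nlinarith)
  -- The interfering codeword is fixed here, as if revealed to the receiver. The bound does not
  -- depend on `i`, so it survives averaging.
  have hi : ∀ i, (1 - avg fun j => (noise n).real {z | D (x j + y i + z) ≠ j})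
      * Real.log (Fintype.card J1) - Real.log 2
      ≤ ent (fun j => g • x j) (σ ^ 2) - n * Real.log (Real.pi * σ ^ 2) - n := fun i => by
    have h := fano_randomized (fun j => g • x j) (s := σ ^ 2) (by positivity)
      (dec := fun p => D (g⁻¹ • p.1 + y i + (τ : ℂ) • p.2)) (hD.comp (by fun_prop))
    have e : ∀ j, ((noise n).prod (noise n)).real {p : (Fin n → ℂ) × (Fin n → ℂ) |
        D (g⁻¹ • (g • x j + ((√(σ ^ 2) : ℝ) : ℂ) • p.1) + y i + (τ : ℂ) • p.2) ≠ j}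
        = (noise n).real {z | D (x j + y i + z) ≠ j} := fun j => by
      rw [← noise_prod_real_eq hD (x j + y i) (a := g⁻¹ * σ) (b := τ) (by
        simp only [norm_mul, norm_inv, Complex.norm_real, Real.norm_eq_abs, mul_pow, sq_abs]
        rw [hτ2]; field_simp; ring) j]
      congr 1
      ext p
      have : g⁻¹ • (g • x j + ((√(σ ^ 2) : ℝ) : ℂ) • p.1) + y i + (τ : ℂ) • p.2
          = x j + y i + ((g⁻¹ * σ) • p.1 + (τ : ℂ) • p.2) := by
        rw [Real.sqrt_sq hσ.le, smul_add, smul_smul, smul_smul, inv_mul_cancel₀ hg0, one_smul]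
        abel
      simp only [Set.mem_ofPred_eq, this]
    simp only [e] at h
    exact h
  have h := avg_mono hi
  simp only [avg_sub, avg_const, avg_mul_right] at h
  rw [errProb, avg_comm]
  exact h

/-- The bound for receiver 2 with the genie signal `a i + γ N + V`, where `N` is a part of the
noise. -/
theorem rate_le_genie [MeasurableSpace J2] [MeasurableSingletonClass J2]
    (x : J2 → Fin n → ℂ) {a : J1 → Fin n → ℂ} (ha : ∑ i, a i = 0)
    {D : (Fin n → ℂ) → J2} (hD : Measurable D) (β γ : ℂ) {P A d ν q c vy : ℝ} (hP : 0 < P)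
    (hA : 0 ≤ A) (hd : 0 < d) (hν : 0 < ν) (hγ : ‖1 + γ‖ ^ 2 * d + ν = 1)
    (hβ : ‖β‖ ^ 2 * d ≤ 1) (hx : (avg fun j => nsq (x j)) ≤ n * P)
    (haA : (avg fun i => nsq (a i)) ≤ n * A) (hq : q = ‖γ‖ ^ 2 * d / (A + (‖γ‖ ^ 2 * d + ν)))
    (hc : c = P + d - d * q) (hvy : vy = ‖β‖ ^ 2 * c + 1 - ‖β‖ ^ 2 * d) :
    (1 - errProb x a D) * Real.log (Fintype.card J2) - Real.log 2
      ≤ ent (fun j => β • x j) 1 + ent a (‖γ‖ ^ 2 * d + ν) - ent a ν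
        + n * Real.log (c / (d * vy)) - n * Real.log Real.pi - n := by
  set w := ‖γ‖ ^ 2 * d + ν with hw
  have hwpos : 0 < w := by positivity
  have hAw : 0 < A + w := by linarith
  have hq1 : q ≤ 1 := by
    rw [hq, div_le_one hAw]; linarith
  have hq0 : 0 ≤ q := by rw [hq]; positivity
  have hcpos : 0 < c := by
    have : d * q ≤ d := mul_le_of_le_one_right hd.le hq1
    linarith
  -- `B` is the variance of `βD`; noise of variance `τ² = 1 - B` brings `β(x + D)` to unit noise
  -- variance.
  set B := ‖β‖ ^ 2 * d with hB
  have hB0 : 0 ≤ B := by positivity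
  set τ := √(1 - B) with hτ
  have hτ2 : τ ^ 2 = 1 - B := Real.sq_sqrt (by linarith)
  have hvy' : vy = B * (c / d) + τ ^ 2 := by
    rw [hvy, hτ2, hB]; field_simp; ring
  have hvypos : 0 < vy := by
    have h1 : 0 < c / d := by positivity
    rcases hB0.eq_or_lt with h | h
    · rw [hvy', hτ2, ← h]; norm_num
    · have := mul_pos h h1
      have := sq_nonneg τ
      linarith
  set δ := √d with hδ
  have hδpos : 0 < δ := Real.sqrt_pos.2 hd
  have hδ2 : δ ^ 2 = d := Real.sq_sqrt hd.le
  -- Since `|b|² + τ² = 1`, the pairs `(D/δ, n')` and `(z₁, z₂)`, with `n'` a unit noise independent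
  -- of `D`, are related by a unitary matrix: `D = δ (conj b z₁ - τ z₂)`.
  set b : ℂ := β * δ with hb
  have hb2 : ‖b‖ ^ 2 = B := by
    rw [hb, norm_mul, mul_pow, Complex.norm_real, Real.norm_eq_abs, sq_abs, hδ2]
  have hcb : conj b * β * δ = (B : ℂ) := by
    have : conj b * b = ((‖b‖ ^ 2 : ℝ) : ℂ) := by
      rw [mul_comm, Complex.mul_conj, Complex.normSq_eq_norm_sq]
    rw [mul_assoc, ← hb, this, hb2]
  set e0 : ℝ := τ / (δ * vy) with he0
  -- Linear estimation coefficient of `D` from the genie signal, whose variance at full power is `A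
  -- + w`; `dq` is the variance thereby removed from `D`.
  set α : ℂ := d * conj γ / ((A + w : ℝ) : ℂ) with hα
  have hαγ : α * γ = (q : ℂ) := by
    have : conj γ * γ = ((‖γ‖ ^ 2 : ℝ) : ℂ) := by
      rw [mul_comm, Complex.mul_conj, Complex.normSq_eq_norm_sq]
    rw [hα, hq, div_mul_eq_mul_div, mul_assoc, this]
    push_cast; ring
  have hα2 : ‖α‖ ^ 2 * (A + ν) = d * q * (1 - q) := by
    have h1 : ‖α‖ ^ 2 = d ^ 2 * ‖γ‖ ^ 2 / (A + w) ^ 2 := by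
      rw [hα, norm_div, norm_mul, Complex.norm_real, Complex.norm_real, RCLike.norm_conj,
        Real.norm_of_nonneg hd.le, Real.norm_of_nonneg hAw.le, div_pow, mul_pow]
    have h2 : A + ν = A + w - ‖γ‖ ^ 2 * d := by rw [hw]; ring
    rw [h1, hq, h2]
    field_simp
  -- `k` and `l` are the optimal linear coefficients for the second copy given the first copy and
  -- the genie signal, computed for Gaussian inputs.
  set k : ℂ := conj b * ((τ * (d - c) / (d * vy) : ℝ) : ℂ) with hk
  set l : ℂ := -α * e0 with hl
  -- Chosen so that `τβ + bη = 0`: the combination of the two copies whose noise is independent of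
  -- `D` carries no signal. The two copies thus amount to `x + D` and independent noise.
  set η : ℂ := ((-(τ / δ) : ℝ) : ℂ) with hη
  set g1 : ℂ := γ * δ * conj b with hg1
  set g2 : ℂ := -(γ * δ * τ) with hg2
  have hg : ‖g1‖ ^ 2 + ‖g2‖ ^ 2 = ‖γ‖ ^ 2 * d := by
    rw [hg1, hg2, norm_neg, norm_mul, norm_mul, norm_mul, norm_mul, RCLike.norm_conj, mul_pow,
      mul_pow, mul_pow, mul_pow, hb2, Complex.norm_real, Complex.norm_real, Real.norm_eq_abs,
      Real.norm_eq_abs, sq_abs, sq_abs, hδ2, hτ2]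
    ring
  have hm : 0 < c / (d * vy) := by positivity
  have hδc : (δ : ℂ) ≠ 0 := by exact_mod_cast hδpos.ne'
  have hηk : η - k * β = ((-e0 : ℝ) : ℂ) := by
    have h1 : k * β = ((B * (τ * (d - c) / (d * vy)) / δ : ℝ) : ℂ) := by
      rw [hk]
      push_cast
      rw [← hcb]
      field_simp
    rw [h1, hη, ← Complex.ofReal_sub]
    congr 1
    have hBτ : B = 1 - τ ^ 2 := by linarith
    have : vy * d = (1 - τ ^ 2) * c + τ ^ 2 * d := by rw [hvy', hBτ]; field_simp
    rw [he0, hBτ]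
    field_simp
    linear_combination -τ * this
  have hk1 : k + l * g1 = conj b * ((τ * ((1 - q) - c / d) / vy : ℝ) : ℂ) := by
    have : l * g1 = conj b * ((-(q * (τ / vy)) : ℝ) : ℂ) := by
      rw [hl, hg1]
      have h1 : (e0 * δ : ℝ) = τ / vy := by rw [he0]; field_simp
      calc -α * e0 * (γ * δ * conj b) = -(α * γ) * ((e0 * δ : ℝ) : ℂ) * conj b := by
            push_cast; ring
        _ = _ := by rw [hαγ, h1]; push_cast; ring
    rw [this, hk, ← mul_add, ← Complex.ofReal_add]
    congr 2
    field_simp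
    ring
  have hk2 : 1 - l * g2 = ((1 - q * τ ^ 2 / vy : ℝ) : ℂ) := by
    have : l * g2 = ((q * τ ^ 2 / vy : ℝ) : ℂ) := by
      rw [hl, hg2]
      have h1 : (e0 * δ * τ : ℝ) = τ ^ 2 / vy := by rw [he0]; field_simp
      calc -α * e0 * -(γ * δ * τ) = (α * γ) * ((e0 * δ * τ : ℝ) : ℂ) := by
            push_cast; ring
        _ = _ := by rw [hαγ, h1]; push_cast; ring
    rw [this]; push_cast; ring
  have hl2 : ‖l‖ ^ 2 = ‖α‖ ^ 2 * e0 ^ 2 := by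
    rw [hl, norm_mul, norm_neg, mul_pow, Complex.norm_real, Real.norm_eq_abs, sq_abs]
  have hQ : (avg fun j => avg fun i => nsq ((η - k * β) • x j - l • a i))
      + n * (‖k + l * g1‖ ^ 2 + ‖1 - l * g2‖ ^ 2 + ‖l‖ ^ 2 * ν) ≤ n * (c / (d * vy)) := by
    have h1 : (avg fun j => avg fun i => nsq ((η - k * β) • x j - l • a i))
        = e0 ^ 2 * (avg fun j => nsq (x j)) + ‖l‖ ^ 2 * avg fun i => nsq (a i) := by
      rw [avg_comm]
      have h2 : ∀ i j, nsq ((η - k * β) • x j - l • a i)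
          = nsq ((-l) • a i + (η - k * β) • x j) := fun i j => by
        congr 1; module
      simp only [h2]
      rw [avg_nsq_add (x := fun i => (-l) • a i) (by rw [← Finset.smul_sum, ha, smul_zero])]
      simp only [nsq_smul, avg_mul_left, hηk]
      rw [norm_neg, Complex.norm_real, Real.norm_eq_abs, sq_abs]; ring
    rw [h1, hk1, hk2, hl2]
    have h3 : e0 ^ 2 * (avg fun j => nsq (x j)) + ‖α‖ ^ 2 * e0 ^ 2 * (avg fun i => nsq (a i))
        ≤ e0 ^ 2 * (n * P) + ‖α‖ ^ 2 * e0 ^ 2 * (n * A) := by gcongr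
    have h4 : ‖conj b * ((τ * ((1 - q) - c / d) / vy : ℝ) : ℂ)‖ ^ 2
        = B * τ ^ 2 * (((1 - q) - c / d) / vy) ^ 2 := by
      rw [norm_mul, RCLike.norm_conj, mul_pow, hb2, Complex.norm_real, Real.norm_eq_abs, sq_abs]
      ring
    have h5 : ‖((1 - q * τ ^ 2 / vy : ℝ) : ℂ)‖ ^ 2 = (1 - (1 - (1 - q)) * τ ^ 2 / vy) ^ 2 := by
      rw [Complex.norm_real, Real.norm_eq_abs, sq_abs]; ring
    have h6 : e0 ^ 2 * P + ‖α‖ ^ 2 * e0 ^ 2 * A + ‖α‖ ^ 2 * e0 ^ 2 * ν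
        = τ ^ 2 * (c / d - (1 - q) ^ 2) / vy ^ 2 := by
      have h7 : P = c - d + d * q := by rw [hc]; ring
      have h8 : e0 ^ 2 = τ ^ 2 / (d * vy ^ 2) := by rw [he0, div_pow, mul_pow, hδ2]
      calc _ = e0 ^ 2 * (P + ‖α‖ ^ 2 * (A + ν)) := by ring
        _ = _ := by
          rw [hα2, h7, h8]; field_simp; ring
    have h9 := mmse_identity (t := c / d) (p := 1 - q) (T := τ ^ 2) (B := B) (vy := vy)
      (by linarith) hvy' hvypos.ne'
    rw [h4, h5]
    have h10 : c / (d * vy) = c / d / vy := by rw [div_div]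
    rw [h10, ← h9, ← h6]
    calc _ ≤ e0 ^ 2 * (n * P) + ‖α‖ ^ 2 * e0 ^ 2 * (n * A) + _ := by gcongr
      _ = _ := by ring
  -- The receiver rebuilds `x + D` from the two copies and adds the genie signal, which is exactly
  -- the channel output.
  have hdec : Measurable fun p : ((Fin n → ℂ) × (Fin n → ℂ)) × (Fin n → ℂ) =>
      D ((δ : ℂ) • (conj b • p.1.1 - (τ : ℂ) • p.1.2) + p.2) := hD.comp (by fun_prop)
  have h := fano_genie x a β η g1 g2 k l hν hm (w := w) (by rw [hg]) hdec hQ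
  have e : ∀ j i, (((noise n).prod (noise n)).prod (noise n)).real
      {p : ((Fin n → ℂ) × (Fin n → ℂ)) × (Fin n → ℂ) |
        D ((δ : ℂ) • (conj b • (β • x j + p.1.1) - (τ : ℂ) • (η • x j + p.1.2))
          + (a i + (g1 • p.1.1 + g2 • p.1.2 + ((√ν : ℝ) : ℂ) • p.2))) ≠ j}
      = (noise n).real {z | D (x j + a i + z) ≠ j} := fun j i => by
    rw [← noise_prod_prod_real_eq hD (x j + a i) (a := (1 + γ) * δ * conj b)
      (b := -((1 + γ) * δ * τ)) (e := (√ν : ℝ)) (by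
        rw [norm_neg, norm_mul, norm_mul, norm_mul, norm_mul, RCLike.norm_conj, mul_pow,
          mul_pow, mul_pow, mul_pow, hb2, Complex.norm_real, Complex.norm_real, Complex.norm_real,
          Real.norm_eq_abs, Real.norm_eq_abs, Real.norm_eq_abs, sq_abs, sq_abs, sq_abs, hδ2, hτ2,
          Real.sq_sqrt hν.le]
        linear_combination hγ) j]
    congr 1
    ext p
    have hone : (δ : ℂ) * conj b * β - δ * τ * η = 1 := by
      have h1 : (δ : ℂ) * τ * η = ((-(τ ^ 2) : ℝ) : ℂ) := by
        rw [hη]; push_cast; field_simp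
      have h2 : (δ : ℂ) * conj b * β = (B : ℂ) := by rw [← hcb]; ring
      rw [h1, h2, ← Complex.ofReal_sub, hτ2]; norm_num
    have : (δ : ℂ) • (conj b • (β • x j + p.1.1) - (τ : ℂ) • (η • x j + p.1.2))
          + (a i + (g1 • p.1.1 + g2 • p.1.2 + ((√ν : ℝ) : ℂ) • p.2))
        = x j + a i + (((1 + γ) * δ * conj b) • p.1.1 + (-((1 + γ) * δ * τ)) • p.1.2
          + ((√ν : ℝ) : ℂ) • p.2) := by
      have h3 : x j = ((δ : ℂ) * conj b * β - δ * τ * η) • x j := by rw [hone, one_smul]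
      conv_rhs => rw [h3]
      rw [hg1, hg2]
      module
    simp only [Set.mem_ofPred_eq, this]
  simp only [e] at h
  rw [Real.log_mul Real.pi_ne_zero hm.ne'] at h
  rw [errProb]
  linarith

/-- The sum-rate bound for one block length, for a centred first codebook. -/
theorem sum_rate_le [MeasurableSpace J1] [MeasurableSingletonClass J1] [MeasurableSpace J2]
    [MeasurableSingletonClass J2] (x1 : J1 → Fin n → ℂ) (x2 : J2 → Fin n → ℂ) (hx1 : ∑ i, x1 i = 0)
    {D1 : (Fin n → ℂ) → J1} (hD1 : Measurable D1) {D2 : (Fin n → ℂ) → J2} (hD2 : Measurable D2)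
    (h12 h21 γ : ℂ) {P1 P2 σ d ν A w q c vy : ℝ} (hP1 : 0 < P1) (hP2 : 0 < P2)
    (hp1 : (avg fun j => nsq (x1 j)) ≤ n * P1) (hp2 : (avg fun j => nsq (x2 j)) ≤ n * P2)
    (hσ : 0 < σ) (hσ1 : σ ^ 2 ≤ 1) (hσh : σ ≤ ‖h21‖)
    (hd : 0 < d) (hν : 0 < ν) (hγ : ‖1 + γ‖ ^ 2 * d + ν = 1) (hβ : ‖h12‖ ^ 2 * d ≤ 1)
    (hA : A = ‖h21‖ ^ 2 * P1) (hw : w = ‖γ‖ ^ 2 * d + ν) (hw1 : w ≤ 1)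
    (hmin : min (σ ^ 2) w ≤ ν) (hq : q = ‖γ‖ ^ 2 * d / (A + w))
    (hc : c = P2 + d - d * q) (hvy : vy = ‖h12‖ ^ 2 * c + 1 - ‖h12‖ ^ 2 * d) :
    2 * ((1 - errProb x1 (fun j => h12 • x2 j) D1) * Real.log (Fintype.card J1))
      + 2 * ((1 - errProb x2 (fun j => h21 • x1 j) D2) * Real.log (Fintype.card J2))
      - 4 * Real.log 2
      ≤ n * (Real.log (A + σ ^ 2) - Real.log (A + ν) + Real.log (A + w) - Real.log (A + 1)
        + Real.log (P1 + ‖h12‖ ^ 2 * P2 + 1) + Real.log (P2 + A + 1) - Real.log (σ ^ 2)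
        + Real.log (c / (d * vy))) := by
  have hA0 : 0 ≤ A := by rw [hA]; positivity
  set a : J1 → Fin n → ℂ := fun j => h21 • x1 j with ha
  have hasum : ∑ i, a i = 0 := by simp only [ha, ← Finset.smul_sum, hx1, smul_zero]
  have hapow : (avg fun i => nsq (a i)) ≤ n * A := by
    simp only [ha, nsq_smul, avg_mul_left, hA]
    calc _ ≤ ‖h21‖ ^ 2 * (n * P1) := by gcongr
      _ = _ := by ring
  have hypow : (avg fun j => nsq (h12 • x2 j)) ≤ ‖h12‖ ^ 2 * (n * P2) := by
    simp only [nsq_smul, avg_mul_left]; gcongr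
  have b1 := rate_le_degraded x1 (fun j => h12 • x2 j) hD1 hσ hσh
  have b2 := fano_gaussian x1 (fun j => h12 • x2 j) hD1 (v := P1 + ‖h12‖ ^ 2 * P2 + 1)
    (by positivity) (by rw [avg_nsq_add hx1]; linarith)
  have b3 := fano_gaussian x2 a hD2 (v := P2 + A + 1) (by positivity) (by
    rw [avg_comm]
    simp only [add_comm (x2 _)]
    rw [avg_nsq_add hasum]; linarith)
  have b4 := rate_le_genie x2 hasum hD2 h12 γ hP2 hA0 hd hν hγ hβ hp2 hapow
    (by rw [hq, hw]) hc hvy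
  rw [← hw] at b4
  change (1 - errProb x1 (fun j => h12 • x2 j) D1) * _ - _ ≤ _ at b2
  change (1 - errProb x2 a D2) * _ - _ ≤ _ at b3
  have hwpos : 0 < w := by rw [hw]; positivity
  have hσ2 : 0 < σ ^ 2 := by positivity
  have hents : ent a (σ ^ 2) - ent a ν + ent a w - ent a 1
      ≤ n * (Real.log (A + σ ^ 2) - Real.log (A + ν) + Real.log (A + w) - Real.log (A + 1)) := by
    have hld : ∀ s t : ℝ, 0 < s → 0 < t →
        Real.log ((A + s) / (A + t)) = Real.log (A + s) - Real.log (A + t) := fun s t hs ht =>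
      Real.log_div (by positivity) (by positivity)
    -- Whichever of `σ²` and `w` is at most `ν` is paired with `ν`; the other is at most one and is
    -- paired with the unit noise.
    rcases min_le_iff.1 hmin with h | h
    · have e1 := ent_sub_ent_le a hA0 hσ2 h hapow
      have e2 := ent_sub_ent_le a hA0 hwpos hw1 hapow
      rw [hld _ _ hσ2 hν] at e1
      rw [hld _ _ hwpos one_pos] at e2
      linarith
    · have e1 := ent_sub_ent_le a hA0 hwpos h hapow
      have e2 := ent_sub_ent_le a hA0 hσ2 hσ1 hapow
      rw [hld _ _ hwpos hν] at e1
      rw [hld _ _ hσ2 one_pos] at e2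
      linarith
  rw [Real.log_mul Real.pi_ne_zero (by positivity)] at b1 b2 b3
  linarith

end Bounds

/-! ### The sum-rate bound for codes and for the capacity region -/

/-- Power of the interference at receiver 2. -/
def Channel.crossPower (c : Channel) : ℝ := ‖c.h21‖ ^ 2 * c.P1

/-- Variance of `X₂ + D` given the genie signal `h₂₁ X₁ + γ D + V`, for `D` and `V` of variances
`d` and `ν`. -/
def genieVar (c : Channel) (d ν : ℝ) (γ : ℂ) : ℝ :=
  c.P2 + d - d * (‖γ‖ ^ 2 * d / (c.crossPower + (‖γ‖ ^ 2 * d + ν)))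

/-- Variance of `h₁₂ (X₂ + D) + Z̃` given the genie signal. -/
def genieVarY (c : Channel) (d ν : ℝ) (γ : ℂ) : ℝ :=
  ‖c.h12‖ ^ 2 * genieVar c d ν γ + 1 - ‖c.h12‖ ^ 2 * d

/-- Twice the sum-rate bound, in nats. -/
def natBound (c : Channel) (σ d ν : ℝ) (γ : ℂ) : ℝ :=
  Real.log (c.crossPower + σ ^ 2) - Real.log (c.crossPower + ν)
    + Real.log (c.crossPower + (‖γ‖ ^ 2 * d + ν)) - Real.log (c.crossPower + 1)
    + Real.log (c.P1 + ‖c.h12‖ ^ 2 * c.P2 + 1) + Real.log (c.P2 + c.crossPower + 1)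
    - Real.log (σ ^ 2) + Real.log (genieVar c d ν γ / (d * genieVarY c d ν γ))

/-- The conditions on the noise parameters under which the bound is proved. -/
structure NoiseCond (c : Channel) (σ d ν : ℝ) (γ : ℂ) : Prop where
  σ_pos : 0 < σ
  σ_le_one : σ ^ 2 ≤ 1
  σ_le : σ ≤ ‖c.h21‖
  d_pos : 0 < d
  ν_pos : 0 < ν
  total : ‖1 + γ‖ ^ 2 * d + ν = 1
  h12_le : ‖c.h12‖ ^ 2 * d ≤ 1
  var_le_one : ‖γ‖ ^ 2 * d + ν ≤ 1
  min_le : min (σ ^ 2) (‖γ‖ ^ 2 * d + ν) ≤ ν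

/-- Subtracting the mean from the first codebook lowers its average power, and shifting the decoders
accordingly leaves the error probabilities unchanged. -/
theorem sum_rate_le_of_nonempty {c : Channel} (hP1 : 0 < c.P1) (hP2 : 0 < c.P2) {σ d ν : ℝ}
    {γ : ℂ} (h : NoiseCond c σ d ν γ) {n : ℕ} {J1 J2 : Type*} [Fintype J1] [Nonempty J1]
    [Fintype J2] [Nonempty J2] [MeasurableSpace J1] [MeasurableSingletonClass J1]
    [MeasurableSpace J2] [MeasurableSingletonClass J2]
    (x1 : J1 → Fin n → ℂ) (x2 : J2 → Fin n → ℂ)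
    {D1 : (Fin n → ℂ) → J1} (hD1 : Measurable D1) {D2 : (Fin n → ℂ) → J2} (hD2 : Measurable D2)
    (hp1 : ∀ j, nsq (x1 j) ≤ n * c.P1) (hp2 : ∀ j, nsq (x2 j) ≤ n * c.P2) :
    2 * ((1 - errProb x1 (fun j => c.h12 • x2 j) D1) * Real.log (Fintype.card J1))
      + 2 * ((1 - errProb x2 (fun j => c.h21 • x1 j) D2) * Real.log (Fintype.card J2))
      - 4 * Real.log 2 ≤ n * natBound c σ d ν γ := by
  set μ : Fin n → ℂ := ((Fintype.card J1 : ℂ)⁻¹) • ∑ j, x1 j with hμ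
  have hcard : (Fintype.card J1 : ℂ) ≠ 0 := by exact_mod_cast Fintype.card_ne_zero
  have hsum : ∑ j, (x1 j - μ) = 0 := by
    rw [Finset.sum_sub_distrib, Finset.sum_const, Finset.card_univ, hμ, ← Nat.cast_smul_eq_nsmul ℂ,
      smul_smul, mul_inv_cancel₀ hcard, one_smul, sub_self]
  have hp1' : (avg fun j => nsq (x1 j - μ)) ≤ n * c.P1 := by
    have h1 := avg_nsq_add hsum (fun _ : Unit => μ)
    simp only [sub_add_cancel, avg_const] at h1
    have h2 : (avg fun j => nsq (x1 j)) ≤ avg fun _ : J1 => (n : ℝ) * c.P1 := avg_mono hp1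
    rw [avg_const] at h2
    linarith [nsq_nonneg μ]
  have hp2' : (avg fun j => nsq (x2 j)) ≤ n * c.P2 := by
    have h2 : (avg fun j => nsq (x2 j)) ≤ avg fun _ : J2 => (n : ℝ) * c.P2 := avg_mono hp2
    rwa [avg_const] at h2
  have key := sum_rate_le (fun j => x1 j - μ) x2 hsum (D1 := fun y => D1 (y + μ))
    (D2 := fun y => D2 (y + c.h21 • μ)) (hD1.comp (by fun_prop)) (hD2.comp (by fun_prop))
    c.h12 c.h21 γ hP1 hP2 hp1' hp2' h.σ_pos h.σ_le_one h.σ_le h.d_pos h.ν_pos h.total h.h12_le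
    rfl rfl h.var_le_one h.min_le rfl rfl rfl
  have e1 : errProb (fun j => x1 j - μ) (fun j => c.h12 • x2 j) (fun y => D1 (y + μ))
      = errProb x1 (fun j => c.h12 • x2 j) D1 := by
    simp only [errProb]
    have : ∀ j i, ∀ z : Fin n → ℂ, x1 j - μ + c.h12 • x2 i + z + μ = x1 j + c.h12 • x2 i + z :=
      fun j i z => by abel
    simp only [this]
  have e2 : errProb x2 (fun j => c.h21 • (x1 j - μ)) (fun y => D2 (y + c.h21 • μ))
      = errProb x2 (fun j => c.h21 • x1 j) D2 := by
    simp only [errProb]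
    have : ∀ j i, ∀ z : Fin n → ℂ, x2 j + c.h21 • (x1 i - μ) + z + c.h21 • μ
        = x2 j + c.h21 • x1 i + z := fun j i z => by rw [smul_sub]; abel
    simp only [this]
  rw [e1, e2] at key
  exact key

lemma Code.err1_eq {c : Channel} {n M1 M2 : ℕ} (C : Code c n M1 M2) :
    C.err1 = errProb C.enc1 (fun j => c.h12 • C.enc2 j) C.dec1 := by
  simp only [Code.err1, errProb, avg, Fintype.card_fin, ← Finset.sum_div, div_div]
  rw [mul_comm (M1 : ℝ)]
  rfl

lemma Code.err2_eq {c : Channel} {n M1 M2 : ℕ} (C : Code c n M1 M2) :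
    C.err2 = errProb C.enc2 (fun j => c.h21 • C.enc1 j) C.dec2 := by
  simp only [Code.err2, errProb, avg, Fintype.card_fin, ← Finset.sum_div, div_div]
  rw [Finset.sum_comm]
  have : ∀ j i, ∀ z : Fin n → ℂ, C.enc2 j + c.h21 • C.enc1 i + z
      = fun k => c.h21 * C.enc1 i k + C.enc2 j k + z k := fun j i z => by
    ext k; simp [add_comm]
  simp only [this]

lemma Code.err1_le_one {c : Channel} {n M1 M2 : ℕ} [NeZero M1] [NeZero M2] (C : Code c n M1 M2) :
    C.err1 ≤ 1 := by
  rw [C.err1_eq, errProb]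
  calc _ ≤ avg fun _ : Fin M1 => avg fun _ : Fin M2 => (1 : ℝ) :=
        avg_mono fun j => avg_mono fun i => measureReal_le_one
    _ = 1 := by simp

lemma Code.err2_le_one {c : Channel} {n M1 M2 : ℕ} [NeZero M1] [NeZero M2] (C : Code c n M1 M2) :
    C.err2 ≤ 1 := by
  rw [C.err2_eq, errProb]
  calc _ ≤ avg fun _ : Fin M2 => avg fun _ : Fin M1 => (1 : ℝ) :=
        avg_mono fun j => avg_mono fun i => measureReal_le_one
    _ = 1 := by simp

lemma numMessages_pos (n : ℕ) (R : ℝ) : 0 < numMessages n R := Nat.ceil_pos.2 (by positivity)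

instance (n : ℕ) (R : ℝ) : NeZero (numMessages n R) := ⟨(numMessages_pos n R).ne'⟩

lemma le_log_numMessages (n : ℕ) (R : ℝ) : n * R * Real.log 2 ≤ Real.log (numMessages n R) := by
  have h : (2 : ℝ) ^ ((n : ℝ) * R) ≤ numMessages n R := Nat.le_ceil _
  calc n * R * Real.log 2 = Real.log ((2 : ℝ) ^ ((n : ℝ) * R)) :=
        (Real.log_rpow two_pos _).symm
    _ ≤ _ := Real.log_le_log (by positivity) h

/-- Divide the finite block length bound by `n`: the Fano constant and the error probabilities
disappear in the limit. -/
theorem achievable_le {c : Channel} (hP1 : 0 < c.P1) (hP2 : 0 < c.P2) {σ d ν : ℝ} {γ : ℂ}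
    (h : NoiseCond c σ d ν γ) {R : ℝ × ℝ} (hR : c.Achievable R) :
    2 * (R.1 + R.2) * Real.log 2 ≤ natBound c σ d ν γ := by
  obtain ⟨-, -, C, h1, h2⟩ := hR
  set B := natBound c σ d ν γ with hB
  have key : ∀ n : ℕ, 0 < n → 2 * ((1 - (C n).err1) * (R.1 * Real.log 2))
      + 2 * ((1 - (C n).err2) * (R.2 * Real.log 2)) - 4 * Real.log 2 * (n : ℝ)⁻¹ ≤ B := by
    intro n hn
    have hb := sum_rate_le_of_nonempty hP1 hP2 h (C n).enc1 (C n).enc2 (C n).measurable_dec1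
      (C n).measurable_dec2 (C n).power1 (C n).power2
    rw [← Code.err1_eq, ← Code.err2_eq, Fintype.card_fin, Fintype.card_fin] at hb
    have l1 := mul_le_mul_of_nonneg_left (le_log_numMessages n R.1)
      (sub_nonneg.2 (C n).err1_le_one)
    have l2 := mul_le_mul_of_nonneg_left (le_log_numMessages n R.2)
      (sub_nonneg.2 (C n).err2_le_one)
    have hn' : (0 : ℝ) < n := by exact_mod_cast hn
    have hle : (2 * ((1 - (C n).err1) * (R.1 * Real.log 2))
      + 2 * ((1 - (C n).err2) * (R.2 * Real.log 2))) * n - 4 * Real.log 2 ≤ n * B := by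
      refine le_trans ?_ hb
      nlinarith
    have := mul_le_mul_of_nonneg_right hle (inv_pos.2 hn').le
    rw [sub_mul, mul_assoc, mul_inv_cancel₀ hn'.ne', mul_one, mul_comm (n : ℝ) B, mul_assoc B,
      mul_inv_cancel₀ hn'.ne', mul_one] at this
    exact this
  have hlim : Tendsto (fun n : ℕ => 2 * ((1 - (C n).err1) * (R.1 * Real.log 2))
      + 2 * ((1 - (C n).err2) * (R.2 * Real.log 2)) - 4 * Real.log 2 * (n : ℝ)⁻¹) atTop
      (𝓝 (2 * ((1 - 0) * (R.1 * Real.log 2)) + 2 * ((1 - 0) * (R.2 * Real.log 2))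
        - 4 * Real.log 2 * 0)) :=
    ((((h1.const_sub 1).mul_const _).const_mul 2).add
      (((h2.const_sub 1).mul_const _).const_mul 2)).sub
      (tendsto_inv_atTop_nhds_zero_nat.const_mul _)
  have := le_of_tendsto hlim (eventually_atTop.2 ⟨1, fun n hn => key n hn⟩)
  linarith

/-- The limiting case in which the genie gives the interference to receiver 2. -/
theorem achievable_le_of_noiseless {c : Channel} (hP1 : 0 < c.P1) (hP2 : 0 < c.P2) {σ : ℝ}
    (hσ : 0 < σ) (hσ1 : σ ^ 2 ≤ 1) (hσh : σ ≤ ‖c.h21‖) (h12 : ‖c.h12‖ ^ 2 ≤ 1) {R : ℝ × ℝ}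
    (hR : c.Achievable R) :
    2 * (R.1 + R.2) * Real.log 2 ≤ natBound c σ 1 0 0 := by
  have hA : 0 < c.crossPower := by
    have : 0 < ‖c.h21‖ := hσ.trans_le hσh
    unfold Channel.crossPower; positivity
  -- The genie signal `h₂₁X₁` has no density bound of the required kind, so it is blurred by part of
  -- the receiver noise: `V` of variance `ε`, `D` of variance `1 - ε`, `γ = 0`.
  have key : ∀ᶠ ε in 𝓝[>] (0 : ℝ),
      2 * (R.1 + R.2) * Real.log 2 ≤ natBound c σ (1 - ε) ε 0 := by
    filter_upwards [Ioo_mem_nhdsGT (zero_lt_one' ℝ)] with ε hε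
    refine achievable_le hP1 hP2 ⟨hσ, hσ1, hσh, by linarith [hε.2], hε.1, by simp, ?_, ?_, ?_⟩ hR
    · nlinarith [hε.1, sq_nonneg ‖c.h12‖]
    · simpa using hε.2.le
    · simp
  have hlim : Tendsto (fun ε => natBound c σ (1 - ε) ε 0) (𝓝[>] (0 : ℝ))
      (𝓝 (natBound c σ 1 0 0)) := by
    -- Positivity of the cross power keeps the logarithms continuous at `ε = 0`.
    have hc : ContinuousAt (fun ε : ℝ => natBound c σ (1 - ε) ε 0) 0 := by
      simp only [natBound, genieVar, genieVarY]
      have hne : ∀ x : ℝ, 0 < x → x ≠ 0 := fun x hx => hx.ne'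
      refine ContinuousAt.add (ContinuousAt.sub (ContinuousAt.add (ContinuousAt.add
        (ContinuousAt.sub (ContinuousAt.add (ContinuousAt.sub ?_ ?_) ?_) ?_) ?_) ?_) ?_) ?_
      · exact continuousAt_const
      · exact ContinuousAt.log (by fun_prop) (by simp; exact hA.ne')
      · exact ContinuousAt.log (by fun_prop) (by simp; exact hA.ne')
      · exact continuousAt_const
      · exact continuousAt_const
      · exact continuousAt_const
      · exact continuousAt_const
      · have h3 : 0 < ‖c.h12‖ ^ 2 * (c.P2 + 1) + 1 - ‖c.h12‖ ^ 2 := by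
          nlinarith [mul_nonneg (sq_nonneg ‖c.h12‖) hP2.le]
        simp only [norm_zero, ne_eq, OfNat.ofNat_ne_zero, not_false_eq_true, zero_pow, zero_mul,
          zero_div, mul_zero, sub_zero]
        refine ContinuousAt.log (ContinuousAt.div (by fun_prop) (by fun_prop) ?_) ?_
        · simpa using h3.ne'
        · simp only [sub_zero, one_mul, mul_one]
          exact (div_pos (by linarith) h3).ne'
    have := hc.tendsto
    simp only [sub_zero] at this
    exact this.mono_left nhdsWithin_le_nhds
  exact ge_of_tendsto hlim key

lemma capacityRegion_le {c : Channel} {B : ℝ} (h : ∀ R, c.Achievable R → R.1 + R.2 ≤ B) :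
    ∀ R ∈ c.capacityRegion, R.1 + R.2 ≤ B := fun _ hR =>
  closure_minimal (s := {R | c.Achievable R}) (t := {R : ℝ × ℝ | R.1 + R.2 ≤ B})
    (fun R hR => h R hR) (isClosed_le (by fun_prop) continuous_const) hR

/-- Interchanging the users of a code. -/
def Code.swap {c : Channel} {n M1 M2 : ℕ} (C : Code c n M1 M2) : Code c.swap n M2 M1 where
  enc1 := C.enc2
  enc2 := C.enc1
  dec1 := C.dec2
  dec2 := C.dec1
  power1 := C.power2
  power2 := C.power1
  measurable_dec1 := C.measurable_dec2
  measurable_dec2 := C.measurable_dec1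

lemma Channel.Achievable.swap {c : Channel} {R : ℝ × ℝ} (h : c.Achievable R) :
    c.swap.Achievable R.swap := by
  obtain ⟨h1, h2, C, hC1, hC2⟩ := h
  refine ⟨h2, h1, fun n => (C n).swap, ?_, ?_⟩
  · have : ∀ n, (C n).swap.err1 = (C n).err2 := fun n => by
      rw [Code.err1_eq, Code.err2_eq]; rfl
    simpa only [this] using hC2
  · have : ∀ n, (C n).swap.err2 = (C n).err1 := fun n => by
      rw [Code.err1_eq, Code.err2_eq]; rfl
    simpa only [this] using hC1

/-! ### Linear forms in independent standard complex Gaussian variables -/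

section LinearForms

variable {n : ℕ}

/-- The linear form `∑ aᵢ zᵢ`, as a real linear map. -/
def lin (a : Fin n → ℂ) : (Fin n → ℂ) →L[ℝ] ℂ :=
  ∑ i, (mulL (a i)).comp (.proj (R := ℝ) (φ := fun _ : Fin n => ℂ) i)

lemma lin_apply (a z : Fin n → ℂ) : lin a z = ∑ i, a i * z i := by
  simp [lin]

lemma lin_sub (a b : Fin n → ℂ) (z : Fin n → ℂ) : lin (a - b) z = lin a z - lin b z := by
  simp [lin_apply, sub_mul]

lemma lin_smul (k : ℂ) (b : Fin n → ℂ) (z : Fin n → ℂ) : lin (k • b) z = k * lin b z := by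
  simp [lin_apply, Finset.mul_sum, mul_assoc]

/-- The covariance of two linear forms. -/
def ip (a b : Fin n → ℂ) : ℂ := ∑ i, a i * conj (b i)

lemma ip_self (a : Fin n → ℂ) : ip a a = (nsq a : ℂ) := by
  simp only [ip, nsq, Complex.mul_conj, Complex.normSq_eq_norm_sq]
  push_cast; rfl

lemma ip_conj (a b : Fin n → ℂ) : conj (ip a b) = ip b a := by
  simp [ip, map_sum, mul_comm]

lemma dualVec_comp_lin_single (L : StrongDual ℝ ℂ) (a : Fin n → ℂ) (i : Fin n) :
    dualVec ((L.comp (lin a)).comp (.single ℝ (fun _ => ℂ) i)) = conj (a i) * dualVec L := by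
  rw [← dualVec_comp_mulL]
  congr 1
  refine ContinuousLinearMap.ext fun z => ?_
  simp only [ContinuousLinearMap.comp_apply, lin_apply, mulL_apply]
  congr 1
  rw [Finset.sum_eq_single i] <;> simp +contextual

lemma charFunDual_map_lin (L : StrongDual ℝ ℂ) (a : Fin n → ℂ) :
    charFunDual ((noise n).map (lin a)) L
      = Complex.exp (-(nsq a * ‖dualVec L‖ ^ 2 / 4 : ℝ)) := by
  rw [charFunDual_map, noise, charFunDual_pi_stdCN]
  simp_rw [dualVec_comp_lin_single, norm_mul, mul_pow, RCLike.norm_conj, ← Finset.sum_mul]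
  rfl

/-- A circularly symmetric Gaussian is determined by its variance. This reduces any linear form to a
scaled single coordinate. -/
lemma map_lin_congr {m : ℕ} {a : Fin n → ℂ} {b : Fin m → ℂ} (h : nsq a = nsq b) :
    (noise n).map (lin a) = (noise m).map (lin b) := by
  have := Measure.isProbabilityMeasure_map (μ := noise n) (lin a).measurable.aemeasurable
  have := Measure.isProbabilityMeasure_map (μ := noise m) (lin b).measurable.aemeasurable
  refine Measure.ext_of_charFunDual ?_
  ext L
  rw [charFunDual_map_lin, charFunDual_map_lin, h]

lemma nsq_comb {a b : Fin n → ℂ} (h : ip a b = 0) (s t : ℂ) :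
    ∑ i, ‖conj (a i) * s + conj (b i) * t‖ ^ 2 = nsq a * ‖s‖ ^ 2 + nsq b * ‖t‖ ^ 2 := by
  apply Complex.ofReal_injective
  have h' : ip b a = 0 := by rw [← ip_conj, h, map_zero]
  have e : ∀ i, ((‖conj (a i) * s + conj (b i) * t‖ ^ 2 : ℝ) : ℂ)
      = (a i * conj (a i)) * (s * conj s) + (b i * conj (b i)) * (t * conj t)
        + (b i * conj (a i)) * (s * conj t) + (a i * conj (b i)) * (t * conj s) := by
    intro i
    rw [Complex.ofReal_pow, ← Complex.mul_conj']
    simp only [map_add, map_mul, Complex.conj_conj]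
    ring
  have hs := Complex.mul_conj' s
  have ht := Complex.mul_conj' t
  rw [Complex.ofReal_sum, Finset.sum_congr rfl fun i _ => e i]
  simp only [Finset.sum_add_distrib, ← Finset.sum_mul]
  change ip a a * _ + ip b b * _ + ip b a * _ + ip a b * _ = _
  rw [h, h', ip_self, ip_self, hs, ht]
  push_cast; ring

/-- Uncorrelated jointly Gaussian forms are independent: orthogonality removes the cross terms, and
the characteristic function factorises. -/
lemma map_lin_prod {a b : Fin n → ℂ} (h : ip a b = 0) :
    (noise n).map (fun z => (lin a z, lin b z))
      = ((noise n).map (lin a)).prod ((noise n).map (lin b)) := by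
  have := Measure.isProbabilityMeasure_map (μ := noise n) (lin a).measurable.aemeasurable
  have := Measure.isProbabilityMeasure_map (μ := noise n) (lin b).measurable.aemeasurable
  have e : (fun z => (lin a z, lin b z)) = ⇑((lin a).prod (lin b)) := rfl
  rw [e]
  have := Measure.isProbabilityMeasure_map (μ := noise n)
    ((lin a).prod (lin b)).measurable.aemeasurable
  refine Measure.ext_of_charFunDual ?_
  ext L
  rw [charFunDual_prod, charFunDual_map_lin, charFunDual_map_lin, charFunDual_map, noise,
    charFunDual_pi_stdCN, ← Complex.exp_add]
  set L1 : StrongDual ℝ ℂ := L.comp (.inl ℝ ℂ ℂ)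
  set L2 : StrongDual ℝ ℂ := L.comp (.inr ℝ ℂ ℂ)
  have e : L.comp ((lin a).prod (lin b)) = L1.comp (lin a) + L2.comp (lin b) := by
    refine ContinuousLinearMap.ext fun z => ?_
    simp only [L1, L2, ContinuousLinearMap.comp_apply, add_apply, ← map_add]
    simp
  simp_rw [e, ContinuousLinearMap.add_comp, dualVec_add, dualVec_comp_lin_single]
  rw [nsq_comb h]
  congr 1
  push_cast; ring

lemma hasDens_lin {a : Fin n → ℂ} (ha : 0 < nsq a) :
    HasDens (noise n) (lin a) (fun y => gd (nsq a) (fun _ : Fin 1 => y)) where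
  meas_map := (lin a).measurable
  meas := by fun_prop
  pos y := gd_pos _ _
  map_eq := by
    have h1 : nsq a = nsq (fun _ : Fin 1 => ((√(nsq a) : ℝ) : ℂ)) := by
      simp [nsq, abs_of_nonneg, Real.sqrt_nonneg]
      rw [Real.sq_sqrt]; exact ha.le
    have h2 : (⇑(lin fun _ : Fin 1 => ((√(nsq a) : ℝ) : ℂ)) : (Fin 1 → ℂ) → ℂ)
        = MeasurableEquiv.funUnique (Fin 1) ℂ ∘ fun z => (0 : Fin 1 → ℂ) + ((√(nsq a) : ℝ) : ℂ) • z := by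
      ext z; simp [lin_apply, MeasurableEquiv.funUnique]
    rw [map_lin_congr h1, h2, ← Measure.map_map (MeasurableEquiv.measurable _) (by fun_prop),
      noise_map_affine ha]
    refine Measure.ext_of_lintegral _ fun φ hφ => ?_
    have h3 : Measurable fun y : Fin 1 → ℂ => φ (MeasurableEquiv.funUnique (Fin 1) ℂ y) :=
      hφ.comp (MeasurableEquiv.measurable _)
    rw [lintegral_map hφ (MeasurableEquiv.measurable _),
      lintegral_withDensity_eq_lintegral_mul _ (by fun_prop) h3,
      lintegral_withDensity_eq_lintegral_mul _ (by fun_prop) hφ,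
      ← (volume_preserving_funUnique (Fin 1) ℂ).lintegral_comp_emb
        (MeasurableEquiv.measurableEmbedding _)]
    refine lintegral_congr fun y => ?_
    have : (fun _ => y 0) = y := by ext i; rw [Subsingleton.elim i 0]
    simp [MeasurableEquiv.funUnique, this]

lemma integral_lin (a : Fin n → ℂ) : ∫ z, lin a z ∂noise n = 0 := by
  simp only [lin_apply]
  rw [integral_finsetSum _ fun i _ => (integrable_eval_noise i).const_mul _]
  simp [integral_const_mul, integral_eval_noise]

lemma integrable_norm_sq_lin (a : Fin n → ℂ) :
    Integrable (fun z => ‖lin a z‖ ^ 2) (noise n) := by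
  refine ((integrable_norm_sq_noise n).const_mul (‖lin a‖ ^ 2)).mono' (by fun_prop)
    (Eventually.of_forall fun z => ?_)
  rw [Real.norm_of_nonneg (by positivity), ← mul_pow]
  gcongr
  exact (lin a).le_opNorm z

lemma integral_norm_sq_lin (a : Fin n → ℂ) : ∫ z, ‖lin a z‖ ^ 2 ∂noise n = nsq a := by
  have h1 : nsq a = nsq (fun _ : Fin 1 => ((√(nsq a) : ℝ) : ℂ)) := by
    simp [nsq, abs_of_nonneg, Real.sqrt_nonneg]
    rw [Real.sq_sqrt]; exact nsq_nonneg a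
  rw [← integral_map (f := fun y => ‖y‖ ^ 2) (lin a).measurable.aemeasurable (by fun_prop),
    map_lin_congr h1, integral_map (lin _).measurable.aemeasurable (by fun_prop)]
  have h2 := integral_nsq_affine (n := 1) 0 ((√(nsq a) : ℝ) : ℂ)
  have h3 : nsq (0 : Fin 1 → ℂ) = 0 := by simp [nsq]
  rw [h3] at h2
  simp only [lin_apply]
  simp only [nsq, zero_add, Pi.smul_apply, smul_eq_mul, Finset.univ_unique, Finset.sum_singleton] at h2 ⊢
  rw [h2]
  simp [abs_of_nonneg, Real.sqrt_nonneg]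
  rw [Real.sq_sqrt (Finset.sum_nonneg fun _ _ => by positivity)]

lemma var_lin (a : Fin n → ℂ) : var (noise n) (lin a) = nsq a := by
  simp [var, integral_lin, integral_norm_sq_lin]

lemma nsq_add_smul (a b : Fin n → ℂ) (k : ℂ) :
    nsq (a + k • b) = nsq a + ‖k‖ ^ 2 * nsq b + 2 * (conj k * ip a b).re := by
  rw [nsq_add, nsq_smul]
  congr 2
  rw [ip, Finset.mul_sum, Complex.re_sum]
  refine Finset.sum_congr rfl fun i _ => ?_
  rw [← Complex.conj_re]
  simp [mul_comm, mul_left_comm]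

lemma cov_lin (a b : Fin n → ℂ) : cov (noise n) (lin a) (lin b) = ip a b := by
  simp only [cov, integral_lin, sub_zero]
  simp only [lin_apply, map_sum, map_mul, Finset.sum_mul_sum]
  have hi : ∀ i j : Fin n, Integrable (fun z => z i * conj (z j)) (noise n) := fun i j => by
    refine ((integrable_norm_sq_noise n).mono' (by fun_prop)
      (Eventually.of_forall fun z => ?_))
    rw [norm_mul, RCLike.norm_conj, sq]
    gcongr <;> exact norm_le_pi_norm z _
  have hv : ∀ i j : Fin n, ∫ z, z i * conj (z j) ∂noise n = if i = j then 1 else 0 := fun i j => by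
    split_ifs with h
    · subst h
      simp_rw [Complex.mul_conj, Complex.normSq_eq_norm_sq]
      rw [integral_complex_ofReal, noise, integral_comp_eval (μ := fun _ : Fin n => stdCN)
        (f := fun z : ℂ => ‖z‖ ^ 2) (by fun_prop), integral_norm_sq_stdCN]
      simp
    · have hind := iIndepFun_pi (μ := fun _ : Fin n => stdCN) (X := fun _ z => z)
        (fun i => aemeasurable_id)
      have h2 := (hind.indepFun h).comp (measurable_id (α := ℂ)) (Complex.continuous_conj.measurable)
      have h3 := h2.integral_fun_mul_eq_mul_integral
        (measurable_id.comp (measurable_pi_apply i)).aestronglyMeasurable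
        (Complex.continuous_conj.measurable.comp (measurable_pi_apply j)).aestronglyMeasurable
      simp only [Function.comp, id] at h3
      have h4 := integral_eval_noise i
      simp only [noise] at h4 ⊢
      rw [h3, h4, zero_mul]
  have e : ∀ (z : Fin n → ℂ) (i j : Fin n), a i * z i * (conj (b j) * conj (z j))
      = (a i * conj (b j)) * (z i * conj (z j)) := fun z i j => by ring
  simp_rw [e]
  rw [integral_finsetSum _ fun i _ => integrable_finsetSum _ fun j _ => (hi i j).const_mul _]
  simp_rw [integral_finsetSum _ fun j _ => (hi _ j).const_mul _, integral_const_mul, hv]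
  simp [ip]

end LinearForms

/-! ### Differential entropy of jointly Gaussian variables -/

/-- The Radon–Nikodym derivative agrees with the density Lebesgue almost everywhere, hence almost
everywhere for the law. -/
lemma diffEntropy_of_hasDens {Ω E : Type*} [MeasurableSpace Ω] [MeasureSpace E]
    [SigmaFinite (volume : Measure E)] {μ : Measure Ω} {X : Ω → E} {p : E → ℝ}
    (h : HasDens μ X p) : diffEntropy μ X = -∫ ω, Real.logb 2 (p (X ω)) ∂μ := by
  have hm : Measurable fun y => ENNReal.ofReal (p y) := h.meas.ennreal_ofReal
  have hac : μ.map X ≪ volume := by rw [h.map_eq]; exact withDensity_absolutelyContinuous _ _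
  rw [diffEntropy, ← integral_map (f := fun x => Real.logb 2 (p x)) h.meas_map.aemeasurable
    ((Real.measurable_log.comp h.meas).div_const _).aestronglyMeasurable]
  congr 1
  refine integral_congr_ae ?_
  refine hac.ae_le ?_
  rw [h.map_eq]
  filter_upwards [Measure.rnDeriv_withDensity volume hm] with y hy
  rw [hy, ENNReal.toReal_ofReal (h.pos y).le]

lemma HasDens.swap {Ω V W : Type*} [MeasurableSpace Ω] [MeasureSpace V]
    [MeasureSpace W] [SFinite (volume : Measure V)] [SFinite (volume : Measure W)] {μ : Measure Ω}
    {T : Ω → V × W} {f : V × W → ℝ} (h : HasDens μ T f) :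
    HasDens μ (fun ω => (T ω).swap) (fun y => f y.swap) where
  meas_map := measurable_swap.comp h.meas_map
  meas := h.meas.comp measurable_swap
  pos y := h.pos _
  map_eq := by
    have hm := h.meas.ennreal_ofReal
    have e : (fun ω => (T ω).swap) = Prod.swap ∘ T := rfl
    rw [e, ← Measure.map_map measurable_swap h.meas_map, h.map_eq]
    refine Measure.ext_of_lintegral _ fun φ hφ => ?_
    rw [lintegral_map hφ measurable_swap, lintegral_withDensity_eq_lintegral_mul _ hm
      (show Measurable fun y : V × W => φ y.swap from hφ.comp measurable_swap),
      lintegral_withDensity_eq_lintegral_mul _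
      (show Measurable fun y : W × V => ENNReal.ofReal (f y.swap) from hm.comp measurable_swap) hφ, Measure.volume_eq_prod, Measure.volume_eq_prod,
      ← lintegral_prod_swap]
    rfl

section Entropy

variable {n : ℕ}

lemma integral_logb_gd_lin {a : Fin n → ℂ} (ha : 0 < nsq a) :
    Integrable (fun z => Real.logb 2 (gd (nsq a) (fun _ : Fin 1 => lin a z))) (noise n) ∧
    ∫ z, Real.logb 2 (gd (nsq a) (fun _ : Fin 1 => lin a z)) ∂noise n
      = -Real.logb 2 (Real.pi * Real.exp 1 * nsq a) := by
  have e : ∀ z, Real.logb 2 (gd (nsq a) (fun _ : Fin 1 => lin a z))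
      = (-Real.log (Real.pi * nsq a) - ‖lin a z‖ ^ 2 / nsq a) / Real.log 2 := by
    intro z
    rw [Real.logb, log_gd]
    simp [nsq]
  simp_rw [e]
  have hi : Integrable (fun z => ‖lin a z‖ ^ 2 / nsq a) (noise n) :=
    (integrable_norm_sq_lin a).div_const _
  refine ⟨((integrable_const _).sub hi).div_const _, ?_⟩
  rw [integral_div, integral_sub (integrable_const _) hi, integral_div, integral_norm_sq_lin,
    div_self ha.ne', Real.logb, mul_right_comm,
    Real.log_mul (x := Real.pi * nsq a) (by positivity) (Real.exp_pos 1).ne',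
    Real.log_exp, integral_const, probReal_univ, one_smul]
  ring

lemma diffEntropy_lin {a : Fin n → ℂ} (ha : 0 < nsq a) :
    diffEntropy (noise n) (lin a) = Real.logb 2 (Real.pi * Real.exp 1 * nsq a) := by
  rw [diffEntropy_of_hasDens (hasDens_lin ha), (integral_logb_gd_lin ha).2, neg_neg]

/-- Split `a = k b + e` with `e` orthogonal to `b`. Then `e` is independent of `b`, the joint
density is a shear of a product, and the conditional entropy is that of the residual `e`. -/
lemma condDiffEntropy_lin {a b : Fin n → ℂ} (hb : 0 < nsq b)
    (hab : 0 < nsq a - ‖ip a b‖ ^ 2 / nsq b) :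
    condDiffEntropy (noise n) (lin a) (lin b)
      = Real.logb 2 (Real.pi * Real.exp 1 * (nsq a - ‖ip a b‖ ^ 2 / nsq b)) := by
  set k : ℂ := ip a b / nsq b with hk
  set e := a - k • b with he
  have hb' : (nsq b : ℂ) ≠ 0 := by exact_mod_cast hb.ne'
  have heb : ip b e = 0 := by
    rw [← ip_conj]
    have : ip e b = ip a b - k * ip b b := by
      simp [ip, he, sub_mul, Finset.mul_sum, mul_assoc]
    rw [this, ip_self, hk, div_mul_cancel₀ _ hb', sub_self, map_zero]
  have hve : nsq e = nsq a - ‖ip a b‖ ^ 2 / nsq b := by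
    have h1 := nsq_add_smul a b (-k)
    rw [neg_smul, ← sub_eq_add_neg, ← he] at h1
    rw [h1, norm_neg, hk, norm_div, map_neg, map_div₀, Complex.conj_ofReal, neg_mul, div_mul_eq_mul_div,
      Complex.conj_mul', ← Complex.ofReal_pow, ← Complex.ofReal_div, Complex.neg_re, Complex.ofReal_re]
    simp only [Complex.norm_real, Real.norm_of_nonneg hb.le]
    field_simp; ring
  rw [← hve] at hab ⊢
  have hb1 := hasDens_lin hb
  have he1 := hasDens_lin hab
  have hbe : HasDens (noise n) (fun z => (lin b z, lin e z))
      (fun y => gd (nsq b) (fun _ : Fin 1 => y.1) * gd (nsq e) (fun _ : Fin 1 => y.2)) := by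
    refine ⟨by fun_prop, by fun_prop, fun y => mul_pos (gd_pos _ _) (gd_pos _ _), ?_⟩
    rw [map_lin_prod heb, ← (hb1.prod he1).map_eq, Measure.map_prod_map _ _ hb1.meas_map he1.meas_map]
    rfl
  have hj := (hbe.shear (g := fun y => k * y) (by fun_prop)).swap
  have hT : (fun z => ((lin b z, lin e z).1, (lin b z, lin e z).2 + k * (lin b z, lin e z).1).swap)
      = fun z => (lin a z, lin b z) := by
    ext z <;> simp [he, lin_sub, lin_smul]
  rw [hT] at hj
  have h1 := integral_logb_gd_lin hb
  have h2 := integral_logb_gd_lin hab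
  rw [condDiffEntropy, diffEntropy_of_hasDens hj, diffEntropy_lin hb]
  have e2 : ∀ z, Real.logb 2 ((fun y : ℂ × ℂ => gd (nsq b) (fun _ : Fin 1 => y.1) *
        gd (nsq e) (fun _ : Fin 1 => y.2 - k * y.1)) ((lin a z, lin b z) : ℂ × ℂ).swap)
      = Real.logb 2 (gd (nsq b) (fun _ : Fin 1 => lin b z))
        + Real.logb 2 (gd (nsq e) (fun _ : Fin 1 => lin e z)) := by
    intro z
    simp only [Prod.swap, he, lin_sub, lin_smul]
    exact Real.logb_mul (gd_pos _ _).ne' (gd_pos _ _).ne'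
  rw [integral_congr_ae (Eventually.of_forall e2), integral_add h1.1 h2.1, h1.2, h2.2]
  ring

end Entropy

/-! ### The Gaussian test variables as linear forms -/

lemma prob_eq : prob = noise 8 := rfl

lemma nsq_vec8 (a₀ a₁ a₂ a₃ a₄ a₅ a₆ a₇ : ℂ) : nsq ![a₀, a₁, a₂, a₃, a₄, a₅, a₆, a₇]
    = ‖a₀‖ ^ 2 + ‖a₁‖ ^ 2 + ‖a₂‖ ^ 2 + ‖a₃‖ ^ 2 + ‖a₄‖ ^ 2 + ‖a₅‖ ^ 2 + ‖a₆‖ ^ 2 + ‖a₇‖ ^ 2 := by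
  simp [nsq, Fin.sum_univ_eight]

lemma ip_vec8 (a₀ a₁ a₂ a₃ a₄ a₅ a₆ a₇ b₀ b₁ b₂ b₃ b₄ b₅ b₆ b₇ : ℂ) :
    ip ![a₀, a₁, a₂, a₃, a₄, a₅, a₆, a₇] ![b₀, b₁, b₂, b₃, b₄, b₅, b₆, b₇]
      = a₀ * conj b₀ + a₁ * conj b₁ + a₂ * conj b₂ + a₃ * conj b₃ + a₄ * conj b₄ + a₅ * conj b₅
        + a₆ * conj b₆ + a₇ * conj b₇ := by
  simp [ip, Fin.sum_univ_eight]

section TestVariables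

variable (c : Channel) (κ : Params)

lemma X2G_eq : X2G c = lin ![0, (√c.P2 : ℝ), 0, 0, 0, 0, 0, 0] := by
  ext ω; simp [X2G, lin_apply, Fin.sum_univ_eight]

lemma Z1_eq : Z1 = lin ![0, 0, 1, 0, 0, 0, 0, 0] := by
  ext ω; simp [Z1, lin_apply, Fin.sum_univ_eight]

lemma Y1G_eq : Y1G c = lin ![(√c.P1 : ℝ), c.h12 * (√c.P2 : ℝ), 1, 0, 0, 0, 0, 0] := by
  ext ω; simp [Y1G, X1G, X2G, Z1, lin_apply, Fin.sum_univ_eight]; ring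

lemma Y2G_eq : Y2G c = lin ![c.h21 * (√c.P1 : ℝ), (√c.P2 : ℝ), 0, 0, 1, 0, 0, 0] := by
  ext ω; simp [Y2G, X1G, X2G, Z2, lin_apply, Fin.sum_univ_eight]; ring

lemma N1_eq : N1 κ = lin ![0, 0, κ.σN1 * conj κ.ρN1, κ.σN1 * (√(1 - ‖κ.ρN1‖ ^ 2) : ℝ),
    0, 0, 0, 0] := by
  ext ω; simp [N1, Z1, lin_apply, Fin.sum_univ_eight]; ring

lemma S1G_eq : S1G c κ = lin ![c.h21 * (√c.P1 : ℝ), 0, κ.σN1 * conj κ.ρN1,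
    κ.σN1 * (√(1 - ‖κ.ρN1‖ ^ 2) : ℝ), 0, 0, 0, 0] := by
  ext ω; simp [S1G, X1G, N1, Z1, lin_apply, Fin.sum_univ_eight]; ring

lemma W2_eq : W2 κ = lin ![0, 0, 0, 0, κ.σW2 * conj κ.ρW2,
    κ.σW2 * (√(1 - ‖κ.ρW2‖ ^ 2) : ℝ), 0, 0] := by
  ext ω; simp [W2, Z2, lin_apply, Fin.sum_univ_eight]; ring

lemma U2G_eq : U2G c κ = lin ![c.h21 * (√c.P1 : ℝ), 0, 0, 0, κ.σW2 * conj κ.ρW2,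
    κ.σW2 * (√(1 - ‖κ.ρW2‖ ^ 2) : ℝ), 0, 0] := by
  ext ω; simp [U2G, X1G, W2, Z2, lin_apply, Fin.sum_univ_eight]; ring

lemma Z2_sub_W2_eq : (fun ω => Z2 ω - W2 κ ω) = lin ![0, 0, 0, 0, 1 - κ.σW2 * conj κ.ρW2,
    -(κ.σW2 * (√(1 - ‖κ.ρW2‖ ^ 2) : ℝ)), 0, 0] := by
  ext ω; simp [W2, Z2, lin_apply, Fin.sum_univ_eight]; ring

lemma Z1_sub_N1_eq : (fun ω => Z1 ω - c.h21⁻¹ * N1 κ ω) = lin ![0, 0,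
    1 - c.h21⁻¹ * κ.σN1 * conj κ.ρN1,
    -(c.h21⁻¹ * κ.σN1 * (√(1 - ‖κ.ρN1‖ ^ 2) : ℝ)), 0, 0, 0, 0] := by
  ext ω; simp [N1, Z1, lin_apply, Fin.sum_univ_eight]; ring

lemma X1G_add_VW2_eq : (fun ω => c.h21 * X1G c ω + VW2 κ ω)
    = lin ![c.h21 * (√c.P1 : ℝ), 0, 0, 0, 0, 0, 0, (√(varVW2 κ) : ℝ)] := by
  ext ω; simp [X1G, VW2, lin_apply, Fin.sum_univ_eight]; ring

lemma Y2G_add_Zt1_eq : (fun ω => c.h12 * Y2G c ω + Zt1 c κ ω)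
    = lin ![c.h12 * (c.h21 * (√c.P1 : ℝ)), c.h12 * (√c.P2 : ℝ),
      (√(1 - ‖c.h12‖ ^ 2 * varZ2W2 κ) : ℝ), 0, c.h12, 0, 0, 0] := by
  ext ω; simp [Y2G, X1G, X2G, Z1, Z2, Zt1, lin_apply, Fin.sum_univ_eight]; ring

variable {c κ}

lemma norm_sqrt_sq {x : ℝ} (hx : 0 ≤ x) : ‖((√x : ℝ) : ℂ)‖ ^ 2 = x := by
  simp [Real.sq_sqrt hx]

lemma sqrt_mul_sqrt {x : ℝ} (hx : 0 ≤ x) : ((√x : ℝ) : ℂ) * ((√x : ℝ) : ℂ) = x := by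
  rw [← Complex.ofReal_mul, Real.mul_self_sqrt hx]

lemma norm_one_sub_sq (w : ℂ) : ‖1 - w‖ ^ 2 = 1 - 2 * w.re + ‖w‖ ^ 2 := by
  rw [Complex.sq_norm, Complex.sq_norm, Complex.normSq_apply, Complex.normSq_apply]
  simp; ring

lemma one_sub_norm_sq_nonneg {ρ : ℂ} (h : ‖ρ‖ ≤ 1) : 0 ≤ 1 - ‖ρ‖ ^ 2 := by
  nlinarith [norm_nonneg ρ]

lemma varZ2W2_eq (h : ‖κ.ρW2‖ ≤ 1) :
    varZ2W2 κ = 1 + κ.σW2 ^ 2 - 2 * (κ.ρW2 * κ.σW2).re := by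
  have h1 : ((κ.σW2 : ℂ) * conj κ.ρW2).re = (κ.ρW2 * κ.σW2).re := by simp [mul_comm]
  rw [varZ2W2, Z2_sub_W2_eq, prob_eq, var_lin]
  rw [nsq_vec8]
  simp [-Complex.mul_re, norm_one_sub_sq, mul_pow, Real.sq_sqrt (one_sub_norm_sq_nonneg h)]
  simp at h1 ⊢
  linarith

lemma varVW2_eq (h : ‖κ.ρW2‖ ≤ 1) : varVW2 κ
    = κ.σW2 ^ 2 - ‖conj (κ.ρW2 * κ.σW2) - ((κ.σW2 ^ 2 : ℝ) : ℂ)‖ ^ 2 / varZ2W2 κ := by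
  have e := sqrt_mul_sqrt (one_sub_norm_sq_nonneg h)
  have e1 : ip ![0, 0, 0, 0, κ.σW2 * conj κ.ρW2, κ.σW2 * (√(1 - ‖κ.ρW2‖ ^ 2) : ℝ), 0, 0]
      ![0, 0, 0, 0, 1 - κ.σW2 * conj κ.ρW2, -(κ.σW2 * (√(1 - ‖κ.ρW2‖ ^ 2) : ℝ)), 0, 0]
      = conj (κ.ρW2 * κ.σW2) - ((κ.σW2 ^ 2 : ℝ) : ℂ) := by
    have e2 := Complex.conj_mul' κ.ρW2
    rw [ip_vec8]
    simp
    push_cast at e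
    linear_combination (-(κ.σW2 : ℂ) ^ 2) * e - (κ.σW2 : ℂ) ^ 2 * e2
  rw [varVW2, gaussCondVar]
  congr 1
  · rw [W2_eq, prob_eq, var_lin]
    rw [nsq_vec8]
    simp [mul_pow, Real.sq_sqrt (one_sub_norm_sq_nonneg h)]
    ring
  · congr 2
    rw [Z2_sub_W2_eq, W2_eq, prob_eq, cov_lin, e1]

lemma nsq_N1 (h : ‖κ.ρN1‖ ≤ 1) : nsq ![0, 0, κ.σN1 * conj κ.ρN1,
    κ.σN1 * ((√(1 - ‖κ.ρN1‖ ^ 2) : ℝ) : ℂ), 0, 0, 0, 0] = κ.σN1 ^ 2 := by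
  rw [nsq_vec8]
  simp [mul_pow, Real.sq_sqrt (one_sub_norm_sq_nonneg h)]
  ring

lemma varVN1_eq (h : ‖κ.ρN1‖ ≤ 1) (hσ : 0 < κ.σN1) : varVN1 κ = 1 - ‖κ.ρN1‖ ^ 2 := by
  rw [varVN1, gaussCondVar, Z1_eq, N1_eq, prob_eq, var_lin, var_lin, cov_lin, nsq_N1 h]
  rw [nsq_vec8, ip_vec8]
  simp [mul_pow]
  field_simp

/-- Pythagoras: the least estimation error plus the squared distance of the coefficient used from
the optimal one, both relative to `N₁` normalised. -/
lemma varZ1N1_eq (h : ‖κ.ρN1‖ ≤ 1) :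
    varZ1N1 c κ = 1 - ‖κ.ρN1‖ ^ 2 + ‖κ.ρN1 - c.h21⁻¹ * κ.σN1‖ ^ 2 := by
  rw [varZ1N1, Z1_sub_N1_eq, prob_eq, var_lin]
  rw [nsq_vec8]
  have e : ((c.h21⁻¹ * κ.σN1) * conj κ.ρN1).re = (κ.ρN1 * conj (c.h21⁻¹ * κ.σN1)).re := by
    rw [← Complex.conj_re]; simp [mul_comm]
  have h2 := Complex.normSq_sub κ.ρN1 (c.h21⁻¹ * κ.σN1)
  simp only [Complex.normSq_eq_norm_sq] at h2
  rw [h2, ← e, norm_neg, norm_one_sub_sq]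
  simp only [norm_mul, mul_pow, norm_sqrt_sq (one_sub_norm_sq_nonneg h), RCLike.norm_conj]
  simp only [norm_zero, ne_eq, OfNat.ofNat_ne_zero, not_false_eq_true, zero_pow]
  ring

/-- The condition on `N₁` forces the correlation of `Z₁` and `N₁`. -/
lemma rho_eq (h : ‖κ.ρN1‖ ≤ 1) (hσ : 0 < κ.σN1) (hle : varZ1N1 c κ ≤ varVN1 κ) :
    κ.ρN1 = c.h21⁻¹ * κ.σN1 := by
  rw [varZ1N1_eq h, varVN1_eq h hσ] at hle
  have : ‖κ.ρN1 - c.h21⁻¹ * κ.σN1‖ ^ 2 = 0 := le_antisymm (by linarith) (by positivity)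
  exact sub_eq_zero.1 (by simpa using this)

lemma VtN1_eq_zero (h : varZ1N1 c κ = varVN1 κ) (ω : Smp) : VtN1 c κ ω = 0 := by
  rw [VtN1, VN1, h]
  rcases eq_or_ne (varVN1 κ) 0 with h0 | h0
  · simp [h0]
  · simp [inv_mul_cancel₀ h0]

/-! ### The differential entropies of the bound -/

lemma Channel.crossPower_pos (hP1 : 0 < c.P1) (h21 : c.h21 ≠ 0) : 0 < c.crossPower := by
  unfold Channel.crossPower; have := norm_pos_iff.2 h21; positivity

lemma diffEntropy_S1G (hP1 : 0 < c.P1) (h : ‖κ.ρN1‖ ≤ 1) (hσ : 0 < κ.σN1) :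
    diffEntropy prob (S1G c κ)
      = Real.logb 2 (Real.pi * Real.exp 1 * (‖c.h21‖ ^ 2 * c.P1 + κ.σN1 ^ 2)) := by
  have e : nsq ![c.h21 * (√c.P1 : ℝ), 0, κ.σN1 * conj κ.ρN1,
      κ.σN1 * ((√(1 - ‖κ.ρN1‖ ^ 2) : ℝ) : ℂ), 0, 0, 0, 0] = ‖c.h21‖ ^ 2 * c.P1 + κ.σN1 ^ 2 := by
    rw [nsq_vec8]
    simp only [norm_mul, mul_pow, norm_sqrt_sq hP1.le, norm_sqrt_sq (one_sub_norm_sq_nonneg h)]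
    simp
    ring
  rw [S1G_eq, prob_eq, diffEntropy_lin (by rw [e]; positivity), e]

lemma diffEntropy_N1 (h : ‖κ.ρN1‖ ≤ 1) (hσ : 0 < κ.σN1) :
    diffEntropy prob (N1 κ) = Real.logb 2 (Real.pi * Real.exp 1 * κ.σN1 ^ 2) := by
  rw [N1_eq, prob_eq, diffEntropy_lin (by rw [nsq_N1 h]; positivity), nsq_N1 h]

lemma diffEntropy_X1G_add_VW2 (hA : 0 < c.crossPower) (hP1 : 0 < c.P1) (hν : 0 ≤ varVW2 κ) :
    diffEntropy prob (fun ω => c.h21 * X1G c ω + VW2 κ ω)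
      = Real.logb 2 (Real.pi * Real.exp 1 * (‖c.h21‖ ^ 2 * c.P1 + varVW2 κ)) := by
  have e : nsq ![c.h21 * (√c.P1 : ℝ), 0, 0, 0, 0, 0, 0, ((√(varVW2 κ) : ℝ) : ℂ)]
      = ‖c.h21‖ ^ 2 * c.P1 + varVW2 κ := by
    rw [nsq_vec8]
    simp only [norm_mul, mul_pow, norm_sqrt_sq hP1.le, norm_sqrt_sq hν]
    simp
  unfold Channel.crossPower at hA
  rw [X1G_add_VW2_eq, prob_eq, diffEntropy_lin (by rw [e]; positivity), e]

lemma nsq_U2G (hP1 : 0 < c.P1) (h : ‖κ.ρW2‖ ≤ 1) :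
    nsq ![c.h21 * (√c.P1 : ℝ), 0, 0, 0, κ.σW2 * conj κ.ρW2,
      κ.σW2 * ((√(1 - ‖κ.ρW2‖ ^ 2) : ℝ) : ℂ), 0, 0] = ‖c.h21‖ ^ 2 * c.P1 + κ.σW2 ^ 2 := by
  rw [nsq_vec8]
  simp only [norm_mul, mul_pow, norm_sqrt_sq hP1.le, norm_sqrt_sq (one_sub_norm_sq_nonneg h)]
  simp
  ring

lemma diffEntropy_U2G (hA : 0 < c.crossPower) (hP1 : 0 < c.P1) (h : ‖κ.ρW2‖ ≤ 1) :
    diffEntropy prob (U2G c κ)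
      = Real.logb 2 (Real.pi * Real.exp 1 * (‖c.h21‖ ^ 2 * c.P1 + κ.σW2 ^ 2)) := by
  unfold Channel.crossPower at hA
  rw [U2G_eq, prob_eq, diffEntropy_lin (by rw [nsq_U2G hP1 h]; positivity), nsq_U2G hP1 h]

lemma diffEntropy_Z2_sub_W2 (hd : 0 < varZ2W2 κ) :
    diffEntropy prob (fun ω => Z2 ω - W2 κ ω)
      = Real.logb 2 (Real.pi * Real.exp 1 * varZ2W2 κ) := by
  rw [varZ2W2, Z2_sub_W2_eq, prob_eq, var_lin] at hd ⊢
  exact diffEntropy_lin hd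

lemma diffEntropy_Y1G (hP1 : 0 < c.P1) (hP2 : 0 < c.P2) : diffEntropy prob (Y1G c)
    = Real.logb 2 (Real.pi * Real.exp 1 * (c.P1 + ‖c.h12‖ ^ 2 * c.P2 + 1)) := by
  have e : nsq ![((√c.P1 : ℝ) : ℂ), c.h12 * (√c.P2 : ℝ), 1, 0, 0, 0, 0, 0]
      = c.P1 + ‖c.h12‖ ^ 2 * c.P2 + 1 := by
    rw [nsq_vec8]
    simp only [norm_mul, mul_pow, norm_sqrt_sq hP1.le, norm_sqrt_sq hP2.le]
    simp
  rw [Y1G_eq, prob_eq, diffEntropy_lin (by rw [e]; positivity), e]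

lemma nsq_Y2G (hP1 : 0 < c.P1) (hP2 : 0 < c.P2) :
    nsq ![c.h21 * (√c.P1 : ℝ), ((√c.P2 : ℝ) : ℂ), 0, 0, 1, 0, 0, 0]
      = c.P2 + ‖c.h21‖ ^ 2 * c.P1 + 1 := by
  rw [nsq_vec8]
  simp only [norm_mul, mul_pow, norm_sqrt_sq hP1.le, norm_sqrt_sq hP2.le]
  simp
  ring

lemma diffEntropy_Y2G (hP1 : 0 < c.P1) (hP2 : 0 < c.P2) : diffEntropy prob (Y2G c)
    = Real.logb 2 (Real.pi * Real.exp 1 * (c.P2 + ‖c.h21‖ ^ 2 * c.P1 + 1)) := by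
  rw [Y2G_eq, prob_eq, diffEntropy_lin (by rw [nsq_Y2G hP1 hP2]; positivity), nsq_Y2G hP1 hP2]

lemma condDiffEntropy_Y2G_X2G (hP1 : 0 < c.P1) (hP2 : 0 < c.P2) :
    condDiffEntropy prob (Y2G c) (X2G c)
      = Real.logb 2 (Real.pi * Real.exp 1 * (‖c.h21‖ ^ 2 * c.P1 + 1)) := by
  have e : nsq ![0, ((√c.P2 : ℝ) : ℂ), 0, 0, 0, 0, 0, 0] = c.P2 := by
    rw [nsq_vec8]
    simp [Real.sq_sqrt hP2.le]
  have e1 : nsq ![c.h21 * (√c.P1 : ℝ), ((√c.P2 : ℝ) : ℂ), 0, 0, 1, 0, 0, 0]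
      - ‖ip ![c.h21 * (√c.P1 : ℝ), ((√c.P2 : ℝ) : ℂ), 0, 0, 1, 0, 0, 0]
        ![0, ((√c.P2 : ℝ) : ℂ), 0, 0, 0, 0, 0, 0]‖ ^ 2 / nsq ![0, ((√c.P2 : ℝ) : ℂ), 0, 0, 0, 0, 0, 0]
      = ‖c.h21‖ ^ 2 * c.P1 + 1 := by
    rw [nsq_Y2G hP1 hP2, e, ip_vec8]
    simp [mul_pow, Real.sq_sqrt hP2.le]
    field_simp; ring
  rw [Y2G_eq, X2G_eq, prob_eq, condDiffEntropy_lin (by rw [e]; exact hP2)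
    (by rw [e1]; positivity), e1]

lemma logb_pi_mul_sub {x y : ℝ} (hx : 0 < x) (hy : 0 < y) :
    Real.logb 2 (Real.pi * Real.exp 1 * x) - Real.logb 2 (Real.pi * Real.exp 1 * y)
      = Real.logb 2 (x / y) := by
  rw [← Real.logb_div (by positivity) (by positivity), mul_div_mul_left _ _ (by positivity)]

theorem R0_eq (hP1 : 0 < c.P1) (hP2 : 0 < c.P2) (h21 : c.h21 ≠ 0) (hN : ‖κ.ρN1‖ ≤ 1)
    (hσ : 0 < κ.σN1) (hW : ‖κ.ρW2‖ ≤ 1) (hd : 0 < varZ2W2 κ) (hν : 0 ≤ varVW2 κ) :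
    R0 c κ = R0Explicit c κ := by
  have hA := Channel.crossPower_pos hP1 h21
  rw [R0, R0Explicit, diffEntropy_S1G hP1 hN hσ, diffEntropy_X1G_add_VW2 hA hP1 hν,
    diffEntropy_U2G hA hP1 hW, condDiffEntropy_Y2G_X2G hP1 hP2, diffEntropy_Y1G hP1 hP2,
    diffEntropy_N1 hN hσ, diffEntropy_Y2G hP1 hP2, diffEntropy_Z2_sub_W2 hd, ← varZ2W2_eq hW]
  unfold Channel.crossPower at hA
  rw [← logb_pi_mul_sub (by positivity) (by positivity),
    ← logb_pi_mul_sub (by positivity) (by positivity),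
    ← logb_pi_mul_sub (by positivity) (by positivity), ← logb_pi_mul_sub (by positivity) hd]
  ring

lemma ip_Y2G_U2G (hP1 : 0 < c.P1) :
    ip ![c.h21 * (√c.P1 : ℝ), ((√c.P2 : ℝ) : ℂ), 0, 0, 1, 0, 0, 0]
      ![c.h21 * (√c.P1 : ℝ), 0, 0, 0, κ.σW2 * conj κ.ρW2,
        κ.σW2 * ((√(1 - ‖κ.ρW2‖ ^ 2) : ℝ) : ℂ), 0, 0]
      = (‖c.h21‖ : ℂ) ^ 2 * c.P1 + κ.ρW2 * κ.σW2 := by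
  rw [ip_vec8]
  have e := sqrt_mul_sqrt hP1.le
  have e2 := Complex.mul_conj' c.h21
  simp
  linear_combination (c.h21 * conj c.h21) * e + c.P1 * e2

lemma ip_Y2G_add_Zt1_U2G (hP1 : 0 < c.P1) :
    ip ![c.h12 * (c.h21 * (√c.P1 : ℝ)), c.h12 * (√c.P2 : ℝ),
        ((√(1 - ‖c.h12‖ ^ 2 * varZ2W2 κ) : ℝ) : ℂ), 0, c.h12, 0, 0, 0]
      ![c.h21 * (√c.P1 : ℝ), 0, 0, 0, κ.σW2 * conj κ.ρW2,
        κ.σW2 * ((√(1 - ‖κ.ρW2‖ ^ 2) : ℝ) : ℂ), 0, 0]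
      = c.h12 * ((‖c.h21‖ : ℂ) ^ 2 * c.P1 + κ.ρW2 * κ.σW2) := by
  rw [← ip_Y2G_U2G (c := c) hP1 (κ := κ), ip_vec8, ip_vec8]
  simp
  ring

end TestVariables

/-! ### The closed form and its identification with the converse bound. -/

section HybridBound

variable {c : Channel} {κ : Params}

/-- Coefficient of the linear estimate of `W₂` given `Z₂ - W₂`. -/
def genieCoeff (κ : Params) : ℂ :=
  (conj (κ.ρW2 * κ.σW2) - ((κ.σW2 ^ 2 : ℝ) : ℂ)) / (varZ2W2 κ : ℂ)

lemma norm_sub_ofReal_sq (w : ℂ) (x : ℝ) : ‖w - x‖ ^ 2 = ‖w‖ ^ 2 - 2 * x * w.re + x ^ 2 := by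
  rw [Complex.sq_norm, Complex.sq_norm, Complex.normSq_apply, Complex.normSq_apply]
  simp; ring

lemma norm_genieCoeff_sq (hd : 0 < varZ2W2 κ) : ‖genieCoeff κ‖ ^ 2 * varZ2W2 κ
    = ‖conj (κ.ρW2 * κ.σW2) - ((κ.σW2 ^ 2 : ℝ) : ℂ)‖ ^ 2 / varZ2W2 κ := by
  rw [genieCoeff, norm_div, Complex.norm_real, Real.norm_of_nonneg hd.le]
  field_simp

/-- Variances in the orthogonal decomposition `W₂ = γD + V` with `D = Z₂ - W₂`. -/
lemma genieCoeff_var (h : ‖κ.ρW2‖ ≤ 1) (hd : 0 < varZ2W2 κ) :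
    ‖genieCoeff κ‖ ^ 2 * varZ2W2 κ + varVW2 κ = κ.σW2 ^ 2 := by
  rw [norm_genieCoeff_sq hd, varVW2_eq h]; ring

/-- Variances in `Z₂ = D + W₂ = (1 + γ)D + V`. -/
lemma norm_one_add_genieCoeff_sq (h : ‖κ.ρW2‖ ≤ 1) (hd : 0 < varZ2W2 κ) :
    ‖1 + genieCoeff κ‖ ^ 2 * varZ2W2 κ + varVW2 κ = 1 := by
  have hd' : (varZ2W2 κ : ℂ) ≠ 0 := by exact_mod_cast hd.ne'
  have hdeq := varZ2W2_eq h
  set r : ℂ := κ.ρW2 * κ.σW2 with hr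
  have e : 1 + genieCoeff κ = (1 - r) / (varZ2W2 κ : ℂ) := by
    rw [genieCoeff, ← hr, eq_div_iff hd', add_mul, div_mul_cancel₀ _ hd', hdeq]
    apply Complex.ext <;> simp
    ring
  rw [e, norm_div, Complex.norm_real, Real.norm_of_nonneg hd.le, div_pow, varVW2_eq h, ← hr,
    norm_sub_ofReal_sq, norm_one_sub_sq, RCLike.norm_conj, Complex.conj_re]
  field_simp
  rw [hdeq]
  ring

/-- Both sides are conditional variances given `U₂G`, of `Y₂G` and of `X₂G + D`; these variables
differ by `U₂G`. -/
lemma genieVar_eq (hA : 0 < c.crossPower) (h : ‖κ.ρW2‖ ≤ 1) (hd : 0 < varZ2W2 κ) :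
    c.P2 + ‖c.h21‖ ^ 2 * c.P1 + 1
        - ‖(‖c.h21‖ : ℂ) ^ 2 * c.P1 + κ.ρW2 * κ.σW2‖ ^ 2 / (‖c.h21‖ ^ 2 * c.P1 + κ.σW2 ^ 2)
      = genieVar c (varZ2W2 κ) (varVW2 κ) (genieCoeff κ) := by
  rw [genieVar, genieCoeff_var h hd, norm_genieCoeff_sq hd, norm_sub_ofReal_sq, RCLike.norm_conj,
    Complex.conj_re]
  have e : (‖c.h21‖ : ℂ) ^ 2 * c.P1 + κ.ρW2 * κ.σW2
      = κ.ρW2 * κ.σW2 - ((-c.crossPower : ℝ) : ℂ) := by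
    unfold Channel.crossPower; push_cast; ring
  rw [e, norm_sub_ofReal_sq]
  change c.P2 + c.crossPower + 1 - _ / (c.crossPower + _) = _
  have : c.crossPower + κ.σW2 ^ 2 ≠ 0 := by positivity
  field_simp
  rw [varZ2W2_eq h]
  ring

/-- The same comparison for `h₁₂Y₂G + Z̃₁` and `h₁₂(X₂G + D) + Z̃₁`, which differ by `h₁₂U₂G`. -/
lemma genieVarY_eq (hA : 0 < c.crossPower) (h : ‖κ.ρW2‖ ≤ 1) (hd : 0 < varZ2W2 κ) :
    ‖c.h12‖ ^ 2 * c.P2 + 1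
        - ‖c.h12 * κ.ρW2 * κ.σW2 - c.h12 * (κ.σW2 : ℂ) ^ 2‖ ^ 2 /
          (‖c.h21‖ ^ 2 * c.P1 + κ.σW2 ^ 2)
      = genieVarY c (varZ2W2 κ) (varVW2 κ) (genieCoeff κ) := by
  rw [genieVarY, genieVar, genieCoeff_var h hd, norm_genieCoeff_sq hd, norm_sub_ofReal_sq,
    RCLike.norm_conj, Complex.conj_re]
  have e : c.h12 * κ.ρW2 * κ.σW2 - c.h12 * (κ.σW2 : ℂ) ^ 2
      = c.h12 * (κ.ρW2 * κ.σW2 - ((κ.σW2 ^ 2 : ℝ) : ℂ)) := by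
    push_cast; ring
  rw [e, norm_mul, mul_pow, norm_sub_ofReal_sq]
  change _ - _ / (c.crossPower + _) = _
  have : c.crossPower + κ.σW2 ^ 2 ≠ 0 := by positivity
  field_simp
  ring

lemma genieVar_pos (hP2 : 0 < c.P2) (hA : 0 < c.crossPower) {d ν : ℝ} {γ : ℂ} (hd : 0 < d)
    (hν : 0 ≤ ν) : 0 < genieVar c d ν γ := by
  unfold genieVar
  have h1 : ‖γ‖ ^ 2 * d / (c.crossPower + (‖γ‖ ^ 2 * d + ν)) ≤ 1 := by
    have : 0 ≤ ‖γ‖ ^ 2 * d := by positivity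
    rw [div_le_one (by positivity)]; linarith
  nlinarith

lemma genieVarY_pos (hP2 : 0 < c.P2) (hA : 0 < c.crossPower) {d ν : ℝ} {γ : ℂ} (hd : 0 < d)
    (hν : 0 ≤ ν) (h12 : ‖c.h12‖ ^ 2 * d ≤ 1) : 0 < genieVarY c d ν γ := by
  have h := genieVar_pos (γ := γ) hP2 hA hd hν
  unfold genieVarY
  rcases eq_or_ne c.h12 0 with h0 | h0
  · simp [h0]
  · have : 0 < ‖c.h12‖ := norm_pos_iff.2 h0
    have : 0 < ‖c.h12‖ ^ 2 * genieVar c d ν γ := by positivity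
    linarith

lemma condDiffEntropy_Y2G_U2G (hP1 : 0 < c.P1) (hP2 : 0 < c.P2) (h21 : c.h21 ≠ 0)
    (h : ‖κ.ρW2‖ ≤ 1) (hd : 0 < varZ2W2 κ) (hν : 0 ≤ varVW2 κ) :
    condDiffEntropy prob (Y2G c) (U2G c κ) = Real.logb 2 (Real.pi * Real.exp 1 *
      genieVar c (varZ2W2 κ) (varVW2 κ) (genieCoeff κ)) := by
  have hA := Channel.crossPower_pos hP1 h21
  have hpos := genieVar_pos (γ := genieCoeff κ) hP2 hA hd hν
  rw [← genieVar_eq hA h hd, ← ip_Y2G_U2G hP1, ← nsq_Y2G hP1 hP2, ← nsq_U2G hP1 h] at hpos ⊢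
  rw [Y2G_eq, U2G_eq, prob_eq, condDiffEntropy_lin _ hpos]
  rw [nsq_U2G hP1 h]
  change 0 < c.crossPower + _
  positivity

lemma condDiffEntropy_Y2G_add_Zt1_U2G (hP1 : 0 < c.P1) (hP2 : 0 < c.P2) (h21 : c.h21 ≠ 0)
    (h : ‖κ.ρW2‖ ≤ 1) (hd : 0 < varZ2W2 κ) (hν : 0 ≤ varVW2 κ)
    (h12 : ‖c.h12‖ ^ 2 * varZ2W2 κ ≤ 1) :
    condDiffEntropy prob (fun ω => c.h12 * Y2G c ω + Zt1 c κ ω) (U2G c κ)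
      = Real.logb 2 (Real.pi * Real.exp 1 *
        genieVarY c (varZ2W2 κ) (varVW2 κ) (genieCoeff κ)) := by
  have hA := Channel.crossPower_pos hP1 h21
  have hpos := genieVarY_pos (γ := genieCoeff κ) hP2 hA hd hν h12
  have e : nsq ![c.h12 * (c.h21 * (√c.P1 : ℝ)), c.h12 * (√c.P2 : ℝ),
        ((√(1 - ‖c.h12‖ ^ 2 * varZ2W2 κ) : ℝ) : ℂ), 0, c.h12, 0, 0, 0]
      - ‖c.h12 * ((‖c.h21‖ : ℂ) ^ 2 * c.P1 + κ.ρW2 * κ.σW2)‖ ^ 2 /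
          (‖c.h21‖ ^ 2 * c.P1 + κ.σW2 ^ 2)
      = genieVarY c (varZ2W2 κ) (varVW2 κ) (genieCoeff κ) := by
    rw [genieVarY, ← genieVar_eq hA h hd, nsq_vec8]
    simp only [norm_mul, mul_pow, norm_sqrt_sq hP1.le, norm_sqrt_sq hP2.le,
      norm_sqrt_sq (sub_nonneg.2 h12), norm_zero]
    ring
  rw [← ip_Y2G_add_Zt1_U2G hP1, ← nsq_U2G hP1 h] at e
  rw [← e] at hpos ⊢
  rw [Y2G_add_Zt1_eq, U2G_eq, prob_eq, condDiffEntropy_lin _ hpos]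
  rw [nsq_U2G hP1 h]
  change 0 < c.crossPower + _
  positivity

/-- The first logarithm of the closed form vanishes. -/
lemma log_S1G_ratio (hA : 0 < c.crossPower) (h21 : c.h21 ≠ 0) (hσ : 0 < κ.σN1)
    (hρ : κ.ρN1 = c.h21⁻¹ * κ.σN1) (hv : varVN1 κ = 1 - ‖κ.ρN1‖ ^ 2) :
    Real.logb 2
        ((c.P1 + ‖c.h12‖ ^ 2 * c.P2 + 1
            - ‖conj c.h21 * c.P1 + κ.ρN1 * κ.σN1‖ ^ 2 / (‖c.h21‖ ^ 2 * c.P1 + κ.σN1 ^ 2)) /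
          (‖c.h12‖ ^ 2 * c.P2 + varVN1 κ
            - ‖κ.ρN1 * κ.σN1 - c.h21⁻¹ * (κ.σN1 : ℂ) ^ 2‖ ^ 2 /
                (‖c.h21‖ ^ 2 * c.P1 + κ.σN1 ^ 2))) = 0 := by
  have hn : 0 < ‖c.h21‖ := norm_pos_iff.2 h21
  have e1 : conj c.h21 * c.P1 + κ.ρN1 * κ.σN1
      = c.h21⁻¹ * ((‖c.h21‖ ^ 2 * c.P1 + κ.σN1 ^ 2 : ℝ) : ℂ) := by
    have := Complex.mul_conj' c.h21
    rw [hρ]; push_cast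
    rw [← this]
    field_simp
  have e2 : κ.ρN1 * κ.σN1 - c.h21⁻¹ * (κ.σN1 : ℂ) ^ 2 = 0 := by rw [hρ]; ring
  have hS : 0 < ‖c.h21‖ ^ 2 * c.P1 + κ.σN1 ^ 2 := by
    change 0 < c.crossPower + _
    positivity
  have e3 : ‖κ.ρN1‖ ^ 2 = κ.σN1 ^ 2 / ‖c.h21‖ ^ 2 := by
    rw [hρ, norm_mul, norm_inv, Complex.norm_real, Real.norm_of_nonneg hσ.le]
    field_simp
  have e4 : c.P1 + ‖c.h12‖ ^ 2 * c.P2 + 1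
            - ‖conj c.h21 * c.P1 + κ.ρN1 * κ.σN1‖ ^ 2 / (‖c.h21‖ ^ 2 * c.P1 + κ.σN1 ^ 2)
      = ‖c.h12‖ ^ 2 * c.P2 + varVN1 κ
            - ‖κ.ρN1 * κ.σN1 - c.h21⁻¹ * (κ.σN1 : ℂ) ^ 2‖ ^ 2 /
                (‖c.h21‖ ^ 2 * c.P1 + κ.σN1 ^ 2) := by
    rw [e1, e2, hv, e3, norm_mul, norm_inv, Complex.norm_real, Real.norm_of_nonneg hS.le]
    have := hS.ne'
    rw [norm_zero]
    field_simp
    ring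
  rw [e4]
  -- Numerator and denominator coincide. If both vanish, the conventions `0 / 0 = 0` and `logb 2 0 =
  -- 0` still give zero.
  rcases eq_or_ne (‖c.h12‖ ^ 2 * c.P2 + varVN1 κ
            - ‖κ.ρN1 * κ.σN1 - c.h21⁻¹ * (κ.σN1 : ℂ) ^ 2‖ ^ 2 /
                (‖c.h21‖ ^ 2 * c.P1 + κ.σN1 ^ 2)) 0 with h0 | h0
  · rw [h0]; simp
  · rw [div_self h0]; simp

lemma varVW2_nonneg (h : Admissible c κ) : 0 ≤ varVW2 κ :=
  le_trans (le_min (sq_nonneg _) (sq_nonneg _)) h.2.1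

/-- The forced value of `ρ_{N₁}` removes the first pair of entropies and the first logarithm; the
rest are Gaussian entropies whose factors `πe` cancel in pairs. The last identity converts from bits
to nats and undoes the factor one half, matching the quantity bounded by `achievable_le`. -/
theorem hybridBound_eq (hP1 : 0 < c.P1) (hP2 : 0 < c.P2) (h : Admissible c κ)
    (h' : Nondegenerate c κ) : R0 c κ = R0Explicit c κ ∧ hybridBound c κ = hybridBoundExplicit c κ
      ∧ 2 * hybridBoundExplicit c κ * Real.log 2
        = natBound c κ.σN1 (varZ2W2 κ) (varVW2 κ) (genieCoeff κ) := by
  have hν := varVW2_nonneg h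
  obtain ⟨⟨-, -, -, -, hN, -, -, hW⟩, -, hle, h12⟩ := h
  obtain ⟨h21, hσ, hd, -⟩ := h'
  have hA := Channel.crossPower_pos hP1 h21
  have hρ := rho_eq hN hσ hle
  have hv := varVN1_eq hN hσ
  have hveq : varZ1N1 c κ = varVN1 κ := by rw [varZ1N1_eq hN, hv, ← hρ]; simp
  have hR0 := R0_eq hP1 hP2 h21 hN hσ hW hd hν
  have g1 := genieVar_pos (γ := genieCoeff κ) hP2 hA hd hν
  have g2 := genieVarY_pos (γ := genieCoeff κ) hP2 hA hd hν h12
  refine ⟨hR0, ?_, ?_⟩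
  · rw [hybridBound, hybridBoundExplicit, log_S1G_ratio hA h21 hσ hρ hv, genieVar_eq hA hW hd,
      genieVarY_eq hA hW hd, condDiffEntropy_Y2G_U2G hP1 hP2 h21 hW hd hν,
      condDiffEntropy_Y2G_add_Zt1_U2G hP1 hP2 h21 hW hd hν h12, hR0, ← logb_pi_mul_sub g1 g2]
    simp only [VtN1_eq_zero hveq, add_zero]
    ring
  · have hlog : Real.log 2 ≠ 0 := (Real.log_pos one_lt_two).ne'
    have hlb : ∀ x, Real.logb 2 x * Real.log 2 = Real.log x := fun x => by
      rw [Real.logb, div_mul_cancel₀ _ hlog]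
    have hσ2 : 0 < κ.σN1 ^ 2 := by positivity
    have hB : 0 < c.P1 + ‖c.h12‖ ^ 2 * c.P2 + 1 := by positivity
    have hC : 0 < c.P2 + c.crossPower + 1 := by positivity
    rw [hybridBoundExplicit, log_S1G_ratio hA h21 hσ hρ hv, genieVar_eq hA hW hd,
      genieVarY_eq hA hW hd, R0Explicit, ← varZ2W2_eq hW]
    change 2 * (1 / 2 * (0 + Real.logb 2 _ + (Real.logb 2 ((c.crossPower + _) / (c.crossPower + _))
      + Real.logb 2 ((c.crossPower + _) / (c.crossPower + _)) + Real.logb 2 (_ / _)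
      + Real.logb 2 ((_ + c.crossPower + _) / _)))) * _ = _
    rw [natBound, genieCoeff_var hW hd]
    simp only [mul_add, add_mul, ← mul_assoc]
    norm_num [hlb]
    rw [Real.log_div (by positivity) (by positivity), Real.log_div (by positivity) (by positivity),
      Real.log_div (by positivity) (by positivity), Real.log_div (by positivity) (by positivity),
      Real.log_div (by positivity) (by positivity), Real.log_div (by positivity) (by positivity),
      Real.log_mul (by positivity) (by positivity), Real.log_pow]
    push_cast
    ring

theorem sum_le_hybridBound (hP1 : 0 < c.P1) (hP2 : 0 < c.P2)
    (h : Admissible c κ) (h' : Nondegenerate c κ) {R : ℝ × ℝ} (hR : c.Achievable R) :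
    R.1 + R.2 ≤ hybridBound c κ := by
  obtain ⟨-, e1, e2⟩ := hybridBound_eq hP1 hP2 h h'
  have hν := varVW2_nonneg h
  obtain ⟨⟨⟨-, hσ1⟩, -, -, ⟨hs0, hs1⟩, hN, -, -, hW⟩, hmin, hle, h12⟩ := h
  obtain ⟨h21, hσ, hd, -⟩ := h'
  have hlog : 0 < Real.log 2 := Real.log_pos one_lt_two
  have hρ := rho_eq hN hσ hle
  have hn : 0 < ‖c.h21‖ := norm_pos_iff.2 h21
  -- The correlation coefficient equals `h₂₁⁻¹σ_{N₁}` and has modulus at most one.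
  have hσh : κ.σN1 ≤ ‖c.h21‖ := by
    rw [hρ, norm_mul, norm_inv, Complex.norm_real, Real.norm_of_nonneg hσ.le,
      inv_mul_le_one₀ hn] at hN
    exact hN
  have hσ2 : κ.σN1 ^ 2 ≤ 1 := by nlinarith
  have hs2 : κ.σW2 ^ 2 ≤ 1 := by nlinarith
  suffices hb : 2 * (R.1 + R.2) * Real.log 2
      ≤ natBound c κ.σN1 (varZ2W2 κ) (varVW2 κ) (genieCoeff κ) by
    rw [← e2, ← e1] at hb
    have := le_of_mul_le_mul_right hb hlog
    linarith
  have hvar := genieCoeff_var hW hd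
  rcases hν.lt_or_eq with hpos | h0
  · refine achievable_le hP1 hP2 ⟨hσ, hσ2, hσh, hd, hpos, norm_one_add_genieCoeff_sq hW hd, h12,
      hvar.trans_le hs2, ?_⟩ hR
    rwa [hvar]
  -- When `ν = 0` the hypothesis on the minimum and `σ_{N₁} > 0` leave only `W₂ = 0`. Then `D = Z₂`
  -- and `γ = 0`, which is the limiting case already treated.
  · have hs : κ.σW2 = 0 := by
      rw [← h0] at hmin
      rcases min_le_iff.1 hmin with h1 | h1
      · nlinarith
      · exact pow_eq_zero_iff two_ne_zero |>.1 (le_antisymm h1 (sq_nonneg _))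
    have hd1 : varZ2W2 κ = 1 := by rw [varZ2W2_eq hW, hs]; simp
    have hγ : genieCoeff κ = 0 := by rw [genieCoeff, hs]; simp
    rw [hd1, ← h0, hγ]
    exact achievable_le_of_noiseless hP1 hP2 hσ hσ2 hσh (by rwa [hd1, mul_one] at h12) hR

end HybridBound

end GIC

end

theorem mainTheorem9 (c : GIC.Channel) (hP1 : 0 < c.P1) (hP2 : 0 < c.P2)
    (hweak : c.WeakInterference) (κ : GIC.Params) :
    (GIC.Admissible c κ → GIC.Nondegenerate c κ →
      (∀ R ∈ c.capacityRegion, R.1 + R.2 ≤ GIC.hybridBound c κ) ∧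
      GIC.hybridBound c κ = GIC.hybridBoundExplicit c κ ∧
      GIC.R0 c κ = GIC.R0Explicit c κ) ∧
    (GIC.Admissible c.swap κ.swap → GIC.Nondegenerate c.swap κ.swap →
      (∀ R ∈ c.capacityRegion, R.1 + R.2 ≤ GIC.hybridBound c.swap κ.swap) ∧
      GIC.hybridBound c.swap κ.swap = GIC.hybridBoundExplicit c.swap κ.swap ∧
      GIC.R0 c.swap κ.swap = GIC.R0Explicit c.swap κ.swap) := by
  constructor
  · intro h h'
    obtain ⟨e1, e2, -⟩ := GIC.hybridBound_eq hP1 hP2 h h'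
    exact ⟨GIC.capacityRegion_le fun R hR => GIC.sum_le_hybridBound hP1 hP2 h h' hR, e2, e1⟩
  · intro h h'
    obtain ⟨e1, e2, -⟩ := GIC.hybridBound_eq (c := c.swap) hP2 hP1 h h'
    refine ⟨GIC.capacityRegion_le fun R hR => ?_, e2, e1⟩
    -- Relabelling the users of the codes makes the swapped pair achievable for the swapped channel,
    -- and the sum of the rates is symmetric.
    have := GIC.sum_le_hybridBound (c := c.swap) hP2 hP1 h h' hR.swap
    simpa [add_comm] using this
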